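/- **Setting.** Fix numbers $a,b\ge 0$ of qubits, $\mathcal H^A=(\mathbb C^2)^{\otimes a}$, $\mathcal H^B=(\mathbb C^2)^{\otimes b}$. A linear map $\Lambda$ from operators on $\mathcal H^A$ to operators on $\mathcal H^B$ is a *postselective channel* if it is completely positive, satisfies $0\le \mathrm{Tr}\,\Lambda(\rho)\le \mathrm{Tr}\,\rho$ for all positive semidefinite $\rho$, and $\mathrm{Tr}\,\Lambda(|\psi\rangle\langle\psi|)=1$ for some unit vector $\psi$. With $|\mathrm{Bell}_A\rangle = 2^{-a/2}\sum_i |i\rangle\otimes|i\rangle$, its Choi state is $\phi_\Lambda=(\Lambda\otimes I)(|\mathrm{Bell}_A\rangle\langle\mathrm{Bell}_A|)$ and its normalized Choi state is $\bar\phi_\Lambda=\phi_\Lambda/\mathrm{Tr}(\phi_\Lambda)$. An $n$-qubit stabilizer state is a unit vector fixed by $n$ independent signed Pauli operators (its *tableau*). The robustness of magic is $\mathcal R(\rho)=\min\{\sum_i|q_i| : \rho=\sum_i q_i|\phi_i\rangle\langle\phi_i|,\ \sum_i q_i=1,\ q_i \in\mathbb R\}$, the $|\phi_i\rangle$ being the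 stabilizer states. For a possibly sub-normalized $\rho$ let $\mathcal R_\perp(\rho)$ be the same minimum where, besides the stabilizer states, the outcome "abort", represented by the operator $0$, may be used in the decomposition. When $\Lambda$ acts on $a$ selected qubits of an $n$-qubit state $\rho$, the resulting operator $\tilde\Lambda(\rho)$ lives on the $b$ output qubits and the $n-a$ other qubits. The *cost* of $\Lambda$ in stabilizer propagation is $\mathcal C(\Lambda)=\sup \mathcal R_\perp(\tilde\Lambda(|\psi\rangle\langle\psi|))$ over all $n$, all $n$-qubit stabilizer states $\psi$ and all choices of $a$ distinct qubits of them. The number of samples for additive error $\varepsilon$ with probability $1-\delta$ is $\frac1{2\varepsilon^2}\ln\frac2\delta\,(2M\prod_j c_j)^2$, where the $c_j$ are the costs of the circuit components and $M$ bounds the inner products of the observable with stabilizer states; $\Lambda$ *does not increase the number of samples* if inserting the factor $\mathcal C(\Lambda)$ never makes this number larger. **Theorem.** For every postselective channel $\Lambda$ the following are equivalent. 1. $\mathcal R(\bar\phi_\Lambda)=1$. 2. $\bar\phi_\Lambda$ is a stabilizer mixture, i.e. a convex combination of pure stabilizer states $|\phi_i\rangle\langle\phi_i|$. 3. $\Lambda$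 does not increase the number of samples required for stabilizer propagation. 4. $\Lambda$ can be simulated efficiently on part of any stabilizer state: there are a randomized program and a polynomial $P$, depending only on $\Lambda$, such that for every $n$, every tableau of an $n$-qubit stabilizer state $\psi$ and every choice of $a$ distinct qubits, the program always stops within $P(n)$ steps and outputs either a tableau of a stabilizer state of the $b$ output qubits and the $n-a$ other qubits, or "abort", and the mean of its output (the density matrix of the output state, or $0$ for "abort") is $\tilde\Lambda(|\psi\rangle\langle\psi|)$. In 4, programs run on a unit-cost random access machine on natural numbers with addition and truncated subtraction (without multiplication), with bounded loops; they may toss coins with finitely many biases, which are real constants of the program. -/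

import Mathlib

open scoped NNReal ENNReal Matrix ComplexOrder

noncomputable section

namespace StabProp

/-! ### Qubit registers, Pauli operators and stabilizer states -/

/-- Operators on the Hilbert space of a qubit register whose qubits are labelled by `Q`;
the computational basis is `Q → Fin 2`. -/
abbrev Op (Q : Type) : Type := Matrix (Q → Fin 2) (Q → Fin 2) ℂ

/-- The single-qubit Pauli matrices: `I`, `σ_Z`, `σ_X`, `σ_Y` for
`(x, z) = (0, 0), (0, 1), (1, 0), (1, 1)`. -/
def pauli (x z : ZMod 2) : Matrix (Fin 2) (Fin 2) ℂ :=
  if x = 0 then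
    if z = 0 then !![1, 0; 0, 1] else !![1, 0; 0, -1]
  else
    if z = 0 then !![0, 1; 1, 0] else !![0, -Complex.I; Complex.I, 0]

/-- The tensor product of the Pauli matrices `pauli (x q) (z q)` over the qubits `q`. -/
def pauliOp {Q : Type} [Fintype Q] (x z : Q → ZMod 2) : Op Q :=
  Matrix.of fun r c => ∏ q, pauli (x q) (z q) (r q) (c q)

/-- A tableau: a list of `k` signed Pauli operators, given by bits. -/
structure Tableau (k : ℕ) (Q : Type) where
  x : Fin k → Q → ZMod 2
  z : Fin k → Q → ZMod 2
  sign : Fin k → ZMod 2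

/-- The `i`-th generator `± σ_1 ⊗ ⋯ ⊗ σ_n`. -/
def Tableau.generator {k : ℕ} {Q : Type} [Fintype Q] (T : Tableau k Q) (i : Fin k) : Op Q :=
  (-1 : ℂ) ^ (T.sign i).val • pauliOp (T.x i) (T.z i)

/-- The projector onto a vector. -/
def proj {α : Type} (ψ : α → ℂ) : Matrix α α ℂ := Matrix.vecMulVec ψ (star ψ)

/-- `T` describes the stabilizer state `ψ`: `T` lists as many generators as there are qubits, they
are independent (modulo signs), and the unit vector `ψ` is fixed by all of them. The generators
then commute, since otherwise they would have no common fixed vector, and `ψ` is determined up to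
a phase. -/
structure Tableau.Describes {k : ℕ} {Q : Type} [Fintype Q] [DecidableEq Q]
    (T : Tableau k Q) (ψ : (Q → Fin 2) → ℂ) : Prop where
  card_eq : k = Fintype.card Q
  independent : LinearIndependent (ZMod 2) fun i => (T.x i, T.z i)
  unit : star ψ ⬝ᵥ ψ = 1
  fixed : ∀ i, T.generator i *ᵥ ψ = ψ

/-- The density matrices `|φ⟩⟨φ|` of the pure stabilizer states of the register `Q`. -/
def stabStates (Q : Type) [Fintype Q] [DecidableEq Q] : Set (Op Q) :=
  {ρ | ∃ (T : Tableau (Fintype.card Q) Q) (φ : (Q → Fin 2) → ℂ), T.Describes φ ∧ ρ = proj φ}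

/-- Probabilistic mixtures of stabilizer states. -/
def IsStabilizerMixture {Q : Type} [Fintype Q] [DecidableEq Q] (ρ : Op Q) : Prop :=
  ρ ∈ convexHull ℝ (stabStates Q)

/-- The least `∑ |q_i|` over real vectors `q` with `ρ = ∑ q_i φ_i`, `∑ q_i = 1`, `φ_i ∈ S`
(it is `∞` if there is no such `q`). -/
def quasiCost {Q : Type} (S : Set (Op Q)) (ρ : Op Q) : ℝ≥0∞ :=
  ⨅ (q : S →₀ ℝ)
    (_ : (q.sum fun φ c => (c : ℂ) • (φ : Op Q)) = ρ ∧ (q.sum fun _ c => c) = 1),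
    ENNReal.ofReal (q.sum fun _ c => |c|)

/-- The robustness of magic. -/
def robustness {Q : Type} [Fintype Q] [DecidableEq Q] (ρ : Op Q) : ℝ≥0∞ :=
  quasiCost (stabStates Q) ρ

/-- The cost of a possibly sub-normalized state in stabilizer propagation with abort: the
decompositions may also use the outcome "abort", which is represented by the operator `0`. For
states of trace one this is the robustness of magic. -/
def robustnessAbort {Q : Type} [Fintype Q] [DecidableEq Q] (ρ : Op Q) : ℝ≥0∞ :=
  quasiCost (insert 0 (stabStates Q)) ρ

/-! ### Channels -/

/-- `Λ ⊗ id` on operators of the system with a reference system attached on the right. -/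
def ampliate {α β : Type} (Λ : Matrix α α ℂ →ₗ[ℂ] Matrix β β ℂ) {κ : Type}
    (M : Matrix (α × κ) (α × κ) ℂ) : Matrix (β × κ) (β × κ) ℂ :=
  Matrix.of fun p q => Λ (Matrix.of fun u v => M (u, p.2) (v, q.2)) p.1 q.1

def IsCompletelyPositive {α β : Type} (Λ : Matrix α α ℂ →ₗ[ℂ] Matrix β β ℂ) : Prop :=
  ∀ (k : ℕ) (M : Matrix (α × Fin k) (α × Fin k) ℂ), M.PosSemidef → (ampliate Λ M).PosSemidef

/-- Postselective quantum channels. -/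
structure IsPostselective {α β : Type} [Fintype α] [Fintype β]
    (Λ : Matrix α α ℂ →ₗ[ℂ] Matrix β β ℂ) : Prop where
  completelyPositive : IsCompletelyPositive Λ
  traceNonincreasing : ∀ ρ : Matrix α α ℂ, ρ.PosSemidef →
    0 ≤ (Λ ρ).trace.re ∧ (Λ ρ).trace.re ≤ ρ.trace.re
  satisfiable : ∃ ψ : α → ℂ, star ψ ⬝ᵥ ψ = 1 ∧ (Λ (proj ψ)).trace = 1

/-- The Bell state `(dim)^(-1/2) ∑ |i⟩ ⊗ |i⟩`. -/
def bell (α : Type) [Fintype α] [DecidableEq α] : α × α → ℂ :=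
  fun p => if p.1 = p.2 then ((1 / Real.sqrt (Fintype.card α) : ℝ) : ℂ) else 0

/-- The un-normalized Choi state, on the register consisting of the output qubits `B` and the
reference qubits `A`. -/
def choi {A B : Type} [Fintype A] [DecidableEq A] (Λ : Op A →ₗ[ℂ] Op B) : Op (B ⊕ A) :=
  Matrix.reindex (Equiv.sumArrowEquivProdArrow B A (Fin 2)).symm
    (Equiv.sumArrowEquivProdArrow B A (Fin 2)).symm (ampliate Λ (proj (bell (A → Fin 2))))

/-- The normalized Choi state. -/
def normalizedChoi {A B : Type} [Fintype A] [DecidableEq A] [Fintype B] [DecidableEq B]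
    (Λ : Op A →ₗ[ℂ] Op B) : Op (B ⊕ A) :=
  (choi Λ).trace⁻¹ • choi Λ

/-- The qubits of `Q` outside the subset selected by `s`. -/
abbrev Rest {A Q : Type} (s : A ↪ Q) : Type := {q : Q // ∀ i, s i ≠ q}

/-- The register `Q` consists of the selected qubits and the remaining ones. -/
def partEquiv {A Q : Type} (s : A ↪ Q) : A ⊕ Rest s ≃ Q :=
  Equiv.ofBijective (Sum.elim s Subtype.val) <| by
    constructor
    · rintro (i | i) (j | j) h
      · exact congrArg Sum.inl (s.injective h)
      · exact absurd h (j.2 i)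
      · exact absurd h.symm (i.2 j)
      · exact congrArg Sum.inr (Subtype.ext h)
    · intro q
      by_cases h : ∃ i, s i = q
      · exact ⟨Sum.inl h.choose, h.choose_spec⟩
      · exact ⟨Sum.inr ⟨q, not_exists.mp h⟩, rfl⟩

/-- Basis states of `Q` as pairs of basis states of the two parts. -/
def splitBasis {A Q : Type} (s : A ↪ Q) :
    (Q → Fin 2) ≃ (A → Fin 2) × (Rest s → Fin 2) :=
  (Equiv.arrowCongr (partEquiv s).symm (Equiv.refl (Fin 2))).trans
    (Equiv.sumArrowEquivProdArrow A (Rest s) (Fin 2))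

/-- `Λ` applied to the qubits selected by `s`: they are replaced by the output qubits `B`. -/
def applyAt {A B Q : Type} (Λ : Op A →ₗ[ℂ] Op B) (s : A ↪ Q) (ρ : Op Q) : Op (B ⊕ Rest s) :=
  Matrix.reindex (Equiv.sumArrowEquivProdArrow B (Rest s) (Fin 2)).symm
    (Equiv.sumArrowEquivProdArrow B (Rest s) (Fin 2)).symm
    (ampliate Λ (Matrix.reindex (splitBasis s) (splitBasis s) ρ))

/-! ### The number of samples in stabilizer propagation -/

/-- The cost of a channel: the largest factor by which the weight of a sample can grow when the
channel is applied to some of the qubits of a stabilizer state. -/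
def channelCost {a b : ℕ} (Λ : Op (Fin a) →ₗ[ℂ] Op (Fin b)) : ℝ≥0∞ :=
  ⨆ (n : ℕ) (s : Fin a ↪ Fin n) (ρ ∈ stabStates (Fin n)), robustnessAbort (applyAt Λ s ρ)

/-- The number of samples `(1 / (2 ε²)) · ln (2 / δ) · range²` required by Hoeffding's inequality
for additive error `ε` with probability `1 - δ`; the range is twice the product of the costs of
the circuit components times a bound `M` for the inner products of the final observable with
stabilizer states. -/
def requiredSamples (ε δ M : ℝ) (costs : List ℝ≥0∞) : ℝ≥0∞ :=
  ENNReal.ofReal (1 / (2 * ε ^ 2) * Real.log (2 / δ)) * (2 * costs.prod * ENNReal.ofReal M) ^ 2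

/-- Inserting `Λ` anywhere into a circuit does not increase the number of samples required. -/
def DoesNotIncreaseSamples {a b : ℕ} (Λ : Op (Fin a) →ₗ[ℂ] Op (Fin b)) : Prop :=
  ∀ ε δ M : ℝ, 0 < ε → 0 < δ → δ < 1 → 0 < M → ∀ before after : List ℝ≥0∞,
    requiredSamples ε δ M (before ++ channelCost Λ :: after) ≤
      requiredSamples ε δ M (before ++ after)

/-! ### Randomized programs with a step count

A random access machine on natural numbers with addition and truncated subtraction, without
multiplication, so that unit-cost time is polynomially related to the time of a Turing machine.
Loops are bounded: the number of rounds is fixed on entry. Every function that is computable in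
polynomial time is computed in polynomial time by such a program (run the machine for a
precomputed number of steps), so this is no restriction. A program may toss coins; the finitely
many biases are real constants of the program. -/

/-- The memory: two-dimensional arrays of natural numbers; `m x i j` is the entry `(i, j)` of the
array `x`. -/
abbrev Memory : Type := ℕ → ℕ → ℕ → ℕ

def Memory.set (m : Memory) (x i j v : ℕ) : Memory :=
  fun x' i' j' => if x' = x ∧ i' = i ∧ j' = j then v else m x' i' j'

inductive Expr : Type where
  | const (k : ℕ)
  | cell (x : ℕ) (i j : Expr)
  | add (e f : Expr)
  | sub (e f : Expr)

def Expr.eval (m : Memory) : Expr → ℕ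
  | .const k => k
  | .cell x i j => m x (i.eval m) (j.eval m)
  | .add e f => e.eval m + f.eval m
  | .sub e f => e.eval m - f.eval m

/-- The number of steps for evaluating an expression. -/
def Expr.cost : Expr → ℕ
  | .const _ => 1
  | .cell _ i j => i.cost + j.cost + 1
  | .add e f => e.cost + f.cost + 1
  | .sub e f => e.cost + f.cost + 1

/-- Programs: `assign x i j e` is `x[i, j] := e`, `ite e p q` runs `p` if `e ≠ 0` and `q` otherwise,
`loop x e p` runs `p` for `x[0, 0] = 0, 1, …, e - 1`, where `e` is evaluated once, on entry, and
`flip c p q` runs `p` with probability `c` and `q` with probability `1 - c`. -/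
inductive Prog : Type where
  | skip
  | assign (x : ℕ) (i j e : Expr)
  | seq (p q : Prog)
  | ite (e : Expr) (p q : Prog)
  | loop (x : ℕ) (e : Expr) (p : Prog)
  | flip (c : ℝ≥0) (hc : c ≤ 1) (p q : Prog)

/-- A coin that shows `true` with probability `c`. -/
def coin (c : ℝ≥0) (hc : c ≤ 1) : PMF Bool :=
  PMF.ofFintype (fun y => if y then (c : ℝ≥0∞) else 1 - c) <| by
    simpa using add_tsub_cancel_of_le (ENNReal.coe_le_one_iff.mpr hc)

/-- Add `t` to the number of steps taken. -/
def charge (t : ℕ) (o : Memory × ℕ) : Memory × ℕ := (o.1, o.2 + t)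

/-- Run `body` for `x[0, 0] = 0, 1, …, k - 1`, with one step per round for the loop itself. -/
def runLoop (body : Memory → PMF (Memory × ℕ)) (x : ℕ) : ℕ → Memory → PMF (Memory × ℕ)
  | 0, m => PMF.pure (m, 0)
  | k + 1, m => (runLoop body x k m).bind fun o =>
      (body (o.1.set x 0 0 k)).map (charge (o.2 + 1))

/-- The joint distribution of the final memory and of the number of steps. -/
def Prog.exec : Prog → Memory → PMF (Memory × ℕ)
  | .skip, m => PMF.pure (m, 1)
  | .assign x i j e, m =>
      PMF.pure (m.set x (i.eval m) (j.eval m) (e.eval m), i.cost + j.cost + e.cost + 1)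
  | .seq p q, m => (p.exec m).bind fun o => (q.exec o.1).map (charge o.2)
  | .ite e p q, m =>
      (if e.eval m ≠ 0 then p.exec m else q.exec m).map (charge (e.cost + 1))
  | .loop x e p, m => (runLoop p.exec x (e.eval m) m).map (charge (e.cost + 1))
  | .flip c hc p q, m =>
      ((coin c hc).bind fun y => if y then p.exec m else q.exec m).map (charge 1)

/-! ### Efficient simulation -/

/-- The memory holds the tableau `T`: its bits are in the arrays `0` (`x`), `1` (`z`) and, as a
column, `2` (signs); the qubit `q` is stored in the column `label q`. -/
def Memory.Holds (m : Memory) {k : ℕ} {Q : Type} (label : Q → ℕ) (T : Tableau k Q) : Prop :=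
  (∀ (i : Fin k) q, m 0 i (label q) = (T.x i q).val) ∧
  (∀ (i : Fin k) q, m 1 i (label q) = (T.z i q).val) ∧
  ∀ i : Fin k, m 2 i 0 = (T.sign i).val

/-- The input: a tableau of `n` generators on `n` qubits in the arrays `0`, `1`, `2`, the list of
selected qubits in the array `3`, the number `n` in `4[0, 0]`, and `0` in all other cells. -/
def inputMemory {a n : ℕ} (T : Tableau n (Fin n)) (s : Fin a ↪ Fin n) : Memory := fun x i j =>
  if x = 0 then (if h : i < n ∧ j < n then (T.x ⟨i, h.1⟩ ⟨j, h.2⟩).val else 0)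
  else if x = 1 then (if h : i < n ∧ j < n then (T.z ⟨i, h.1⟩ ⟨j, h.2⟩).val else 0)
  else if x = 2 then (if h : i < n ∧ j = 0 then (T.sign ⟨i, h.1⟩).val else 0)
  else if x = 3 then (if h : i < a ∧ j = 0 then (s ⟨i, h.1⟩ : ℕ) else 0)
  else if x = 4 then (if i = 0 ∧ j = 0 then n else 0)
  else 0

/-- The labels of the qubits after the channel: the remaining qubits keep their numbers and the
output qubits of the channel are numbered `n`, `n + 1`, …. -/
def outputLabel {a b n : ℕ} (s : Fin a ↪ Fin n) : Fin b ⊕ Rest s → ℕ :=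
  Sum.elim (fun i => n + i) (fun q => (q.1 : ℕ))

/-- The memory holds an output with value `ρ`: either "abort", signalled by a nonzero `5[0, 0]`,
with value `0`, or a tableau describing a stabilizer state with density matrix `ρ`. -/
def Memory.IsOutput (m : Memory) {a b n : ℕ} (s : Fin a ↪ Fin n) (ρ : Op (Fin b ⊕ Rest s)) :
    Prop :=
  (m 5 0 0 ≠ 0 ∧ ρ = 0) ∨
  (m 5 0 0 = 0 ∧ ∃ (T : Tableau (b + (n - a)) (Fin b ⊕ Rest s))
    (φ : (Fin b ⊕ Rest s → Fin 2) → ℂ),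
    m.Holds (outputLabel s) T ∧ T.Describes φ ∧ ρ = proj φ)

/-- One randomized program, running in time polynomial in the number `n` of qubits, takes any
stabilizer state of `n` qubits and any choice of the qubits on which `Λ` acts, and always outputs
a stabilizer state or "abort", where the mean of the output is the state after `Λ`. -/
def EfficientlySimulable {a b : ℕ} (Λ : Op (Fin a) →ₗ[ℂ] Op (Fin b)) : Prop :=
  ∃ (S : Prog) (P : Polynomial ℕ), ∀ (n : ℕ) (s : Fin a ↪ Fin n) (T : Tableau n (Fin n))
    (ψ : (Fin n → Fin 2) → ℂ), T.Describes ψ →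
    ∃ value : Memory → Op (Fin b ⊕ Rest s),
      (∀ o ∈ (S.exec (inputMemory T s)).support,
        o.2 ≤ P.eval n ∧ o.1.IsOutput s (value o.1)) ∧
      HasSum (fun o : Memory × ℕ => ((S.exec (inputMemory T s) o).toReal : ℂ) • value o.1)
        (applyAt Λ s (proj ψ))

end StabProp

end

set_option linter.unusedSectionVars false

/-! The two statements about Choi states are joined by a separation argument. There are finitely
many stabilizer states (`stabStates_finite`), so their convex hull is compact, and a point outside
it is strictly separated by a real functional; that functional forces every affine decomposition to
have `∑ |q_i|` above 1 by a fixed amount (`mem_of_quasiCost_le_one`). The same argument with the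
operator `0` added shows that `channelCost Λ ≤ 1` means exactly that Λ sends stabilizer states into
the hull of stabilizer states and `0`; and inserting a factor never increases the number of samples
iff it is at most 1.

A simulation yields cost at most 1, because the mean of random stabilizer states and zeros lies in
that hull (`mean_mem_convexHull`). Cost at most 1 yields a mixture: apply Λ to one half of a Bell
state, which is a stabilizer state. The result is the Choi state, a sub-convex combination of
stabilizer states, and division by its trace turns it into a convex one
(`isStabilizerMixture_of_channelCost`).

The substance is the program for a mixture. Write the Choi state as `∑ λ_i |φ_i⟩⟨φ_i|`. On an input
ψ the channel gives `∑ λ_i 2^a |χ_i⟩⟨χ_i|`, where χ_i arises from φ_i ⊗ ψ by contracting the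
reference qubits of φ_i with the selected qubits of ψ against an unnormalized Bell state
(`applyAt_eq_sum`).

The stabilizer group of φ_i ⊗ ψ determines χ_i. A Pauli operator that agrees on the two contracted
copies passes through the contraction (`contr_mulVec`), any other contracts to zero (`contrOp_hz`).
Gaussian elimination over 𝔽₂ sorts the generators into three kinds: pivots for disagreement between
the copies (mark 1), pivots for the action on the output among matched rows (mark 2), and k matched
rows that act trivially on the output (mark 0). A row of the last kind multiplies χ_i by a phase, so
a nontrivial phase forces χ_i = 0 (`contr_eq_zero`). Otherwise the squared norm of χ_i is `2^k /
2^a` (`contr_norm`), and the rows with mark 2, restricted to the output, form a tableau of the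
normalized χ_i (`contr_describes`).

Component i thus has weight `λ_i 2^k`. All weights together sum to the trace of the result, which is
at most 1, so the program runs through the components, accepts each with its weight divided by the
weight still available, and aborts if none is accepted (`tree_sampled`). The exponent k depends on
the input, but a weight of at most 1 bounds it in terms of λ_i, so finitely many coin biases
suffice. -/

noncomputable section

namespace StabProp

/-! ### Pauli operators as tensor products -/

/-- The tensor product of single-qubit matrices. -/
def tens {W : Type} [Fintype W] (M : W → Matrix (Fin 2) (Fin 2) ℂ) : Op W :=
  Matrix.of fun r c => ∏ w, M w (r w) (c w)

section tens

variable {W : Type} [Fintype W] [DecidableEq W]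

theorem tens_mul (M N : W → Matrix (Fin 2) (Fin 2) ℂ) :
    tens M * tens N = tens fun w => M w * N w := by
  ext r c
  simp only [tens, Matrix.mul_apply, Matrix.of_apply, ← Finset.prod_mul_distrib]
  rw [Finset.prod_univ_sum]
  simp

theorem tens_smul (a : W → ℂ) (M : W → Matrix (Fin 2) (Fin 2) ℂ) :
    (tens fun w => a w • M w) = (∏ w, a w) • tens M := by
  ext r c
  simp [tens, Finset.prod_mul_distrib]

theorem tens_one : (tens fun _ : W => (1 : Matrix (Fin 2) (Fin 2) ℂ)) = 1 := by
  ext r c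
  simp only [tens, Matrix.of_apply, Matrix.one_apply, Finset.prod_ite_zero]
  simp [funext_iff]

theorem tens_trace (M : W → Matrix (Fin 2) (Fin 2) ℂ) :
    (tens M).trace = ∏ w, (M w).trace := by
  simp only [tens, Matrix.trace, Matrix.diag, Matrix.of_apply]
  rw [Finset.prod_univ_sum]
  simp

theorem tens_conjTranspose (M : W → Matrix (Fin 2) (Fin 2) ℂ) :
    (tens M)ᴴ = tens fun w => (M w)ᴴ := by
  ext r c
  simp [tens, Matrix.conjTranspose_apply]

end tens

/-- The symplectic vectors that label Pauli operators modulo phases. -/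
abbrev V2 (W : Type) : Type := (W → ZMod 2) × (W → ZMod 2)

/-- The single-qubit operator `X ^ x * Z ^ z`. -/
def xz (x z : ZMod 2) : Matrix (Fin 2) (Fin 2) ℂ :=
  if x = 0 then
    if z = 0 then !![1, 0; 0, 1] else !![1, 0; 0, -1]
  else
    if z = 0 then !![0, 1; 1, 0] else !![0, -1; 1, 0]

/-- The operator `X ^ x * Z ^ z` on a register. -/
def hz {W : Type} [Fintype W] (v : V2 W) : Op W := tens fun w => xz (v.1 w) (v.2 w)

/-- The phase `i ^ e`. -/
def ip (e : ZMod 4) : ℂ := Complex.I ^ e.val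

theorem zmod2_cases (x : ZMod 2) : x = 0 ∨ x = 1 := by
  revert x; decide

theorem zmod4_cases (x : ZMod 4) : x = 0 ∨ x = 1 ∨ x = 2 ∨ x = 3 := by
  revert x; decide

theorem ip_zero : ip 0 = 1 := by simp [ip]

theorem ip_natCast (k : ℕ) : ip (k : ZMod 4) = Complex.I ^ k := by
  rw [ip, ZMod.val_natCast, ← Complex.I_pow_eq_pow_mod]

theorem ip_add (e f : ZMod 4) : ip (e + f) = ip e * ip f := by
  have he : ((e.val + f.val : ℕ) : ZMod 4) = e + f := by simp
  rw [← he, ip_natCast, pow_add, ip, ip]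

theorem ip_two : ip 2 = -1 := by
  have : ((2 : ℕ) : ZMod 4) = 2 := rfl
  rw [← this, ip_natCast, Complex.I_sq]

theorem ip_star (e : ZMod 4) : star (ip e) = ip (-e) := by
  have h : ip e * ip (-e) = 1 := by rw [← ip_add, add_neg_cancel, ip_zero]
  have h2 : star (ip e) * ip e = 1 := by
    rw [Complex.star_def, ← Complex.normSq_eq_conj_mul_self]
    simp [ip]
  calc star (ip e) = star (ip e) * (ip e * ip (-e)) := by rw [h, mul_one]
    _ = ip (-e) := by rw [← mul_assoc, h2, one_mul]

theorem ip_injective {e f : ZMod 4} (h : ip e = ip f) : e = f := by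
  have h1 : ip (e - f) = 1 := by
    rw [sub_eq_add_neg, ip_add, h, ← ip_add, add_neg_cancel, ip_zero]
  rw [← sub_eq_zero]
  have hI : Complex.I ≠ 1 := fun h => by simpa using congrArg Complex.re h
  have h3 : Complex.I ^ 3 ≠ 1 := fun h => by
    rw [Complex.I_pow_three] at h; simpa using congrArg Complex.re h
  rcases zmod4_cases (e - f) with h' | h' | h' | h' <;> rw [h'] at h1 ⊢
  · exact absurd (show Complex.I = 1 by simpa using (ip_natCast 1).symm.trans (by simpa using h1)) hI
  · rw [ip_two] at h1; norm_num at h1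
  · exact absurd ((ip_natCast 3).symm.trans (by simpa using h1)) h3

/-- `0, 1` modulo `2` as residues modulo `4`. -/
def lift4 (x : ZMod 2) : ZMod 4 := (x.val : ZMod 4)

theorem ip_sum {ι : Type} (s : Finset ι) (f : ι → ZMod 4) : ip (∑ i ∈ s, f i) = ∏ i ∈ s, ip (f i) := by
  classical
  induction s using Finset.induction_on with
  | empty => simp [ip_zero]
  | insert a s ha ih => rw [Finset.sum_insert ha, Finset.prod_insert ha, ip_add, ih]

/-- Moving `Z ^ z` past `X ^ x'` costs the sign `(-1) ^ (z x')`, written as a power of `i` so that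
all phases live in `ZMod 4`. -/
theorem xz_mul (x z x' z' : ZMod 2) :
    xz x z * xz x' z' = ip (2 * (lift4 z * lift4 x')) • xz (x + x') (z + z') := by
  have h11 : (1 : ZMod 2) + 1 = 0 := rfl
  have h2 : ip (2 * (lift4 1 * lift4 1)) = -1 := ip_two
  have h0 : lift4 0 = 0 := rfl
  rcases zmod2_cases x with rfl | rfl <;> rcases zmod2_cases z with rfl | rfl <;>
  rcases zmod2_cases x' with rfl | rfl <;> rcases zmod2_cases z' with rfl | rfl <;>
  ext i j <;> fin_cases i <;> fin_cases j <;>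
  simp [xz, h11, h2, h0, ip_zero, Matrix.mul_apply]

theorem xz_conjTranspose (x z : ZMod 2) :
    (xz x z)ᴴ = ip (2 * (lift4 x * lift4 z)) • xz x z := by
  have h2 : ip (2 * (lift4 1 * lift4 1)) = -1 := ip_two
  have h0 : lift4 0 = 0 := rfl
  rcases zmod2_cases x with rfl | rfl <;> rcases zmod2_cases z with rfl | rfl <;>
  ext i j <;> fin_cases i <;> fin_cases j <;>
  simp [xz, h2, h0, ip_zero, Matrix.conjTranspose_apply]

theorem xz_trace (x z : ZMod 2) : (xz x z).trace = if x = 0 ∧ z = 0 then 2 else 0 := by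
  rcases zmod2_cases x with rfl | rfl <;> rcases zmod2_cases z with rfl | rfl <;>
  (simp [xz, Matrix.trace, Fin.sum_univ_two]; try norm_num)

/-- The only correction is `Y = i X Z`. Working with the real matrices `xz` makes products and
transposes uniform and confines factors of `i` to the exponent. -/
theorem pauli_eq (x z : ZMod 2) : pauli x z = ip (lift4 x * lift4 z) • xz x z := by
  have h2 : ip (lift4 1 * lift4 1) = Complex.I := by
    rw [show lift4 1 * lift4 1 = ((1 : ℕ) : ZMod 4) from rfl, ip_natCast, pow_one]
  have h0 : lift4 0 = 0 := rfl
  rcases zmod2_cases x with rfl | rfl <;> rcases zmod2_cases z with rfl | rfl <;>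
  ext i j <;> fin_cases i <;> fin_cases j <;>
  simp [xz, pauli, h2, h0, ip_zero]

/-! ### Phased Pauli operators on a register and the vectors they fix -/

section hz

variable {W : Type} [Fintype W] [DecidableEq W]

/-- The number of `Y` factors modulo `4`. -/
def yCount (v : V2 W) : ZMod 4 := ∑ w, lift4 (v.1 w) * lift4 (v.2 w)

/-- The exponent of the commutation sign in a product. -/
def cross (v v' : V2 W) : ZMod 4 := ∑ w, 2 * (lift4 (v.2 w) * lift4 (v'.1 w))

theorem hz_mul (v v' : V2 W) : hz v * hz v' = ip (cross v v') • hz (v + v') := by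
  simp only [hz, tens_mul, xz_mul, tens_smul, cross, ip_sum]
  rfl

theorem hz_zero : hz (0 : V2 W) = 1 := by
  rw [← tens_one, hz]
  congr 1
  funext w
  ext i j
  fin_cases i <;> fin_cases j <;> simp [xz]

theorem hz_conjTranspose (v : V2 W) : (hz v)ᴴ = ip (2 * yCount v) • hz v := by
  simp only [hz, tens_conjTranspose, xz_conjTranspose, tens_smul, yCount, ip_sum, Finset.mul_sum]

theorem hz_trace (v : V2 W) : (hz v).trace = if v = 0 then (2 : ℂ) ^ Fintype.card W else 0 := by
  simp only [hz, tens_trace, xz_trace, Finset.prod_ite_zero]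
  simp [Prod.ext_iff, funext_iff, forall_and]

theorem pauliOp_eq (x z : W → ZMod 2) : pauliOp x z = ip (yCount (x, z)) • hz (x, z) := by
  have : pauliOp x z = tens fun w => pauli (x w) (z w) := rfl
  rw [this]
  simp only [pauli_eq, tens_smul, yCount, ip_sum]
  rfl

/-- `i ^ e X ^ x Z ^ z` fixes the vector `ψ`. -/
def Fixes (e : ZMod 4) (v : V2 W) (ψ : (W → Fin 2) → ℂ) : Prop := (ip e • hz v) *ᵥ ψ = ψ

theorem generator_eq {k : ℕ} (T : Tableau k W) (i : Fin k) :
    T.generator i =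
      ip (2 * lift4 (T.sign i) + yCount (T.x i, T.z i)) • hz (T.x i, T.z i) := by
  rw [Tableau.generator, pauliOp_eq, smul_smul, ip_add]
  congr 2
  rcases zmod2_cases (T.sign i) with h | h <;> rw [h]
  · simp [lift4, ip_zero]
  · have : ip (2 * lift4 1) = -1 := ip_two
    rw [this]
    simp [ZMod.val_one]

theorem fixes_iff (e : ZMod 4) (v : V2 W) (ψ : (W → Fin 2) → ℂ) :
    Fixes e v ψ ↔ hz v *ᵥ ψ = ip (-e) • ψ := by
  have h : ip (-e) * ip e = 1 := by rw [← ip_add, neg_add_cancel, ip_zero]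
  have h' : ip e * ip (-e) = 1 := by rw [← ip_add, add_neg_cancel, ip_zero]
  rw [Fixes, Matrix.smul_mulVec]
  constructor
  · intro hh
    conv_rhs => rw [← hh, smul_smul, h, one_smul]
  · intro hh
    rw [hh, smul_smul, h', one_smul]

theorem Fixes.mul {e e' : ZMod 4} {v v' : V2 W} {ψ : (W → Fin 2) → ℂ} (h : Fixes e v ψ)
    (h' : Fixes e' v' ψ) : Fixes (e + e' + cross v v') (v + v') ψ := by
  unfold Fixes at *
  have : ip (e + e' + cross v v') • hz (v + v') = (ip e • hz v) * (ip e' • hz v') := by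
    rw [smul_mul_smul_comm, hz_mul, smul_smul, ip_add, ip_add]
  rw [this, ← Matrix.mulVec_mulVec, h', h]

theorem Fixes.zero (ψ : (W → Fin 2) → ℂ) : Fixes 0 0 ψ := by
  simp [Fixes, ip_zero, hz_zero]

/-- The phase is read off from an eigenvalue on a nonzero vector. This replaces many phase
computations below: two ways of obtaining the same symplectic vector must give the same exponent. -/
theorem Fixes.unique {e e' : ZMod 4} {v : V2 W} {ψ : (W → Fin 2) → ℂ} (hψ : ψ ≠ 0)
    (h : Fixes e v ψ) (h' : Fixes e' v ψ) : e = e' := by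
  rw [fixes_iff] at h h'
  have : (ip (-e) - ip (-e')) • ψ = 0 := by rw [sub_smul, ← h, ← h', sub_self]
  rcases smul_eq_zero.mp this with h0 | h0
  · exact neg_injective (ip_injective (sub_eq_zero.mp h0))
  · exact absurd h0 hψ

theorem hz_conjTranspose_mul (v : V2 W) : (hz v)ᴴ * hz v = 1 := by
  rw [hz_conjTranspose, smul_mul_assoc, hz_mul, smul_smul, ← ip_add]
  have h1 : v + v = 0 := by
    ext w <;> exact CharTwo.add_self_eq_zero _
  have h2 : 2 * yCount v + cross v v = 0 := by
    simp only [yCount, cross, Finset.mul_sum, ← Finset.sum_add_distrib]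
    refine Finset.sum_eq_zero fun w _ => ?_
    have : ∀ x z : ZMod 2, 2 * (lift4 x * lift4 z) + 2 * (lift4 z * lift4 x) = 0 := by decide
    exact this _ _
  rw [h1, h2, hz_zero, ip_zero, one_smul]

theorem op_unitary (e : ZMod 4) (v : V2 W) : (ip e • hz v)ᴴ * (ip e • hz v) = 1 := by
  rw [Matrix.conjTranspose_smul, smul_mul_smul_comm, hz_conjTranspose_mul, ip_star, ← ip_add,
    neg_add_cancel, ip_zero, one_smul]

theorem Fixes.adjoint {e : ZMod 4} {v : V2 W} {ψ : (W → Fin 2) → ℂ} (h : Fixes e v ψ) :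
    (ip e • hz v)ᴴ *ᵥ ψ = ψ := by
  unfold Fixes at h
  conv_lhs => rw [← h, Matrix.mulVec_mulVec, op_unitary, Matrix.one_mulVec]

/-- The operators that fix a nonzero vector are Hermitian. -/
theorem Fixes.hermitian {e : ZMod 4} {v : V2 W} {ψ : (W → Fin 2) → ℂ} (hψ : ψ ≠ 0)
    (h : Fixes e v ψ) : (ip e • hz v)ᴴ = ip e • hz v := by
  have h1 := h.adjoint
  rw [Matrix.conjTranspose_smul, hz_conjTranspose, smul_smul, ip_star, ← ip_add] at h1 ⊢
  rw [Fixes.unique hψ h1 h]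

/-- The square of an operator that fixes a nonzero vector is the identity. -/
theorem Fixes.even {e : ZMod 4} {v : V2 W} {ψ : (W → Fin 2) → ℂ} (hψ : ψ ≠ 0)
    (h : Fixes e v ψ) : 2 * e = 2 * yCount v := by
  have h1 := h.adjoint
  rw [Matrix.conjTranspose_smul, hz_conjTranspose, smul_smul, ip_star, ← ip_add] at h1
  have h2 := Fixes.unique hψ h1 h
  linear_combination -h2

/-- The exponent depends on commutation signs and is left implicit; for nonzero `ψ` it is determined
by `Fixes.unique`. -/
theorem exists_fixes_sum {ι : Type} [Fintype ι] {e : ι → ZMod 4} {v : ι → V2 W}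
    {ψ : (W → Fin 2) → ℂ} (h : ∀ i, Fixes (e i) (v i) ψ) (c : ι → ZMod 2) :
    ∃ f, Fixes f (∑ i, c i • v i) ψ := by
  classical
  have key : ∀ s : Finset ι, ∃ f, Fixes f (∑ i ∈ s, c i • v i) ψ := by
    intro s
    induction s using Finset.induction_on with
    | empty => exact ⟨0, by simpa using Fixes.zero ψ⟩
    | insert a s ha ih =>
      obtain ⟨f, hf⟩ := ih
      rw [Finset.sum_insert ha]
      rcases zmod2_cases (c a) with h0 | h0 <;> rw [h0]
      · exact ⟨f, by simpa using hf⟩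
      · exact ⟨_, by simpa using (h a).mul hf⟩
  exact key _

end hz

theorem ne_zero_of_unit {α : Type} [Fintype α] {ψ : α → ℂ} (h : star ψ ⬝ᵥ ψ = 1) : ψ ≠ 0 := by
  rintro rfl
  simp at h

/-! ### The density matrix as a stabilizer group average -/

section projector

variable {W : Type} [Fintype W] [DecidableEq W] {ι : Type} [Fintype ι]

theorem sum_smul_add (v : ι → V2 W) (c d : ι → ZMod 2) :
    ∑ i, (c + d) i • v i = ∑ i, c i • v i + ∑ i, d i • v i := by
  simp [add_smul, Finset.sum_add_distrib]

/-- The density matrix of a stabilizer state is the average of its stabilizer group. -/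
theorem proj_eq_average [DecidableEq ι] {e : ι → ZMod 4} {v : ι → V2 W} {ψ : (W → Fin 2) → ℂ}
    (hψ : star ψ ⬝ᵥ ψ = 1) (h : ∀ i, Fixes (e i) (v i) ψ) (hv : LinearIndependent (ZMod 2) v)
    (hc : Fintype.card ι = Fintype.card W) :
    ∃ f : (ι → ZMod 2) → ZMod 4, (∀ c, Fixes (f c) (∑ i, c i • v i) ψ) ∧
      proj ψ = ((2 : ℂ) ^ Fintype.card W)⁻¹ • ∑ c, ip (f c) • hz (∑ i, c i • v i) := by
  choose f hf using exists_fixes_sum h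
  refine ⟨f, hf, ?_⟩
  have hψ0 := ne_zero_of_unit hψ
  set g : (ι → ZMod 2) → Op W := fun c => ip (f c) • hz (∑ i, c i • v i) with hg
  have hmul : ∀ c d, g c * g d = g (c + d) := by
    intro c d
    simp only [hg]
    rw [smul_mul_smul_comm, hz_mul, smul_smul, ← ip_add, ← ip_add, sum_smul_add]
    have h1 := (hf c).mul (hf d)
    have h2 := hf (c + d)
    rw [sum_smul_add] at h2
    rw [Fixes.unique hψ0 h1 h2]
  have hadj : ∀ c, (g c)ᴴ = g c := fun c => (hf c).hermitian hψ0
  have hcard : Fintype.card (ι → ZMod 2) = 2 ^ Fintype.card W := by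
    rw [Fintype.card_fun, ZMod.card, hc]
  have h2 : ((2 : ℂ) ^ Fintype.card W) ≠ 0 := by positivity
  set E : Op W := ((2 : ℂ) ^ Fintype.card W)⁻¹ • ∑ c, g c with hE
  have hcc : ((Fintype.card (ι → ZMod 2) : ℕ) : ℂ) = 2 ^ Fintype.card W := by
    rw [hcard]; push_cast; rfl
  -- The `g c` form a group, since `g c * g d = g (c + d)`, so their average is idempotent.
  have hE2 : E * E = E := by
    rw [hE, smul_mul_smul_comm, Finset.sum_mul]
    simp only [Finset.mul_sum, hmul]
    have : ∀ c, ∑ d, g (c + d) = ∑ d, g d := fun c => Equiv.sum_comp (Equiv.addLeft c) g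
    simp only [this, Finset.sum_const, Finset.card_univ]
    rw [← Nat.cast_smul_eq_nsmul ℂ, hcc, smul_smul]
    congr 1
    field_simp
  have hEψ : E *ᵥ ψ = ψ := by
    rw [hE, Matrix.smul_mulVec, Matrix.sum_mulVec]
    have : ∀ c, g c *ᵥ ψ = ψ := hf
    simp only [this, Finset.sum_const, Finset.card_univ]
    rw [← Nat.cast_smul_eq_nsmul ℂ, hcc, smul_smul, inv_mul_cancel₀ h2, one_smul]
  have hEadj : Eᴴ = E := by
    rw [hE, Matrix.conjTranspose_smul, Matrix.conjTranspose_sum]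
    simp only [hadj]
    simp
  have hP : E * proj ψ = proj ψ := by
    rw [proj, Matrix.mul_vecMulVec, hEψ]
  have hPadj : (proj ψ)ᴴ = proj ψ := by
    rw [proj, Matrix.conjTranspose_vecMulVec, star_star]
  have hP' : proj ψ * E = proj ψ := by
    have := congrArg Matrix.conjTranspose hP
    rwa [Matrix.conjTranspose_mul, hEadj, hPadj] at this
  have hPP : proj ψ * proj ψ = proj ψ := by
    rw [proj, Matrix.vecMulVec_mul_vecMulVec, hψ]; simp
  -- Only the identity of the group has nonzero trace, and by independence it occurs only for `c =
  -- 0`.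
  have htr : E.trace = 1 := by
    rw [hE, Matrix.trace_smul, Matrix.trace_sum]
    have : ∀ c, (g c).trace = if c = 0 then (2 : ℂ) ^ Fintype.card W else 0 := by
      intro c
      simp only [hg, Matrix.trace_smul, hz_trace]
      by_cases hc0 : c = 0
      · subst hc0
        have : f 0 = 0 := Fixes.unique hψ0 (by simpa using hf 0) (Fixes.zero ψ)
        simp [this, ip_zero]
      · have : ∑ i, c i • v i ≠ 0 := fun h0 =>
          hc0 (funext (Fintype.linearIndependent_iff.mp hv c h0))
        simp [this, hc0]
    simp only [this, Finset.sum_ite_eq', Finset.mem_univ, if_true, smul_eq_mul]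
    exact inv_mul_cancel₀ h2
  have htrP : (proj ψ).trace = 1 := by
    rw [proj, Matrix.trace_vecMulVec, dotProduct_comm, hψ]
  -- `E` is a projector whose range contains `ψ`, so the difference is again a projector; its trace
  -- is zero, hence it vanishes.
  have hD : (E - proj ψ)ᴴ * (E - proj ψ) = E - proj ψ := by
    rw [Matrix.conjTranspose_sub, hEadj, hPadj, sub_mul, mul_sub, mul_sub, hE2, hP, hP', hPP]
    simp
  have hD0 : E - proj ψ = 0 := by
    rw [← Matrix.trace_conjTranspose_mul_self_eq_zero_iff, hD, Matrix.trace_sub, htr, htrP,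
      sub_self]
  exact (sub_eq_zero.mp hD0).symm

end projector

theorem Tableau.Describes.fixes {k : ℕ} {Q : Type} [Fintype Q] [DecidableEq Q] {T : Tableau k Q}
    {ψ : (Q → Fin 2) → ℂ} (h : T.Describes ψ) (i : Fin k) :
    Fixes (2 * lift4 (T.sign i) + yCount (T.x i, T.z i)) (T.x i, T.z i) ψ := by
  rw [Fixes, ← generator_eq]
  exact h.fixed i

/-- By the average formula a stabilizer density matrix is determined by finitely many bits and phase
exponents. Finiteness supplies the compact hulls needed for separation. -/
theorem stabStates_finite (Q : Type) [Fintype Q] [DecidableEq Q] : (stabStates Q).Finite := by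
  let F : (Fin (Fintype.card Q) → V2 Q) × ((Fin (Fintype.card Q) → ZMod 2) → ZMod 4) → Op Q :=
    fun p => ((2 : ℂ) ^ Fintype.card Q)⁻¹ • ∑ c, ip (p.2 c) • hz (∑ i, c i • p.1 i)
  refine (Set.finite_range F).subset ?_
  rintro ρ ⟨T, φ, h, rfl⟩
  obtain ⟨f, -, hf⟩ := proj_eq_average h.unit h.fixes h.independent (Fintype.card_fin _)
  exact ⟨(fun i => (T.x i, T.z i), f), hf.symm⟩

/-! ### Contracting pairs of qubits with Bell states -/

/-- The restriction of symplectic vectors along a map of registers. -/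
def restr {O W : Type} (f : O → W) : V2 W →ₗ[ZMod 2] V2 O :=
  (LinearMap.funLeft (ZMod 2) (ZMod 2) f).prodMap (LinearMap.funLeft (ZMod 2) (ZMod 2) f)

theorem restr_apply {O W : Type} (f : O → W) (v : V2 W) :
    restr f v = (fun o => v.1 (f o), fun o => v.2 (f o)) := rfl

/-- The register of the output qubits `O` and of two copies of `A` that are to be contracted. -/
abbrev Joint (O A : Type) : Type := O ⊕ (A ⊕ A)

section contraction

variable {O A : Type} [Fintype O] [DecidableEq O] [Fintype A] [DecidableEq A]

/-- The contraction of the two copies of `A` with an unnormalized Bell state. -/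
def contr (ψ : (Joint O A → Fin 2) → ℂ) : (O → Fin 2) → ℂ :=
  fun g => ∑ t : A → Fin 2, ψ (Sum.elim g (Sum.elim t t))

/-- The contraction of operators. -/
def contrOp (M : Op (Joint O A)) : Op O :=
  Matrix.of fun g h => ∑ t : A → Fin 2, ∑ u : A → Fin 2,
    M (Sum.elim g (Sum.elim t t)) (Sum.elim h (Sum.elim u u))

/-- The part of a symplectic vector on the output qubits. -/
def outPart : V2 (Joint O A) →ₗ[ZMod 2] V2 O := restr Sum.inl

/-- The difference of the parts of a symplectic vector on the two copies of `A`. -/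
def mismatch : V2 (Joint O A) →ₗ[ZMod 2] V2 A :=
  restr (fun i => Sum.inr (Sum.inl i)) + restr (fun i => Sum.inr (Sum.inr i))

theorem mismatch_eq_zero (v : V2 (Joint O A)) :
    mismatch v = 0 ↔
      restr (fun i => Sum.inr (Sum.inl i)) v = restr (fun i => Sum.inr (Sum.inr i)) v := by
  have h : ∀ x y : ZMod 2, x + y = 0 ↔ x = y := by decide
  simp [mismatch, restr_apply, Prod.ext_iff, funext_iff, h]

theorem hz_joint (v : V2 (Joint O A)) (g h : O → Fin 2) (t t' u u' : A → Fin 2) :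
    hz v (Sum.elim g (Sum.elim t t')) (Sum.elim h (Sum.elim u u')) =
      hz (outPart v) g h * (hz (restr (fun i => Sum.inr (Sum.inl i)) v) t u *
        hz (restr (fun i => Sum.inr (Sum.inr i)) v) t' u') := by
  simp only [hz, tens, Matrix.of_apply, Fintype.prod_sum_type]
  rfl

theorem sum_joint {M : Type} [AddCommMonoid M] (F : (Joint O A → Fin 2) → M) :
    ∑ f, F f = ∑ g : O → Fin 2, ∑ t : A → Fin 2, ∑ t' : A → Fin 2,
      F (Sum.elim g (Sum.elim t t')) := by
  rw [← (Equiv.sumArrowEquivProdArrow O (A ⊕ A) (Fin 2)).symm.sum_comp, Fintype.sum_prod_type]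
  refine Finset.sum_congr rfl fun g _ => ?_
  rw [← (Equiv.sumArrowEquivProdArrow A A (Fin 2)).symm.sum_comp, Fintype.sum_prod_type]
  rfl

/-- `X` and `Z` are real. Hence adjoint and transpose of `hz v` agree, and contraction with a Bell
state involves no complex conjugation. -/
theorem hz_star {W : Type} [Fintype W] (v : V2 W) (r c : W → Fin 2) :
    star (hz v r c) = hz v r c := by
  simp only [hz, tens, Matrix.of_apply, star_prod]
  refine Finset.prod_congr rfl fun w _ => ?_
  generalize v.1 w = x
  generalize v.2 w = z
  generalize r w = i
  generalize c w = j
  rcases zmod2_cases x with rfl | rfl <;> rcases zmod2_cases z with rfl | rfl <;>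
  fin_cases i <;> fin_cases j <;> simp [xz]

theorem hz_sum_mul (v : V2 A) (u u' : A → Fin 2) :
    ∑ t, hz v t u * hz v t u' = if u = u' then 1 else 0 := by
  have := congrFun (congrFun (hz_conjTranspose_mul v) u) u'
  simpa [Matrix.mul_apply, Matrix.conjTranspose_apply, ← Complex.star_def, hz_star,
    Matrix.one_apply] using this

/-- Hilbert–Schmidt orthogonality of Pauli operators. -/
theorem hz_sum_sum_mul (v w : V2 A) :
    ∑ t, ∑ u, hz v t u * hz w t u = if v = w then (2 : ℂ) ^ Fintype.card A else 0 := by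
  have h1 : ∑ t, ∑ u, hz v t u * hz w t u = ((hz v)ᴴ * hz w).trace := by
    simp only [Matrix.trace, Matrix.diag, Matrix.mul_apply, Matrix.conjTranspose_apply, hz_star]
    rw [Finset.sum_comm]
  rw [h1]
  split_ifs with h
  · rw [h, hz_conjTranspose_mul]
    simp [Matrix.trace_one]
  · have : v + w ≠ 0 := fun h0 => h <| by
      have h2 : w + w = 0 := by ext i <;> exact CharTwo.add_self_eq_zero _
      exact add_right_cancel (h0.trans h2.symm)
    rw [hz_conjTranspose, smul_mul_assoc, hz_mul, Matrix.trace_smul, Matrix.trace_smul, hz_trace]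
    simp [this]

/-- A matched operator acts on the two copies as `H ⊗ H` with `H` real orthogonal. This leaves the
Bell state invariant, so only the factor on the output survives. -/
theorem contr_mulVec {v : V2 (Joint O A)} (hv : mismatch v = 0) (ψ : (Joint O A → Fin 2) → ℂ) :
    contr (hz v *ᵥ ψ) = hz (outPart v) *ᵥ contr ψ := by
  rw [mismatch_eq_zero] at hv
  funext g
  simp only [contr, Matrix.mulVec, dotProduct, sum_joint, hz_joint, hv]
  rw [Finset.sum_comm]
  refine Finset.sum_congr rfl fun h _ => ?_
  rw [Finset.sum_comm, Finset.mul_sum]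
  refine Finset.sum_congr rfl fun u _ => ?_
  rw [Finset.sum_comm]
  have : ∀ u', ∑ t, hz (outPart v) g h * (hz (restr (fun i => Sum.inr (Sum.inr i)) v) t u *
      hz (restr (fun i => Sum.inr (Sum.inr i)) v) t u') * ψ (Sum.elim h (Sum.elim u u')) =
      if u = u' then hz (outPart v) g h * ψ (Sum.elim h (Sum.elim u u')) else 0 := by
    intro u'
    rw [← Finset.sum_mul, ← Finset.mul_sum, hz_sum_mul]
    split_ifs <;> simp
  simp [this]

/-- The contraction leaves the Hilbert–Schmidt product of the factors on the two copies, which are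
orthogonal unless they are matched. -/
theorem contrOp_hz (v : V2 (Joint O A)) :
    contrOp (hz v) = if mismatch v = 0 then (2 : ℂ) ^ Fintype.card A • hz (outPart v) else 0 := by
  ext g h
  simp only [contrOp, Matrix.of_apply, hz_joint, ← Finset.mul_sum, hz_sum_sum_mul,
    ← mismatch_eq_zero]
  split_ifs <;> simp [mul_comm]

theorem contrOp_smul (a : ℂ) (M : Op (Joint O A)) : contrOp (a • M) = a • contrOp M := by
  ext g h
  simp [contrOp, Finset.mul_sum]

theorem contrOp_sum {ι : Type} (s : Finset ι) (M : ι → Op (Joint O A)) :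
    contrOp (∑ i ∈ s, M i) = ∑ i ∈ s, contrOp (M i) := by
  classical
  induction s using Finset.induction_on with
  | empty => ext g h; simp [contrOp]
  | insert a s ha ih =>
    rw [Finset.sum_insert ha, Finset.sum_insert ha, ← ih]
    ext g h
    simp [contrOp, Finset.sum_add_distrib]

theorem contrOp_proj (ψ : (Joint O A → Fin 2) → ℂ) : contrOp (proj ψ) = proj (contr ψ) := by
  ext g h
  simp [contrOp, proj, contr, Matrix.vecMulVec_apply, Finset.sum_mul_sum]

theorem Fixes.contr {e : ZMod 4} {v : V2 (Joint O A)} {ψ : (Joint O A → Fin 2) → ℂ}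
    (h : Fixes e v ψ) (hv : mismatch v = 0) : Fixes e (outPart v) (contr ψ) := by
  rw [fixes_iff] at *
  rw [← contr_mulVec hv, h]
  funext g
  simp [StabProp.contr, Finset.mul_sum]

/-- Independent generators in echelon form: those marked `1` are not matched on the two copies of
`A`, those marked `0` act trivially on the output. -/
structure Echelon {ι : Type} [Fintype ι] (mark : ι → ℕ) (v : ι → V2 (Joint O A)) : Prop where
  matched : ∀ i, mark i ≠ 1 → mismatch (v i) = 0
  trivial : ∀ i, mark i = 0 → outPart (v i) = 0
  first : ∀ c : ι → ZMod 2, mismatch (∑ i, c i • v i) = 0 → ∀ i, mark i = 1 → c i = 0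
  second : ∀ c : ι → ZMod 2, mismatch (∑ i, c i • v i) = 0 → outPart (∑ i, c i • v i) = 0 →
    ∀ i, mark i ≠ 0 → c i = 0

variable {ι : Type} [Fintype ι] [DecidableEq ι]

theorem card_vanishing (p : ι → Prop) [DecidablePred p] :
    (Finset.univ.filter fun c : ι → ZMod 2 => ∀ i, p i → c i = 0).card =
      2 ^ (Finset.univ.filter fun i => ¬ p i).card := by
  have : (Finset.univ.filter fun c : ι → ZMod 2 => ∀ i, p i → c i = 0) =
      Fintype.piFinset fun i => if p i then {0} else Finset.univ := by
    ext c
    simp only [Finset.mem_filter, Finset.mem_univ, true_and, Fintype.mem_piFinset]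
    refine forall_congr' fun i => ?_
    by_cases h : p i <;> simp [h]
  rw [this, Fintype.card_piFinset, ← Finset.prod_const, Finset.prod_filter]
  refine Finset.prod_congr rfl fun i _ => ?_
  by_cases h : p i <;> simp [h]

theorem Echelon.mismatch_sum_iff {mark : ι → ℕ} {v : ι → V2 (Joint O A)} (h : Echelon mark v)
    (c : ι → ZMod 2) : mismatch (∑ i, c i • v i) = 0 ↔ ∀ i, mark i = 1 → c i = 0 := by
  refine ⟨h.first c, fun hc => ?_⟩
  rw [map_sum]
  refine Finset.sum_eq_zero fun i _ => ?_
  by_cases hi : mark i = 1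
  · simp [hc i hi]
  · simp [h.matched i hi]

theorem Echelon.both_iff {mark : ι → ℕ} {v : ι → V2 (Joint O A)} (h : Echelon mark v)
    (c : ι → ZMod 2) : (mismatch (∑ i, c i • v i) = 0 ∧ outPart (∑ i, c i • v i) = 0) ↔
      ∀ i, mark i ≠ 0 → c i = 0 := by
  refine ⟨fun hc => h.second c hc.1 hc.2, fun hc => ⟨?_, ?_⟩⟩
  · rw [h.mismatch_sum_iff]
    exact fun i hi => hc i (by simp [hi])
  · rw [map_sum]
    refine Finset.sum_eq_zero fun i _ => ?_
    by_cases hi : mark i = 0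
    · simp [h.trivial i hi]
    · simp [hc i hi]

/-- Each contracted qubit contributes the same commutation sign twice, once per copy, and nothing
comes from the output. So exponents simply add when such rows are multiplied. -/
theorem cross_eq_zero {v w : V2 (Joint O A)} (hv : mismatch v = 0) (hv' : outPart v = 0)
    (hw : mismatch w = 0) : cross v w = 0 := by
  rw [mismatch_eq_zero] at hv hw
  have h0 : ∀ o, v.2 (Sum.inl o) = 0 := fun o => congrFun (congrArg Prod.snd hv') o
  have h1 : ∀ i, v.2 (Sum.inr (Sum.inl i)) = v.2 (Sum.inr (Sum.inr i)) :=
    fun i => congrFun (congrArg Prod.snd hv) i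
  have h2 : ∀ i, w.1 (Sum.inr (Sum.inl i)) = w.1 (Sum.inr (Sum.inr i)) :=
    fun i => congrFun (congrArg Prod.fst hw) i
  have h4 : ∀ x z : ZMod 2, 2 * (lift4 z * lift4 x) + 2 * (lift4 z * lift4 x) = 0 := by decide
  have h5 : ∀ x : ZMod 2, 2 * (lift4 0 * lift4 x) = 0 := by decide
  simp [cross, Fintype.sum_sum_type, h0, h1, h2, h5, ← Finset.sum_add_distrib, h4]

theorem fixes_zero_sum {v : ι → V2 (Joint O A)} {ψ : (Joint O A → Fin 2) → ℂ}
    {p : ι → Prop} (h : ∀ i, p i → Fixes 0 (v i) ψ ∧ mismatch (v i) = 0 ∧ outPart (v i) = 0)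
    {c : ι → ZMod 2} (hc : ∀ i, ¬ p i → c i = 0) : Fixes 0 (∑ i, c i • v i) ψ := by
  have key : ∀ s : Finset ι, Fixes 0 (∑ i ∈ s, c i • v i) ψ ∧ mismatch (∑ i ∈ s, c i • v i) = 0 := by
    intro s
    induction s using Finset.induction_on with
    | empty => exact ⟨by simpa using Fixes.zero ψ, by simp⟩
    | insert a s ha ih =>
      rw [Finset.sum_insert ha]
      rcases zmod2_cases (c a) with h0 | h0 <;> rw [h0]
      · simpa using ih
      · have ha' := h a (by by_contra h'; simp [hc a h'] at h0)
        refine ⟨?_, by rw [map_add, ih.2, one_smul, ha'.2.1, add_zero]⟩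
        have := ha'.1.mul ih.1
        rw [cross_eq_zero ha'.2.1 ha'.2.2 ih.2] at this
        simpa using this
  exact (key _).1

/-- If a generator acts as a nontrivial phase on the contracted vector, then that vector is zero. -/
theorem contr_eq_zero {mark : ι → ℕ} {v : ι → V2 (Joint O A)} (hE : Echelon mark v)
    {e : ι → ZMod 4} {ψ : (Joint O A → Fin 2) → ℂ} (h : ∀ i, Fixes (e i) (v i) ψ)
    {i : ι} (hi : mark i = 0) (he : e i ≠ 0) : contr ψ = 0 := by
  by_contra h0
  have h1 := (h i).contr (hE.matched i (by simp [hi]))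
  rw [hE.trivial i hi] at h1
  exact he (Fixes.unique h0 h1 (Fixes.zero _))

theorem star_dotProduct_proj {α : Type} [Fintype α] (ψ : α → ℂ) :
    star ψ ⬝ᵥ (proj ψ *ᵥ ψ) = (star ψ ⬝ᵥ ψ) * (star ψ ⬝ᵥ ψ) := by
  rw [proj, Matrix.vecMulVec_mulVec]
  simp [dotProduct_smul]

/-- The norm of the contracted vector and the number of generators that describe it. -/
theorem contr_norm {mark : ι → ℕ} {v : ι → V2 (Joint O A)} (hE : Echelon mark v)
    {e : ι → ZMod 4} {ψ : (Joint O A → Fin 2) → ℂ} (hψ : star ψ ⬝ᵥ ψ = 1)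
    (h : ∀ i, Fixes (e i) (v i) ψ) (hv : LinearIndependent (ZMod 2) v)
    (hcard : Fintype.card ι = Fintype.card (Joint O A)) (he : ∀ i, mark i = 0 → e i = 0) :
    star (contr ψ) ⬝ᵥ contr ψ =
        2 ^ (Finset.univ.filter fun i => mark i = 0).card / 2 ^ Fintype.card A ∧
      (Finset.univ.filter fun i => mark i ≠ 1).card =
        (Finset.univ.filter fun i => mark i = 0).card + Fintype.card O := by
  obtain ⟨f, hf, hP⟩ := proj_eq_average hψ h hv hcard
  set k := (Finset.univ.filter fun i => mark i = 0).card with hk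
  set m := (Finset.univ.filter fun i => mark i ≠ 1).card with hm
  have hχ : proj (contr ψ) = ((2 : ℂ) ^ Fintype.card (Joint O A))⁻¹ • ∑ c : ι → ZMod 2,
      if ∀ i, mark i = 1 → c i = 0 then
        (2 : ℂ) ^ Fintype.card A • (ip (f c) • hz (outPart (∑ i, c i • v i))) else 0 := by
    rw [← contrOp_proj, hP, contrOp_smul, contrOp_sum]
    congr 1
    refine Finset.sum_congr rfl fun c _ => ?_
    rw [contrOp_smul, contrOp_hz]
    simp only [hE.mismatch_sum_iff]
    split_ifs
    · rw [smul_comm]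
    · simp
  have hcN : Fintype.card (Joint O A) = Fintype.card O + (Fintype.card A + Fintype.card A) := by
    simp [Fintype.card_sum]
  have hψ0 := ne_zero_of_unit hψ
  have h20 : ∀ n : ℕ, (2 : ℂ) ^ n ≠ 0 := fun n => by positivity
  -- The squared norm is the trace of the contracted average. The surviving terms are the `2 ^ k`
  -- combinations of rows with mark 0; they have phase 1 and contribute `2^|A| * 2^|O|` each,
  -- against the normalization `2^(|O| + 2|A|)`.
  have h1 : star (contr ψ) ⬝ᵥ contr ψ = 2 ^ k / 2 ^ Fintype.card A := by
    have ht : (proj (contr ψ)).trace = star (contr ψ) ⬝ᵥ contr ψ := by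
      rw [proj, Matrix.trace_vecMulVec, dotProduct_comm]
    rw [← ht, hχ, Matrix.trace_smul, Matrix.trace_sum]
    have : ∀ c : ι → ZMod 2, (if ∀ i, mark i = 1 → c i = 0 then
        (2 : ℂ) ^ Fintype.card A • (ip (f c) • hz (outPart (∑ i, c i • v i))) else 0).trace =
        if ∀ i, mark i ≠ 0 → c i = 0 then (2 : ℂ) ^ Fintype.card A * 2 ^ Fintype.card O else 0 := by
      intro c
      by_cases h0 : ∀ i, mark i ≠ 0 → c i = 0
      · have h1 : ∀ i, mark i = 1 → c i = 0 := fun i hi => h0 i (by simp [hi])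
        have hfc : f c = 0 := by
          refine Fixes.unique hψ0 (hf c) (fixes_zero_sum (p := fun i => mark i = 0) ?_ h0)
          intro i hi
          have := h i
          rw [he i hi] at this
          exact ⟨this, hE.matched i (by simp [hi]), hE.trivial i hi⟩
        rw [if_pos h0, if_pos h1, ((hE.both_iff c).mpr h0).2, hfc]
        simp [ip_zero, hz_trace]
      · rw [if_neg h0]
        split_ifs with h1
        · have : outPart (∑ i, c i • v i) ≠ 0 := fun h2 =>
            h0 ((hE.both_iff c).mp ⟨(hE.mismatch_sum_iff c).mpr h1, h2⟩)
          rw [Matrix.trace_smul, Matrix.trace_smul, hz_trace, if_neg this, smul_zero, smul_zero]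
        · simp
    simp only [this]
    rw [← Finset.sum_filter, Finset.sum_const, card_vanishing, nsmul_eq_mul]
    have : (Finset.univ.filter fun i => ¬ mark i ≠ 0).card = k := by simp [hk]
    rw [this, hcN, smul_eq_mul]
    push_cast
    field_simp
    ring
  refine ⟨h1, ?_⟩
  -- The expectation of the projector in the contracted vector is the square of its squared norm.
  -- Evaluated with the average, each of the `2 ^ m` matched terms fixes that vector; comparing the
  -- two gives `m = k + |O|`.
  have h3 := star_dotProduct_proj (contr ψ)
  conv_lhs at h3 => rw [hχ]
  rw [Matrix.smul_mulVec, Matrix.sum_mulVec] at h3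
  have : ∀ c : ι → ZMod 2, (if ∀ i, mark i = 1 → c i = 0 then
        (2 : ℂ) ^ Fintype.card A • (ip (f c) • hz (outPart (∑ i, c i • v i))) else 0) *ᵥ contr ψ =
        if ∀ i, mark i = 1 → c i = 0 then (2 : ℂ) ^ Fintype.card A • contr ψ else 0 := by
    intro c
    split_ifs with h0
    · have := (hf c).contr ((hE.mismatch_sum_iff c).mpr h0)
      rw [Fixes] at this
      rw [Matrix.smul_mulVec, this]
    · simp
  simp only [this] at h3
  rw [← Finset.sum_filter, Finset.sum_const, card_vanishing, ← Nat.cast_smul_eq_nsmul ℂ, smul_smul,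
    smul_smul, dotProduct_smul, smul_eq_mul, h1] at h3
  have hm' : (Finset.univ.filter fun i => ¬ mark i = 1).card = m := rfl
  rw [hm', hcN] at h3
  have h4 : (2 : ℂ) ^ (m + Fintype.card A + Fintype.card A) =
      2 ^ (k + (Fintype.card O + (Fintype.card A + Fintype.card A))) := by
    push_cast at h3
    field_simp at h3
    rw [pow_add, pow_add, pow_add 2 k]
    linear_combination h3
  have h5 : m + Fintype.card A + Fintype.card A =
      k + (Fintype.card O + (Fintype.card A + Fintype.card A)) := by
    have : (2 : ℕ) ^ (m + Fintype.card A + Fintype.card A) =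
      2 ^ (k + (Fintype.card O + (Fintype.card A + Fintype.card A))) := by exact_mod_cast h4
    exact Nat.pow_right_injective le_rfl this
  omega

/-- The generators that are not marked `0` or `1` describe the contracted vector. -/
theorem contr_describes {mark : ι → ℕ} {v : ι → V2 (Joint O A)} (hE : Echelon mark v)
    {e : ι → ZMod 4} {ψ : (Joint O A → Fin 2) → ℂ} (hψ : star ψ ⬝ᵥ ψ = 1)
    (h : ∀ i, Fixes (e i) (v i) ψ) (hv : LinearIndependent (ZMod 2) v)
    (hcard : Fintype.card ι = Fintype.card (Joint O A)) (he : ∀ i, mark i = 0 → e i = 0)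
    {k : ℕ} (hk : k = Fintype.card O) (T : Tableau k O) (r : Fin k → ι)
    (hr : Function.Injective r) (hmark : ∀ j, mark (r j) ≠ 0 ∧ mark (r j) ≠ 1)
    (hT : ∀ j, (T.x j, T.z j) = outPart (v (r j)))
    (hsign : ∀ j, T.sign j = if e (r j) - yCount (outPart (v (r j))) = 0 then 0 else 1) :
    ∃ φ, T.Describes φ ∧
      ((2 : ℂ) ^ (Finset.univ.filter fun i => mark i = 0).card) • proj φ =
        (2 : ℂ) ^ Fintype.card A • proj (contr ψ) := by
  obtain ⟨hn, -⟩ := contr_norm hE hψ h hv hcard he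
  set l := (Finset.univ.filter fun i => mark i = 0).card
  have hχ0 : contr ψ ≠ 0 := by
    intro h0
    rw [h0] at hn
    have : (2 : ℂ) ^ l / 2 ^ Fintype.card A ≠ 0 := by positivity
    exact this (by simpa using hn.symm)
  -- The inverse of the norm given by `contr_norm`.
  set s : ℝ := Real.sqrt (2 ^ Fintype.card A / 2 ^ l) with hs
  have hss : (s : ℂ) * s = 2 ^ Fintype.card A / 2 ^ l := by
    have : s * s = 2 ^ Fintype.card A / 2 ^ l := Real.mul_self_sqrt (by positivity)
    rw [← Complex.ofReal_mul, this]
    push_cast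
    rfl
  refine ⟨(s : ℂ) • contr ψ, ⟨hk, ?_, ?_, ?_⟩, ?_⟩
  · rw [Fintype.linearIndependent_iff]
    intro c hc j
    simp only [hT] at hc
    -- The coefficients extended by zero to all rows, so that `Echelon.second` applies.
    set d : ι → ZMod 2 := fun i => ∑ j, if r j = i then c j else 0 with hd
    have hdr : ∀ j, d (r j) = c j := by
      intro j
      simp [hd, hr.eq_iff]
    have hsum : ∀ {M : Type} [AddCommGroup M] [Module (ZMod 2) M] (F : ι → M),
        ∑ i, d i • F i = ∑ j, c j • F (r j) := by
      intro M _ _ F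
      simp only [hd, Finset.sum_smul, ite_smul, zero_smul]
      rw [Finset.sum_comm]
      simp
    have h1 : mismatch (∑ i, d i • v i) = 0 := by
      rw [hsum, map_sum]
      refine Finset.sum_eq_zero fun j _ => ?_
      rw [map_smul, hE.matched _ (hmark j).2, smul_zero]
    have h2 : outPart (∑ i, d i • v i) = 0 := by
      rw [hsum, map_sum]
      simpa only [map_smul] using hc
    rw [← hdr j]
    exact hE.second d h1 h2 _ (hmark j).1
  · rw [star_smul, smul_dotProduct, dotProduct_smul, hn, smul_smul]
    have : star (s : ℂ) = s := by simp
    rw [this, hss, smul_eq_mul]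
    have : (2 : ℂ) ^ l ≠ 0 := by positivity
    have : (2 : ℂ) ^ Fintype.card A ≠ 0 := by positivity
    field_simp
  · intro j
    have h1 := (h (r j)).contr (hE.matched _ (hmark j).2)
    have h2 := h1.even hχ0
    rw [generator_eq, hT, hsign]
    have h3 : (2 * lift4 (if e (r j) - yCount (outPart (v (r j))) = 0 then 0 else 1) +
        yCount (outPart (v (r j)))) = e (r j) := by
      -- By `Fixes.even` the exponent differs from that of the Hermitian Pauli operator by 0 or 2,
      -- and the sign bit records which.
      have key : ∀ x y : ZMod 4, 2 * x = 2 * y → 2 * lift4 (if x - y = 0 then 0 else 1) + y = x := by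
        decide
      exact key _ _ h2
    rw [h3, Matrix.mulVec_smul]
    rw [Fixes] at h1
    rw [h1]
  · have : proj ((s : ℂ) • contr ψ) = ((s : ℂ) * s) • proj (contr ψ) := by
      ext g g'
      simp [proj, Matrix.vecMulVec_apply]
      ring
    rw [this, hss, smul_smul]
    congr 1
    have : (2 : ℂ) ^ l ≠ 0 := by positivity
    field_simp

end contraction

/-! ### Deterministic programs -/

/-- Apply `f 0`, `f 1`, …, `f (k - 1)` in turn. -/
def iter (f : ℕ → Memory → Memory) : ℕ → Memory → Memory
  | 0, m => m
  | k + 1, m => f k (iter f k m)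

theorem iter_induction {f : ℕ → Memory → Memory} {p : ℕ → Memory → Prop} {m : Memory} (k : ℕ)
    (h0 : p 0 m) (hs : ∀ j m', j < k → p j m' → p (j + 1) (f j m')) : p k (iter f k m) := by
  induction k with
  | zero => exact h0
  | succ k ih => exact hs k _ (Nat.lt_succ_self k) (ih fun j m' hj => hs j m' (Nat.lt_succ_of_lt hj))

/-- The final memory of a program without coin tosses. -/
def Prog.run : Prog → Memory → Memory
  | .skip, m => m
  | .assign x i j e, m => m.set x (i.eval m) (j.eval m) (e.eval m)
  | .seq p q, m => q.run (p.run m)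
  | .ite e p q, m => if e.eval m ≠ 0 then p.run m else q.run m
  | .loop x e p, m => iter (fun k m' => p.run (m'.set x 0 0 k)) (e.eval m) m
  -- A junk value; `run` describes `exec` only for programs that are `FlipFree`.
  | .flip _ _ p _, m => p.run m

theorem Prog.run_seq (p q : Prog) (m : Memory) : (Prog.seq p q).run m = q.run (p.run m) := rfl

theorem Prog.run_ite (e : Expr) (p q : Prog) (m : Memory) :
    (Prog.ite e p q).run m = if e.eval m ≠ 0 then p.run m else q.run m := rfl

theorem Prog.run_loop (x : ℕ) (e : Expr) (p : Prog) (m : Memory) : (Prog.loop x e p).run m =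
    iter (fun k m' => p.run (m'.set x 0 0 k)) (e.eval m) m := rfl

/-- The program tosses no coins. -/
def Prog.FlipFree : Prog → Prop
  | .skip => True
  | .assign _ _ _ _ => True
  | .seq p q => p.FlipFree ∧ q.FlipFree
  | .ite _ p q => p.FlipFree ∧ q.FlipFree
  | .loop _ _ p => p.FlipFree
  | .flip _ _ _ _ => False

/-- The program may change the array `y`. -/
def Prog.Writes (y : ℕ) : Prog → Prop
  | .skip => False
  | .assign x _ _ _ => x = y
  | .seq p q => p.Writes y ∨ q.Writes y
  | .ite _ p q => p.Writes y ∨ q.Writes y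
  | .loop x _ p => x = y ∨ p.Writes y
  | .flip _ _ p q => p.Writes y ∨ q.Writes y

/-- The step count stays existential: results are computed with `run`, while time is bounded
separately through `Tame`. -/
theorem Prog.exec_eq_pure (p : Prog) (hp : p.FlipFree) (m : Memory) :
    ∃ t, p.exec m = PMF.pure (p.run m, t) := by
  induction p generalizing m with
  | skip => exact ⟨1, rfl⟩
  | assign x i j e => exact ⟨_, rfl⟩
  | seq p q ihp ihq =>
    obtain ⟨t, ht⟩ := ihp hp.1 m
    obtain ⟨u, hu⟩ := ihq hp.2 (p.run m)
    exact ⟨_, by simp only [exec, ht, PMF.pure_bind, hu, PMF.pure_map, charge]; rfl⟩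
  | ite e p q ihp ihq =>
    obtain ⟨t, ht⟩ := ihp hp.1 m
    obtain ⟨u, hu⟩ := ihq hp.2 m
    simp only [exec, run]
    split_ifs
    · exact ⟨_, by simp only [ht, PMF.pure_map, charge]; rfl⟩
    · exact ⟨_, by simp only [hu, PMF.pure_map, charge]; rfl⟩
  | loop x e p ih =>
    have key : ∀ k, ∃ t, runLoop p.exec x k m =
        PMF.pure (iter (fun k m' => p.run (m'.set x 0 0 k)) k m, t) := by
      intro k
      induction k with
      | zero => exact ⟨0, rfl⟩
      | succ k ihk =>
        obtain ⟨t, ht⟩ := ihk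
        obtain ⟨u, hu⟩ := ih hp ((iter (fun k m' => p.run (m'.set x 0 0 k)) k m).set x 0 0 k)
        exact ⟨_, by simp only [runLoop, ht, PMF.pure_bind, hu, PMF.pure_map, charge]; rfl⟩
    obtain ⟨t, ht⟩ := key (e.eval m)
    exact ⟨_, by simp only [exec, ht, PMF.pure_map, charge]; rfl⟩
  | flip c hc p q => exact hp.elim

theorem Memory.set_of_ne {m : Memory} {x y i j v : ℕ} (h : x ≠ y) : m.set x i j v y = m y := by
  funext i' j'
  simp [Memory.set, h.symm]

/-- The frame rule that carries unaffected arrays through all the correctness proofs. -/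
theorem Prog.run_of_not_writes {y : ℕ} (p : Prog) (hp : ¬ p.Writes y) (m : Memory) :
    p.run m y = m y := by
  induction p generalizing m with
  | skip => rfl
  | assign x i j e => exact Memory.set_of_ne hp
  | seq p q ihp ihq =>
    simp only [Writes, not_or] at hp
    rw [run, ihq hp.2, ihp hp.1]
  | ite e p q ihp ihq =>
    simp only [Writes, not_or] at hp
    rw [run]
    split_ifs
    · exact ihp hp.1 m
    · exact ihq hp.2 m
  | loop x e p ih =>
    simp only [Writes, not_or] at hp
    rw [run]
    exact iter_induction (p := fun _ m' => m' y = m y) _ rfl fun j m' _ h => by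
      rw [ih hp.2, Memory.set_of_ne hp.1, h]
  | flip c hc p q ihp _ =>
    simp only [Writes, not_or] at hp
    exact ihp hp.1 m

/-! ### Running time -/

/-- The expression `4[0, 0] + k`. -/
def size (k : ℕ) : Expr := .add (.cell 4 (.const 0) (.const 0)) (.const k)

theorem size_eval (k : ℕ) (m : Memory) : (size k).eval m = m 4 0 0 + k := rfl

/-- The array `4` is never changed, and the numbers of rounds of loops are `4[0, 0] + k`. -/
def Prog.Tame : Prog → Prop
  | .skip => True
  | .assign x _ _ _ => x ≠ 4
  | .seq p q => p.Tame ∧ q.Tame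
  | .ite _ p q => p.Tame ∧ q.Tame
  | .loop x e p => x ≠ 4 ∧ (∃ k, e = size k) ∧ p.Tame
  | .flip _ _ p q => p.Tame ∧ q.Tame

/-- Every loop has `4[0, 0] + k` rounds with `k` constant, so nesting multiplies polynomials in
`4[0, 0]`. Constancy of `4[0, 0]` is part of the conclusion because the bound for a later part of a
program refers to the memory at which that part starts. -/
theorem Prog.Tame.polynomial_time {p : Prog} (hp : p.Tame) :
    ∃ P : Polynomial ℕ, ∀ m : Memory, ∀ o ∈ (p.exec m).support,
      o.2 ≤ P.eval (m 4 0 0) ∧ o.1 4 0 0 = m 4 0 0 := by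
  induction p with
  | skip => exact ⟨1, fun m o ho => by simp_all [exec]⟩
  | assign x i j e =>
    refine ⟨Polynomial.C (i.cost + j.cost + e.cost + 1), fun m o ho => ?_⟩
    simp only [exec, PMF.support_pure, Set.mem_singleton_iff] at ho
    subst ho
    refine ⟨by simp, ?_⟩
    simp only [Memory.set_of_ne hp]
  | seq p q ihp ihq =>
    obtain ⟨P, hP⟩ := ihp hp.1
    obtain ⟨Q, hQ⟩ := ihq hp.2
    refine ⟨Q + P, fun m o ho => ?_⟩
    simp only [exec, PMF.mem_support_bind_iff, PMF.mem_support_map_iff] at ho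
    obtain ⟨o1, h1, o2, h2, rfl⟩ := ho
    have h1' := hP _ _ h1
    have h2' := hQ _ _ h2
    rw [h1'.2] at h2'
    simp only [charge, Polynomial.eval_add]
    exact ⟨by omega, h2'.2⟩
  | ite e p q ihp ihq =>
    obtain ⟨P, hP⟩ := ihp hp.1
    obtain ⟨Q, hQ⟩ := ihq hp.2
    refine ⟨P + Q + Polynomial.C (e.cost + 1), fun m o ho => ?_⟩
    simp only [exec, PMF.mem_support_map_iff] at ho
    obtain ⟨o1, h1, rfl⟩ := ho
    simp only [charge, Polynomial.eval_add, Polynomial.eval_C]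
    split_ifs at h1
    · have := hP _ _ h1
      exact ⟨by omega, this.2⟩
    · have := hQ _ _ h1
      exact ⟨by omega, this.2⟩
  | loop x e p ih =>
    obtain ⟨hx, ⟨k, rfl⟩, hp⟩ := hp
    obtain ⟨P, hP⟩ := ih hp
    refine ⟨(Polynomial.X + Polynomial.C k) * (P + 1) + Polynomial.C ((size k).cost + 1),
      fun m o ho => ?_⟩
    have key : ∀ l, ∀ o ∈ (runLoop p.exec x l m).support,
        o.2 ≤ l * (P.eval (m 4 0 0) + 1) ∧ o.1 4 0 0 = m 4 0 0 := by
      intro l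
      induction l with
      | zero => intro o ho; simp_all [runLoop]
      | succ l ihl =>
        intro o ho
        simp only [runLoop, PMF.mem_support_bind_iff, PMF.mem_support_map_iff] at ho
        obtain ⟨o1, h1, o2, h2, rfl⟩ := ho
        have h1' := ihl _ h1
        have h2' := hP _ _ h2
        rw [Memory.set_of_ne hx, h1'.2] at h2'
        simp only [charge]
        refine ⟨?_, h2'.2⟩
        rw [add_mul, one_mul]
        omega
    simp only [exec, PMF.mem_support_map_iff] at ho
    obtain ⟨o1, h1, rfl⟩ := ho
    have := key _ _ h1
    rw [size_eval] at this
    simp only [charge, Polynomial.eval_add, Polynomial.eval_C, Polynomial.eval_mul,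
      Polynomial.eval_X, Polynomial.eval_one]
    exact ⟨by omega, this.2⟩
  | flip c hc p q ihp ihq =>
    obtain ⟨P, hP⟩ := ihp hp.1
    obtain ⟨Q, hQ⟩ := ihq hp.2
    refine ⟨P + Q + 1, fun m o ho => ?_⟩
    simp only [exec, PMF.mem_support_map_iff, PMF.mem_support_bind_iff] at ho
    obtain ⟨o1, ⟨y, -, h1⟩, rfl⟩ := ho
    simp only [charge, Polynomial.eval_add, Polynomial.eval_one]
    split_ifs at h1
    · have := hP _ _ h1
      exact ⟨by omega, this.2⟩
    · have := hQ _ _ h1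
      exact ⟨by omega, this.2⟩

/-! ### Means of outputs -/

section sampled

variable {E : Type} [AddCommGroup E] [Module ℂ E] [TopologicalSpace E] [ContinuousAdd E]
  [ContinuousConstSMul ℂ E]

/-- All outcomes of the experiment `p` satisfy `ok`, and the mean of `value` is `ρ`. -/
structure Sampled (value : Memory → E) (ok : Memory → Prop) (p : PMF (Memory × ℕ)) (ρ : E) :
    Prop where
  support : ∀ o ∈ p.support, ok o.1
  mean : HasSum (fun o : Memory × ℕ => ((p o).toReal : ℂ) • value o.1) ρ

variable {value : Memory → E} {ok : Memory → Prop}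

theorem Sampled.pure {m : Memory} {t : ℕ} (hm : ok m) :
    Sampled value ok (PMF.pure (m, t)) (value m) := by
  refine ⟨fun o ho => ?_, ?_⟩
  · simp only [PMF.support_pure, Set.mem_singleton_iff] at ho
    rw [ho]
    exact hm
  · have := hasSum_single (f := fun o : Memory × ℕ =>
      (((PMF.pure (m, t)) o).toReal : ℂ) • value o.1) (m, t) (fun o ho => by simp [PMF.pure_apply, ho])
    simpa using this

theorem charge_injective (t : ℕ) : Function.Injective (charge t) := by
  rintro ⟨m, u⟩ ⟨m', u'⟩ h
  simpa [charge] using h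

/-- Values depend on the memory alone and charging is injective on outcomes, so the sum for the mean
is merely reindexed. -/
theorem Sampled.charge {p : PMF (Memory × ℕ)} {ρ : E} (h : Sampled value ok p ρ) (t : ℕ) :
    Sampled value ok (p.map (StabProp.charge t)) ρ := by
  refine ⟨fun o ho => ?_, ?_⟩
  · rw [PMF.mem_support_map_iff] at ho
    obtain ⟨o', ho', rfl⟩ := ho
    exact h.support o' ho'
  · have h1 : ∀ o, (p.map (StabProp.charge t)) (StabProp.charge t o) = p o := by
      intro o
      rw [PMF.map_apply, tsum_eq_single o]
      · simp
      · intro o' ho'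
        rw [if_neg]
        exact fun h => ho' (charge_injective t h).symm
    rw [← (charge_injective t).hasSum_iff]
    · convert h.mean using 2 with o
      rw [Function.comp_apply, h1]
      rfl
    · intro o ho
      have : (p.map (StabProp.charge t)) o = 0 := by
        rw [PMF.apply_eq_zero_iff, PMF.mem_support_map_iff]
        rintro ⟨o', -, rfl⟩
        exact ho ⟨o', rfl⟩
      simp [this]

theorem Sampled.flip {c : ℝ≥0} (hc : c ≤ 1) {p q : Prog} {m : Memory} {ρ σ : E}
    (hp : Sampled value ok (p.exec m) ρ) (hq : Sampled value ok (q.exec m) σ) :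
    Sampled value ok ((Prog.flip c hc p q).exec m) ((c : ℂ) • ρ + (1 - c : ℂ) • σ) := by
  refine Sampled.charge ⟨fun o ho => ?_, ?_⟩ 1
  · rw [PMF.mem_support_bind_iff] at ho
    obtain ⟨y, -, h⟩ := ho
    split_ifs at h
    · exact hp.support _ h
    · exact hq.support _ h
  · have hsum := (hp.mean.const_smul (c : ℂ)).add (hq.mean.const_smul (1 - c : ℂ))
    convert hsum using 2 with o
    have hb : ((coin c hc).bind fun y => if y then p.exec m else q.exec m) o =
        c * p.exec m o + (1 - c) * q.exec m o := by
      rw [PMF.bind_apply, tsum_bool, add_comm]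
      rfl
    have hp1 := (PMF.coe_le_one (p.exec m) o).trans_lt ENNReal.one_lt_top
    have hq1 := (PMF.coe_le_one (q.exec m) o).trans_lt ENNReal.one_lt_top
    have hc' : (1 - (c : ℝ≥0∞)) ≠ ∞ := ne_top_of_le_ne_top ENNReal.one_ne_top tsub_le_self
    rw [hb, ENNReal.toReal_add (ENNReal.mul_ne_top ENNReal.coe_ne_top hp1.ne)
      (ENNReal.mul_ne_top hc' hq1.ne), ENNReal.toReal_mul, ENNReal.toReal_mul,
      ENNReal.toReal_sub_of_le (by exact_mod_cast hc) ENNReal.one_ne_top]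
    push_cast [ENNReal.toReal_one, ENNReal.coe_toReal]
    rw [add_smul, mul_smul, mul_smul]

theorem Sampled.seq {p q : Prog} (hp : p.FlipFree) {m : Memory} {ρ : E}
    (h : Sampled value ok (q.exec (p.run m)) ρ) : Sampled value ok ((Prog.seq p q).exec m) ρ := by
  obtain ⟨t, ht⟩ := p.exec_eq_pure hp m
  rw [Prog.exec, ht, PMF.pure_bind]
  exact h.charge t

theorem Sampled.of_flipFree {p : Prog} (hp : p.FlipFree) {m : Memory} (h : ok (p.run m)) :
    Sampled value ok (p.exec m) (value (p.run m)) := by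
  obtain ⟨t, ht⟩ := p.exec_eq_pure hp m
  rw [ht]
  exact Sampled.pure h

theorem Sampled.ite {e : Expr} {p q : Prog} {m : Memory} {ρ : E}
    (hp : e.eval m ≠ 0 → Sampled value ok (p.exec m) ρ)
    (hq : e.eval m = 0 → Sampled value ok (q.exec m) ρ) :
    Sampled value ok ((Prog.ite e p q).exec m) ρ := by
  refine Sampled.charge ?_ _
  split_ifs with h
  · exact hp h
  · exact hq (not_not.mp h)

end sampled

/-! ### Multiplying rows of a tableau -/

/-- The conjunction of bits. -/
def band (a b : ℕ) : ℕ := a + b - 1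

/-- The exclusive disjunction of bits. -/
def bxor (a b : ℕ) : ℕ := a + b - band a b - band a b

/-- The residue modulo `4` of a number below `8`. -/
def mod4 (t : ℕ) : ℕ :=
  -- With truncated subtraction `1 - (1 - (t - 3))` is 1 if `t ≥ 4` and 0 otherwise; four copies
  -- stand in for multiplication by 4.
  t - (1 - (1 - (t - 3)) + (1 - (1 - (t - 3))) + (1 - (1 - (t - 3)) + (1 - (1 - (t - 3)))))

theorem bxor_lt {a b : ℕ} (ha : a < 2) (hb : b < 2) : bxor a b < 2 := by
  interval_cases a <;> interval_cases b <;> decide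

theorem bxor_cast {a b : ℕ} (ha : a < 2) (hb : b < 2) : ((bxor a b : ℕ) : ZMod 2) = a + b := by
  interval_cases a <;> interval_cases b <;> decide

theorem band_lt {a b : ℕ} (ha : a < 2) (hb : b < 2) : band a b < 2 := by
  unfold band; omega

theorem band_cast {a b : ℕ} (ha : a < 2) (hb : b < 2) :
    ((band a b : ℕ) : ZMod 4) = lift4 a * lift4 b := by
  interval_cases a <;> interval_cases b <;> decide

theorem mod4_lt {t : ℕ} (ht : t < 8) : mod4 t < 4 := by
  unfold mod4; omega

theorem mod4_cast {t : ℕ} (ht : t < 8) : ((mod4 t : ℕ) : ZMod 4) = t := by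
  interval_cases t <;> decide

/-- The expression for the scalar stored at `x[0, 0]`. -/
def sc (x : ℕ) : Expr := .cell x (.const 0) (.const 0)

/-- The expression for `band`. -/
def andE (e f : Expr) : Expr := .sub (.add e f) (.const 1)

/-- The expression for `bxor`. -/
def xorE (e f : Expr) : Expr := .sub (.sub (.add e f) (andE e f)) (andE e f)

/-- The expression `min 1 (e - 3)`. -/
def overE (e : Expr) : Expr := .sub (.const 1) (.sub (.const 1) (.sub e (.const 3)))

/-- The expression for `mod4`. -/
def modE (e : Expr) : Expr :=
  .sub e (.add (.add (overE e) (overE e)) (.add (overE e) (overE e)))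

section eval

variable (m : Memory)

theorem sc_eval (x : ℕ) : (sc x).eval m = m x 0 0 := rfl

theorem andE_eval (e f : Expr) : (andE e f).eval m = band (e.eval m) (f.eval m) := rfl

theorem xorE_eval (e f : Expr) : (xorE e f).eval m = bxor (e.eval m) (f.eval m) := rfl

theorem modE_eval (e : Expr) : (modE e).eval m = mod4 (e.eval m) := rfl

end eval

/-- The entries of the working tableau are reduced. -/
def Reduced (m : Memory) : Prop := ∀ i j, m 10 i j < 2 ∧ m 11 i j < 2 ∧ m 12 i j < 4

/-- The row with index `23[0, 0] - 1`. -/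
def pivotE : Expr := .sub (sc 23) (.const 1)

/-- Multiply the row `20[0, 0]` of the working tableau by the pivot row from the left. The operator
`i ^ e X ^ x Z ^ z` is stored with `x`, `z`, `e` in the arrays `10`, `11`, `12`. -/
def rowMul (l : ℕ) : Prog :=
  .seq
    (.loop 22 (size l)
      (.seq
        -- The commutation sign `2 z x` of this column needs the old `x`-entry of the row, so it
        -- comes before the entries are overwritten.
        (.assign 12 (sc 20) (.const 0) (modE (.add (.cell 12 (sc 20) (.const 0))
          (.add (andE (.cell 11 pivotE (sc 22)) (.cell 10 (sc 20) (sc 22)))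
            (andE (.cell 11 pivotE (sc 22)) (.cell 10 (sc 20) (sc 22)))))))
        (.seq
          (.assign 10 (sc 20) (sc 22)
            (xorE (.cell 10 pivotE (sc 22)) (.cell 10 (sc 20) (sc 22))))
          (.assign 11 (sc 20) (sc 22)
            (xorE (.cell 11 pivotE (sc 22)) (.cell 11 (sc 20) (sc 22)))))))
    (.assign 12 (sc 20) (.const 0) (modE (.add (.cell 12 (sc 20) (.const 0))
      (.cell 12 pivotE (.const 0)))))

/-- The first `k` columns of the row `r` have been multiplied by the row `p`. -/
structure RowMulInv (m : Memory) (r p k : ℕ) (m' : Memory) : Prop where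
  reduced : Reduced m'
  row : m' 20 0 0 = r
  piv : m' 23 0 0 - 1 = p
  other : ∀ i j, i ≠ r → m' 10 i j = m 10 i j ∧ m' 11 i j = m 11 i j ∧ m' 12 i j = m 12 i j
  later : ∀ j, k ≤ j → m' 10 r j = m 10 r j ∧ m' 11 r j = m 11 r j
  done : ∀ j, j < k → (m' 10 r j : ZMod 2) = m 10 p j + m 10 r j ∧
    (m' 11 r j : ZMod 2) = m 11 p j + m 11 r j
  phase : (m' 12 r 0 : ZMod 4) =
    m 12 r 0 + ∑ j ∈ Finset.range k, 2 * (lift4 (m 11 p j) * lift4 (m 10 r j))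

/-- Since `p ≠ r`, the pivot row keeps its original entries throughout the loop, so each column can
be computed from the initial memory. The phase is the column-wise sum of commutation exponents. -/
theorem rowMul_spec {l : ℕ} {m : Memory} {r p : ℕ} (hm : Reduced m) (hr : m 20 0 0 = r)
    (hp : m 23 0 0 - 1 = p) (hrp : p ≠ r) :
    Reduced ((rowMul l).run m) ∧
    (∀ i j, i ≠ r → (rowMul l).run m 10 i j = m 10 i j ∧ (rowMul l).run m 11 i j = m 11 i j ∧
      (rowMul l).run m 12 i j = m 12 i j) ∧
    (∀ j, j < m 4 0 0 + l → ((rowMul l).run m 10 r j : ZMod 2) = m 10 p j + m 10 r j ∧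
      ((rowMul l).run m 11 r j : ZMod 2) = m 11 p j + m 11 r j) ∧
    ((rowMul l).run m 12 r 0 : ZMod 4) = m 12 p 0 + m 12 r 0 +
      ∑ j ∈ Finset.range (m 4 0 0 + l), 2 * (lift4 (m 11 p j) * lift4 (m 10 r j)) := by
  rw [rowMul, Prog.run_seq, Prog.run_loop]
  have key := iter_induction (p := RowMulInv m r p) (m := m) ((size l).eval m)
    (f := fun k m' => Prog.run (.seq
        (.assign 12 (sc 20) (.const 0) (modE (.add (.cell 12 (sc 20) (.const 0))
          (.add (andE (.cell 11 pivotE (sc 22)) (.cell 10 (sc 20) (sc 22)))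
            (andE (.cell 11 pivotE (sc 22)) (.cell 10 (sc 20) (sc 22)))))))
        (.seq
          (.assign 10 (sc 20) (sc 22)
            (xorE (.cell 10 pivotE (sc 22)) (.cell 10 (sc 20) (sc 22))))
          (.assign 11 (sc 20) (sc 22)
            (xorE (.cell 11 pivotE (sc 22)) (.cell 11 (sc 20) (sc 22)))))) (m'.set 22 0 0 k))
    ⟨hm, hr, hp, fun i j _ => ⟨rfl, rfl, rfl⟩, fun j _ => ⟨rfl, rfl⟩, fun j hj => by omega,
      by simp⟩ ?_
  · set m' := iter _ _ _ with hm'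
    rw [size_eval] at key
    have h12 : ∀ i j, Prog.run (.assign 12 (sc 20) (.const 0) (modE (.add (.cell 12 (sc 20) (.const 0))
      (.cell 12 pivotE (.const 0))))) m' 12 i j =
        if i = r ∧ j = 0 then mod4 (m' 12 r 0 + m' 12 p 0) else m' 12 i j := by
      intro i j
      simp [Prog.run, Memory.set, Expr.eval, modE_eval, sc_eval, pivotE, key.row, key.piv]
    have h10 : ∀ x, x ≠ 12 → Prog.run (.assign 12 (sc 20) (.const 0) (modE (.add (.cell 12 (sc 20)
        (.const 0)) (.cell 12 pivotE (.const 0))))) m' x = m' x :=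
      fun x hx => Prog.run_of_not_writes _ (by simpa [Prog.Writes] using hx.symm) _
    have hlt : m' 12 r 0 + m' 12 p 0 < 8 := by
      have h1 := (key.reduced r 0).2.2
      have h2 := (key.reduced p 0).2.2
      omega
    rw [h10 10 (by decide), h10 11 (by decide)]
    refine ⟨fun i j => ?_, fun i j hi => ?_, key.done, ?_⟩
    · rw [h10 10 (by decide), h10 11 (by decide), h12]
      refine ⟨(key.reduced i j).1, (key.reduced i j).2.1, ?_⟩
      split_ifs
      · exact mod4_lt hlt
      · exact (key.reduced i j).2.2
    · rw [h12, if_neg (by simp [hi])]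
      exact key.other i j hi
    · rw [h12, if_pos ⟨rfl, rfl⟩, mod4_cast hlt, Nat.cast_add, key.phase,
        (key.other p 0 hrp).2.2]
      ring
  · intro k m' hk h
    have hz : m' 11 p k = m 11 p k := (h.other p k hrp).2.1
    have hx : m' 10 p k = m 10 p k := (h.other p k hrp).1
    have hzr : m' 11 r k = m 11 r k := (h.later k le_rfl).2
    have hxr : m' 10 r k = m 10 r k := (h.later k le_rfl).1
    have b1 := (hm p k).1
    have b2 := (hm p k).2.1
    have b3 := (hm r k).1
    have b4 := (hm r k).2.1
    have b5 := (h.reduced r 0).2.2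
    have hlt : m' 12 r 0 + (band (m 11 p k) (m 10 r k) + band (m 11 p k) (m 10 r k)) < 8 := by
      have := band_lt b2 b3
      omega
    set m'' := Prog.run _ _ with hm''
    have e12 : ∀ i j, m'' 12 i j = if i = r ∧ j = 0 then
        mod4 (m' 12 r 0 + (band (m 11 p k) (m 10 r k) + band (m 11 p k) (m 10 r k)))
        else m' 12 i j := by
      intro i j
      simp [hm'', Prog.run, Memory.set, Expr.eval, modE_eval, andE_eval, xorE_eval, sc_eval, pivotE,
        h.row, h.piv, hz, hxr]
    have e10 : ∀ i j, m'' 10 i j = if i = r ∧ j = k then bxor (m 10 p k) (m 10 r k)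
        else m' 10 i j := by
      intro i j
      simp [hm'', Prog.run, Memory.set, Expr.eval, modE_eval, andE_eval, xorE_eval, sc_eval, pivotE,
        h.row, h.piv, hx, hxr]
    have e11 : ∀ i j, m'' 11 i j = if i = r ∧ j = k then bxor (m 11 p k) (m 11 r k)
        else m' 11 i j := by
      intro i j
      simp [hm'', Prog.run, Memory.set, Expr.eval, modE_eval, andE_eval, xorE_eval, sc_eval, pivotE,
        h.row, h.piv, hz, hzr]
    have e20 : m'' 20 = m' 20 := by
      rw [hm'', Prog.run_of_not_writes _ (by simp [Prog.Writes]), Memory.set_of_ne (by decide)]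
    have e23 : m'' 23 = m' 23 := by
      rw [hm'', Prog.run_of_not_writes _ (by simp [Prog.Writes]), Memory.set_of_ne (by decide)]
    refine ⟨fun i j => ?_, by rw [e20]; exact h.row, by rw [e23]; exact h.piv, fun i j hi => ?_,
      fun j hj => ?_, fun j hj => ?_, ?_⟩
    · rw [e10, e11, e12]
      refine ⟨?_, ?_, ?_⟩ <;> split_ifs
      · exact bxor_lt b1 b3
      · exact (h.reduced i j).1
      · exact bxor_lt b2 b4
      · exact (h.reduced i j).2.1
      · exact mod4_lt hlt
      · exact (h.reduced i j).2.2
    · rw [e10, e11, e12, if_neg (by simp [hi]), if_neg (by simp [hi]), if_neg (by simp [hi])]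
      exact h.other i j hi
    · rw [e10, e11, if_neg (by omega), if_neg (by omega)]
      exact h.later j (by omega)
    · rw [e10, e11]
      rcases eq_or_ne j k with rfl | hjk
      · rw [if_pos ⟨rfl, rfl⟩, if_pos ⟨rfl, rfl⟩]
        exact ⟨bxor_cast b1 b3, bxor_cast b2 b4⟩
      · rw [if_neg (by simp [hjk]), if_neg (by simp [hjk])]
        exact h.done j (by omega)
    · rw [e12, if_pos ⟨rfl, rfl⟩, mod4_cast hlt, Finset.sum_range_succ, Nat.cast_add, h.phase,
        Nat.cast_add, band_cast b2 b3]
      ring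

/-! ### Elimination -/

/-- The rows of a tableau with marks. -/
structure Rows (W : Type) where
  mark : ℕ → ℕ
  e : ℕ → ZMod 4
  v : ℕ → V2 W

/-- The working tableau in the memory; the qubit `w` is stored in the column `col w`. -/
def view {W : Type} (col : W → ℕ) (m : Memory) : Rows W where
  mark r := m 13 r 0
  e r := m 12 r 0
  v r := (fun w => m 10 r (col w), fun w => m 11 r (col w))

theorem view_congr {W : Type} {col : W → ℕ} {m m' : Memory} (h10 : m 10 = m' 10)
    (h11 : m 11 = m' 11) (h12 : m 12 = m' 12) (h13 : m 13 = m' 13) : view col m = view col m' := by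
  simp [view, h10, h11, h12, h13]

section elimination

variable {W : Type} [Fintype W] [DecidableEq W]

/-- The registers' qubits are stored in the columns `0, …, N - 1`. -/
structure Columns (col : W → ℕ) (N : ℕ) : Prop where
  injective : Function.Injective col
  lt : ∀ w, col w < N
  card : Fintype.card W = N

theorem Columns.sum_range {col : W → ℕ} {N : ℕ} (h : Columns col N) {M : Type} [AddCommMonoid M]
    (F : ℕ → M) : ∑ j ∈ Finset.range N, F j = ∑ w, F (col w) := by
  have himg : Finset.univ.image col = Finset.range N := by
    apply Finset.eq_of_subset_of_card_le
    · intro j hj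
      obtain ⟨w, -, rfl⟩ := Finset.mem_image.mp hj
      exact Finset.mem_range.mpr (h.lt w)
    · rw [Finset.card_image_of_injective _ h.injective, Finset.card_univ, h.card, Finset.card_range]
  rw [← himg, Finset.sum_image fun x _ y _ hxy => h.injective hxy]

/-- The columns enumerate the register exactly, so the sum over columns in memory is `cross` and the
row operation is multiplication of Pauli operators. -/
theorem rowMul_view {col : W → ℕ} {l : ℕ} {m : Memory} (hcol : Columns col (m 4 0 0 + l))
    {r p : ℕ} (hm : Reduced m) (hr : m 20 0 0 = r) (hp : m 23 0 0 - 1 = p) (hrp : p ≠ r) :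
    Reduced ((rowMul l).run m) ∧
    (view col ((rowMul l).run m)).mark = (view col m).mark ∧
    (∀ i, i ≠ r → (view col ((rowMul l).run m)).v i = (view col m).v i ∧
      (view col ((rowMul l).run m)).e i = (view col m).e i) ∧
    (view col ((rowMul l).run m)).v r = (view col m).v p + (view col m).v r ∧
    (view col ((rowMul l).run m)).e r = (view col m).e p + (view col m).e r +
      cross ((view col m).v p) ((view col m).v r) := by
  obtain ⟨h1, h2, h3, h4⟩ := rowMul_spec (l := l) hm hr hp hrp
  have h13 : (rowMul l).run m 13 = m 13 :=
    Prog.run_of_not_writes _ (by simp [rowMul, Prog.Writes]) _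
  refine ⟨h1, ?_, fun i hi => ?_, ?_, ?_⟩
  · simp [view, h13]
  · simp [view, fun j => (h2 i j hi).1, fun j => (h2 i j hi).2.1, fun j => (h2 i j hi).2.2]
  · ext w
    · exact (h3 _ (hcol.lt w)).1
    · exact (h3 _ (hcol.lt w)).2
  · simp only [view]
    rw [h4, hcol.sum_range]
    rfl

/-- One round of elimination for the functional `ℓ`: a pivot row gets the mark `mk` and is added to
other rows without a mark. -/
structure Step (N : ℕ) (ℓ : V2 W →ₗ[ZMod 2] ZMod 2) (mk : ℕ) (s t : Rows W) : Prop where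
  cleared : ∀ r < N, s.mark r = 0 → t.mark r = 0 → ℓ (t.v r) = 0
  rows : (∀ r, t.v r = s.v r ∧ t.e r = s.e r ∧ t.mark r = s.mark r) ∨
    ∃ p < N, s.mark p = 0 ∧ ℓ (s.v p) = 1 ∧ t.v p = s.v p ∧ t.e p = s.e p ∧ t.mark p = mk ∧
      ∀ r, r ≠ p → t.mark r = s.mark r ∧
        ((t.v r = s.v r ∧ t.e r = s.e r) ∨
          (s.mark r = 0 ∧ t.v r = s.v p + s.v r ∧ t.e r = s.e p + s.e r + cross (s.v p) (s.v r)))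

/-- Eliminate the functional that is tested by `test` for the row `20[0, 0]`. -/
def pass (l : ℕ) (test : Expr) (mk : ℕ) : Prog :=
  .seq (.assign 23 (.const 0) (.const 0) (.const 0))
    (.loop 20 (size l)
      (.ite (.cell 13 (sc 20) (.const 0)) .skip
        (.ite test
          -- `23[0, 0]` holds the index of the pivot row plus one; 0 means that no pivot has been
          -- found in this pass.
          (.ite (sc 23) (rowMul l)
            (.seq (.assign 23 (.const 0) (.const 0) (.add (sc 20) (.const 1)))
              (.assign 13 (sc 20) (.const 0) (.const mk))))
          .skip)))

/-- The arrays that are changed by elimination. -/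
def Scratch (x : ℕ) : Prop := x = 10 ∨ x = 11 ∨ x = 12 ∨ x = 13 ∨ x = 20 ∨ x = 22 ∨ x = 23

theorem pass_not_writes {l mk x : ℕ} {test : Expr} (hx : ¬ Scratch x) :
    ¬ (pass l test mk).Writes x := by
  simp only [Scratch, not_or] at hx
  simp [pass, rowMul, Prog.Writes]
  omega

/-- The first `k` rows have been treated. -/
structure PassInv (m : Memory) (col : W → ℕ) (ℓ : V2 W →ₗ[ZMod 2] ZMod 2) (mk k : ℕ)
    (m' : Memory) : Prop where
  reduced : Reduced m'
  frame : ∀ x, ¬ Scratch x → m' x = m x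
  later : ∀ r, k ≤ r → (view col m').v r = (view col m).v r ∧
    (view col m').e r = (view col m).e r ∧ (view col m').mark r = (view col m).mark r
  cleared : ∀ r < k, (view col m).mark r = 0 → (view col m').mark r = 0 →
    ℓ ((view col m').v r) = 0
  rows : (m' 23 0 0 = 0 ∧ ∀ r, (view col m').v r = (view col m).v r ∧
      (view col m').e r = (view col m).e r ∧ (view col m').mark r = (view col m).mark r) ∨
    ∃ p < k, m' 23 0 0 = p + 1 ∧ (view col m).mark p = 0 ∧ ℓ ((view col m).v p) = 1 ∧
      (view col m').v p = (view col m).v p ∧ (view col m').e p = (view col m).e p ∧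
      (view col m').mark p = mk ∧
      ∀ r, r ≠ p → (view col m').mark r = (view col m).mark r ∧
        (((view col m').v r = (view col m).v r ∧ (view col m').e r = (view col m).e r) ∨
          ((view col m).mark r = 0 ∧ (view col m').v r = (view col m).v p + (view col m).v r ∧
            (view col m').e r = (view col m).e p + (view col m).e r +
              cross ((view col m).v p) ((view col m).v r)))

/-- Unmarked rows before the pivot already satisfy `ℓ = 0`, and later ones with `ℓ = 1` are cleared
by adding the pivot. The test is evaluated in the middle of the pass, so its correctness is required
for every reduced memory that differs from `m` only in scratch arrays. -/
theorem pass_spec {col : W → ℕ} {l mk : ℕ} {m : Memory} (hcol : Columns col (m 4 0 0 + l))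
    (hmk : mk ≠ 0) (hm : Reduced m) {test : Expr} {ℓ : V2 W →ₗ[ZMod 2] ZMod 2}
    (htest : ∀ m' : Memory, Reduced m' → (∀ x, ¬ Scratch x → m' x = m x) →
      (test.eval m' ≠ 0 ↔ ℓ ((view col m').v (m' 20 0 0)) = 1)) :
    Reduced ((pass l test mk).run m) ∧
      Step (m 4 0 0 + l) ℓ mk (view col m) (view col ((pass l test mk).run m)) := by
  rw [pass, Prog.run_seq, Prog.run_loop]
  set m0 := Prog.run (.assign 23 (.const 0) (.const 0) (.const 0)) m with hm0
  have hm0x : ∀ x, x ≠ 23 → m0 x = m x := fun x hx =>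
    Prog.run_of_not_writes _ (by simpa [Prog.Writes] using hx.symm) _
  have hv0 : view col m0 = view col m := view_congr (hm0x _ (by decide)) (hm0x _ (by decide))
    (hm0x _ (by decide)) (hm0x _ (by decide))
  have hm023 : m0 23 0 0 = 0 := by simp [hm0, Prog.run, Memory.set, Expr.eval]
  have hz : ∀ x : ZMod 2, x ≠ 1 → x = 0 := by decide
  have key := iter_induction (p := PassInv m col ℓ mk) (m := m0) ((size l).eval m0)
    (f := fun k m' => Prog.run (.ite (.cell 13 (sc 20) (.const 0)) .skip
        (.ite test
          (.ite (sc 23) (rowMul l)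
            (.seq (.assign 23 (.const 0) (.const 0) (.add (sc 20) (.const 1)))
              (.assign 13 (sc 20) (.const 0) (.const mk))))
          .skip)) (m'.set 20 0 0 k))
    ⟨?_, ?_, ?_, by simp, ?_⟩ ?_
  · rw [size_eval, hm0x 4 (by decide)] at key ⊢
    refine ⟨key.reduced, key.cleared, ?_⟩
    rcases key.rows with ⟨-, h⟩ | ⟨p, hp, -, h⟩
    · exact Or.inl h
    · exact Or.inr ⟨p, hp, h⟩
  · intro i j
    rw [hm0x 10 (by decide), hm0x 11 (by decide), hm0x 12 (by decide)]
    exact hm i j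
  · intro x hx
    simp only [Scratch, not_or] at hx
    exact hm0x x (by omega)
  · intro r _
    rw [hv0]
    exact ⟨rfl, rfl, rfl⟩
  · refine Or.inl ⟨hm023, fun r => ?_⟩
    rw [hv0]
    exact ⟨rfl, rfl, rfl⟩
  · intro k m' hk h
    rw [size_eval, hm0x 4 (by decide)] at hk
    set m1 := m'.set 20 0 0 k with hm1
    have h1x : ∀ x, x ≠ 20 → m1 x = m' x := fun x hx => Memory.set_of_ne hx.symm
    have h120 : m1 20 0 0 = k := by simp [hm1, Memory.set]
    have hv1 : view col m1 = view col m' := view_congr (h1x _ (by decide)) (h1x _ (by decide))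
      (h1x _ (by decide)) (h1x _ (by decide))
    have hred1 : Reduced m1 := by
      intro i j
      rw [h1x 10 (by decide), h1x 11 (by decide), h1x 12 (by decide)]
      exact h.reduced i j
    have hframe1 : ∀ x, ¬ Scratch x → m1 x = m x := by
      intro x hx
      rw [h1x x (by simp only [Scratch, not_or] at hx; omega), h.frame x hx]
    have hmark : m1 13 k 0 = (view col m').mark k := by rw [← hv1]; rfl
    have hlater := h.later k le_rfl
    -- the memory is left as it is
    have same : (∀ _ : (view col m).mark k = 0, (view col m').mark k = 0 → ℓ ((view col m').v k) = 0) →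
        PassInv m col ℓ mk (k + 1) m1 := by
      intro hcl
      refine ⟨hred1, hframe1, ?_, ?_, ?_⟩
      · rw [hv1]
        exact fun r hr => h.later r (by omega)
      · rw [hv1]
        intro r hr hr0 hr1
        rcases eq_or_ne r k with rfl | hrk
        · exact hcl hr0 hr1
        · exact h.cleared r (by omega) hr0 hr1
      · rw [hv1, h1x 23 (by decide)]
        rcases h.rows with h' | ⟨p, hp, h'⟩
        · exact Or.inl h'
        · exact Or.inr ⟨p, by omega, h'⟩
    have hite1 : (Expr.cell 13 (sc 20) (.const 0)).eval m1 = m1 13 k 0 := by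
      simp [Expr.eval, sc_eval, h120]
    rw [Prog.run, hite1]
    split_ifs with hc1
    · rw [Prog.run]
      exact same fun _ h1 => absurd (hmark.trans h1) hc1
    have hmark0 : (view col m').mark k = 0 := by rw [← hmark]; exact not_not.mp hc1
    have hmark0' : (view col m).mark k = 0 := by rw [← hlater.2.2]; exact hmark0
    rw [Prog.run]
    have ht1 := htest m1 hred1 hframe1
    rw [hv1, h120] at ht1
    split_ifs with hc2
    swap
    · rw [Prog.run]
      exact same fun _ _ => hz _ fun h1 => hc2 (ht1.mpr h1)
    have hℓ := ht1.mp hc2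
    rw [Prog.run, sc_eval, h1x 23 (by decide)]
    rcases h.rows with ⟨h23, hrows⟩ | ⟨p, hp, h23, hpm, hpℓ, hpv, hpe, hpmk, hrows⟩
    · rw [if_neg (by simp [h23])]
      set m2 := Prog.run _ m1 with hm2
      have h2x : ∀ x, x ≠ 23 → x ≠ 13 → m2 x = m1 x := fun x hx hx' =>
        Prog.run_of_not_writes _ (by simpa [Prog.Writes] using ⟨hx.symm, hx'.symm⟩) _
      have h223 : m2 23 0 0 = k + 1 := by
        simp [hm2, Prog.run, Memory.set, Expr.eval, sc_eval, h120]
      have h213 : ∀ i j, m2 13 i j = if i = k ∧ j = 0 then mk else m1 13 i j := by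
        intro i j
        simp [hm2, Prog.run, Memory.set, Expr.eval, sc_eval, h120]
      have hv2 : ∀ i, (view col m2).v i = (view col m').v i := by
        intro i
        rw [← hv1]
        simp [view, h2x]
      have he2 : ∀ i, (view col m2).e i = (view col m').e i := by
        intro i
        rw [← hv1]
        simp [view, h2x]
      have hmk2 : ∀ i, (view col m2).mark i = if i = k then mk else (view col m').mark i := by
        intro i
        rw [← hv1]
        simp [view, h213]
      refine ⟨?_, ?_, ?_, ?_, ?_⟩
      · intro i j
        rw [h2x 10 (by decide) (by decide), h2x 11 (by decide) (by decide),
          h2x 12 (by decide) (by decide)]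
        exact hred1 i j
      · intro x hx
        rw [← hframe1 x hx]
        simp only [Scratch, not_or] at hx
        exact h2x x (by omega) (by omega)
      · intro r hr
        rw [hv2, he2, hmk2, if_neg (by omega)]
        exact h.later r (by omega)
      · intro r hr hr0 hr1
        rw [hmk2] at hr1
        split_ifs at hr1 with hrk
        · exact absurd hr1 hmk
        · rw [hv2]
          exact h.cleared r (by omega) hr0 hr1
      · refine Or.inr ⟨k, by omega, h223, hmark0', ?_, ?_, ?_, ?_, ?_⟩
        · rw [← hlater.1]
          exact hℓ
        · rw [hv2, hlater.1]
        · rw [he2, hlater.2.1]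
        · rw [hmk2, if_pos rfl]
        · intro r hr
          rw [hmk2, if_neg hr, hv2, he2]
          exact ⟨(hrows r).2.2, Or.inl ⟨(hrows r).1, (hrows r).2.1⟩⟩
    · rw [if_pos (by omega)]
      have hcol1 : Columns col (m1 4 0 0 + l) := by
        rw [hframe1 4 (by simp [Scratch])]
        exact hcol
      obtain ⟨g1, g2, g3, g4, g5⟩ := rowMul_view hcol1 hred1 h120
        (p := p) (by rw [h1x 23 (by decide), h23]; simp) (by omega)
      have g13 : ∀ x, x ≠ 10 → x ≠ 11 → x ≠ 12 → x ≠ 22 → (rowMul l).run m1 x = m1 x := by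
        intro x _ _ _ _
        exact Prog.run_of_not_writes _ (by simp [rowMul, Prog.Writes]; omega) _
      rw [hv1] at g2 g3 g4 g5
      refine ⟨g1, ?_, ?_, ?_, Or.inr ⟨p, by omega, ?_, hpm, hpℓ, ?_, ?_, ?_, ?_⟩⟩
      · intro x hx
        rw [← hframe1 x hx]
        simp only [Scratch, not_or] at hx
        exact g13 x (by omega) (by omega) (by omega) (by omega)
      · intro r hr
        rw [(g3 r (by omega)).1, (g3 r (by omega)).2, g2]
        exact h.later r (by omega)
      · intro r hr hr0 hr1
        rw [g2] at hr1
        rcases eq_or_ne r k with rfl | hrk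
        -- `ℓ` is 1 on both summands, and `1 + 1 = 0`.
        · rw [g4, map_add, hℓ, hpv, hpℓ]
          rfl
        · rw [(g3 r hrk).1]
          exact h.cleared r (by omega) hr0 hr1
      · rw [g13 23 (by decide) (by decide) (by decide) (by decide), h1x 23 (by decide), h23]
      · rw [(g3 p (by omega)).1, hpv]
      · rw [(g3 p (by omega)).2, hpe]
      · rw [g2, hpmk]
      · intro r hr
        rw [g2]
        refine ⟨(hrows r hr).1, ?_⟩
        rcases eq_or_ne r k with rfl | hrk
        · refine Or.inr ⟨hmark0', ?_, ?_⟩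
          · rw [g4, hpv, hlater.1]
          · rw [g5, hpv, hlater.1, hpe, hlater.2.1]
        · rw [(g3 r hrk).1, (g3 r hrk).2]
          exact (hrows r hr).2

end elimination

/-! ### Linear algebra of an elimination round -/

section step

variable {W : Type} [Fintype W] [DecidableEq W]

/-- The functionals in `L` vanish on the rows outside `D`, and detect the rows in `D`. -/
structure Detects (N : ℕ) (L : Set (V2 W →ₗ[ZMod 2] ZMod 2)) (D : ℕ → Prop) (v : ℕ → V2 W) :
    Prop where
  vanish : ∀ r < N, ¬ D r → ∀ ℓ ∈ L, ℓ (v r) = 0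
  detect : ∀ c : Fin N → ZMod 2, (∀ ℓ ∈ L, ℓ (∑ i, c i • v i) = 0) → ∀ i : Fin N, D i → c i = 0

/-- The rows of a tableau that describes `ψ`. -/
structure Generates (N : ℕ) (ψ : (W → Fin 2) → ℂ) (s : Rows W) : Prop where
  fixes : ∀ r < N, Fixes (s.e r) (s.v r) ψ
  independent : LinearIndependent (ZMod 2) fun i : Fin N => s.v i

variable {N mk : ℕ} {ℓ : V2 W →ₗ[ZMod 2] ZMod 2} {s t : Rows W}

/-- The pivot comes from the unmarked rows, so adding it cannot change a functional that vanishes on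
all of them. Earlier eliminations therefore survive later rounds. -/
theorem Step.functional (h : Step N ℓ mk s t) {ℓ' : V2 W →ₗ[ZMod 2] ZMod 2}
    (h' : ∀ r < N, s.mark r = 0 → ℓ' (s.v r) = 0) (r : ℕ) : ℓ' (t.v r) = ℓ' (s.v r) := by
  rcases h.rows with h1 | ⟨p, hp, hpm, -, hpv, -, -, h1⟩
  · rw [(h1 r).1]
  · rcases eq_or_ne r p with rfl | hr
    · rw [hpv]
    · rcases (h1 r hr).2 with h2 | h2
      · rw [h2.1]
      · rw [h2.2.1, map_add, h' p hp hpm, zero_add]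

theorem Step.keep (h : Step N ℓ mk s t) {L : Set (V2 W →ₗ[ZMod 2] ZMod 2)} {D : ℕ → Prop}
    (hD : ∀ r < N, s.mark r = 0 → ¬ D r) (hL : Detects N L D s.v) : Detects N L D t.v := by
  have h1 : ∀ ℓ' ∈ L, ∀ r, ℓ' (t.v r) = ℓ' (s.v r) := fun ℓ' hℓ' r =>
    h.functional (fun r hr hr0 => hL.vanish r hr (hD r hr hr0) ℓ' hℓ') r
  refine ⟨fun r hr hr0 ℓ' hℓ' => ?_, fun c hc i hi => hL.detect c (fun ℓ' hℓ' => ?_) i hi⟩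
  · rw [h1 ℓ' hℓ', hL.vanish r hr hr0 ℓ' hℓ']
  · have := hc ℓ' hℓ'
    simpa only [map_sum, map_smul, h1 ℓ' hℓ'] using this

/-- If all functionals vanish on a combination, those in `L` exclude the rows marked before. On the
remaining rows `ℓ` is nonzero only at the new pivot, so its coefficient vanishes as well. -/
theorem Step.extend (h : Step N ℓ mk s t) {L : Set (V2 W →ₗ[ZMod 2] ZMod 2)}
    (hL : Detects N L (fun r => s.mark r ≠ 0) s.v) :
    Detects N (insert ℓ L) (fun r => t.mark r ≠ 0) t.v := by
  have h0 := h.keep (fun r _ hr => by simpa using hr) hL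
  have hmark : ∀ r, t.mark r = 0 → s.mark r = 0 := by
    intro r hr
    rcases h.rows with h1 | ⟨p, -, hpm, -, -, -, -, h1⟩
    · rw [← (h1 r).2.2, hr]
    · rcases eq_or_ne r p with rfl | hrp
      · exact hpm
      · rw [← (h1 r hrp).1, hr]
  have hvan : ∀ r < N, ¬ t.mark r ≠ 0 → ∀ ℓ' ∈ insert ℓ L, ℓ' (t.v r) = 0 := by
    intro r hr hr0 ℓ' hℓ'
    rw [not_not] at hr0
    rcases hℓ' with rfl | hℓ'
    · exact h.cleared r hr (hmark r hr0) hr0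
    · exact h0.vanish r hr (by simpa using hmark r hr0) ℓ' hℓ'
  refine ⟨hvan, fun c hc i hi => ?_⟩
  have hold := h0.detect c fun ℓ' hℓ' => hc ℓ' (Set.mem_insert_of_mem _ hℓ')
  by_cases hs : s.mark i = 0
  swap
  · exact hold i hs
  rcases h.rows with h1 | ⟨p, hp, hpm, hpℓ, hpv, -, -, h1⟩
  · exact absurd ((h1 i).2.2.trans hs) hi
  · have hip : (i : ℕ) = p := by
      by_contra hne
      exact hi ((h1 i hne).1.trans hs)
    have h2 := hc ℓ (Set.mem_insert _ _)
    rw [map_sum, Finset.sum_eq_single i] at h2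
    · rw [map_smul, hip, hpv, hpℓ] at h2
      simpa using h2
    · intro j _ hj
      by_cases hs' : s.mark j = 0
      · have hjp : (j : ℕ) ≠ p := fun h => hj (Fin.ext (h.trans hip.symm))
        rw [map_smul, hvan j j.2 (by simpa [(h1 j hjp).1] using hs') ℓ (Set.mem_insert _ _),
          smul_zero]
      · rw [hold j hs', zero_smul, map_zero]
    · simp

/-- The round multiplies stabilizers of `ψ` together, and on vectors it adds multiples `d r` of the
pivot with `d p = 0`, an invertible operation. -/
theorem Step.generates (h : Step N ℓ mk s t) {ψ : (W → Fin 2) → ℂ} (hs : Generates N ψ s) :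
    Generates N ψ t := by
  rcases h.rows with h1 | ⟨p, hp, hpm, -, hpv, hpe, -, h1⟩
  · refine ⟨fun r hr => ?_, ?_⟩
    · rw [(h1 r).1, (h1 r).2.1]
      exact hs.fixes r hr
    · convert hs.independent using 2 with i
      exact (h1 i).1
  · refine ⟨fun r hr => ?_, ?_⟩
    · rcases eq_or_ne r p with rfl | hrp
      · rw [hpv, hpe]
        exact hs.fixes r hr
      · rcases (h1 r hrp).2 with h2 | h2
        · rw [h2.1, h2.2]
          exact hs.fixes r hr
        · rw [h2.2.1, h2.2.2]
          exact (hs.fixes p hp).mul (hs.fixes r hr)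
    · obtain ⟨d, hdp, hd⟩ : ∃ d : ℕ → ZMod 2, d p = 0 ∧ ∀ r, t.v r = s.v r + d r • s.v p := by
        have : ∀ r, ∃ d : ZMod 2, (r = p → d = 0) ∧ t.v r = s.v r + d • s.v p := by
          intro r
          rcases eq_or_ne r p with rfl | hrp
          · exact ⟨0, fun _ => rfl, by rw [hpv]; simp⟩
          · rcases (h1 r hrp).2 with h2 | h2
            · exact ⟨0, fun _ => rfl, by rw [h2.1]; simp⟩
            · exact ⟨1, fun h => absurd h hrp, by rw [h2.2.1, one_smul, add_comm]⟩
        choose d hd using this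
        exact ⟨d, (hd p).1 rfl, fun r => (hd r).2⟩
      rw [Fintype.linearIndependent_iff]
      intro c hc
      -- All added copies of the pivot are collected in its coefficient; away from `p` the
      -- coefficients are those of `c`.
      have h3 : ∑ i : Fin N, (c i + if i = ⟨p, hp⟩ then ∑ j : Fin N, c j * d j else 0) • s.v i =
          0 := by
        rw [← hc]
        simp only [hd, add_smul, smul_add, Finset.sum_add_distrib, smul_smul, ite_smul, zero_smul,
          Finset.sum_ite_eq', Finset.mem_univ, if_true, Finset.sum_smul]
      have h4 := Fintype.linearIndependent_iff.mp hs.independent _ h3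
      have h5 : ∀ i, i ≠ ⟨p, hp⟩ → c i = 0 := by
        intro i hi
        simpa [hi] using h4 i
      intro i
      by_cases hi : i = ⟨p, hp⟩
      · have h6 : ∑ j : Fin N, c j * d j = 0 := by
          refine Finset.sum_eq_zero fun j _ => ?_
          by_cases hj : j = ⟨p, hp⟩
          · rw [hj, hdp, mul_zero]
          · rw [h5 j hj, zero_mul]
        have := h4 i
        rw [h6] at this
        simpa using this
      · exact h5 i hi

end step

/-! ### The elimination program -/

/-- Run `f 0`, `f 1`, …, `f (k - 1)` in turn. -/
def seqRange : ℕ → (ℕ → Prog) → Prog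
  | 0, _ => .skip
  | k + 1, f => .seq (seqRange k f) (f k)

theorem seqRange_run (k : ℕ) (f : ℕ → Prog) (m : Memory) :
    (seqRange k f).run m = iter (fun j => (f j).run) k m := by
  induction k with
  | zero => rfl
  | succ k ih => rw [seqRange, Prog.run_seq, ih, iter]

theorem seqRange_flipFree {k : ℕ} {f : ℕ → Prog} (h : ∀ j, (f j).FlipFree) :
    (seqRange k f).FlipFree := by
  induction k with
  | zero => trivial
  | succ k ih => exact ⟨ih, h k⟩

theorem seqRange_tame {k : ℕ} {f : ℕ → Prog} (h : ∀ j, (f j).Tame) : (seqRange k f).Tame := by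
  induction k with
  | zero => trivial
  | succ k ih => exact ⟨ih, h k⟩

theorem seqRange_not_writes {x k : ℕ} {f : ℕ → Prog} (h : ∀ j, ¬ (f j).Writes x) :
    ¬ (seqRange k f).Writes x := by
  induction k with
  | zero => exact id
  | succ k ih => exact fun hw => hw.elim ih (h k)

/-- The difference of the entries of the array `y` in the current row for the two copies of the
`j`-th qubit. -/
def pairE (b y j : ℕ) : Expr :=
  xorE (.cell y (sc 20) (size (b + j))) (.cell y (sc 20) (.cell 3 (.const j) (.const 0)))

/-- Eliminate the differences of the two copies of `a` qubits. -/
def elimPairs (a b : ℕ) : Prog :=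
  seqRange a fun j =>
    .seq (pass (b + a) (pairE b 10 j) 1) (pass (b + a) (pairE b 11 j) 1)

/-- Eliminate the output qubits. -/
def elimOut (a b : ℕ) : Prog :=
  .loop 21 (size b) (.ite (.cell 14 (sc 21) (.const 0)) .skip
    (.seq (pass (b + a) (.cell 10 (sc 20) (sc 21)) 2) (pass (b + a) (.cell 11 (sc 20) (sc 21)) 2)))

section

variable {W : Type}

/-- The `x`-entry at the qubit `w`. -/
def coordX (w : W) : V2 W →ₗ[ZMod 2] ZMod 2 := (LinearMap.proj w).comp (LinearMap.fst _ _ _)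

/-- The `z`-entry at the qubit `w`. -/
def coordZ (w : W) : V2 W →ₗ[ZMod 2] ZMod 2 := (LinearMap.proj w).comp (LinearMap.snd _ _ _)

end

/-! ### Register layout and correctness of the elimination -/

section program

variable {n a b : ℕ}

/-- The columns of the working tableau: the output qubits have their labels, the two copies of the
`j`-th selected qubit are stored in the columns `n + b + j` and `s j`. -/
def jointCol (b : ℕ) (s : Fin a ↪ Fin n) : Joint (Fin b ⊕ Rest s) (Fin a) → ℕ :=
  Sum.elim (outputLabel s) (Sum.elim (fun j => n + (b + j)) (fun j => s j))

theorem card_rest (s : Fin a ↪ Fin n) : a + Fintype.card (Rest s) = n := by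
  have := Fintype.card_congr (partEquiv s)
  simpa using this

/-- Columns below `n` are the input qubits, selected or remaining; then come `b` output qubits and
`a` reference qubits. No column is shared or left over. -/
theorem jointCol_columns (s : Fin a ↪ Fin n) : Columns (jointCol b s) (n + (b + a)) := by
  refine ⟨?_, ?_, ?_⟩
  · rintro ((i | q) | (j | j)) ((i' | q') | (j' | j')) h <;>
      simp only [jointCol, outputLabel, Sum.elim_inl, Sum.elim_inr] at h
    · exact congrArg _ (congrArg _ (Fin.ext (by omega)))
    · exact absurd h (by have := q'.1.2; omega)
    · exact absurd h (by have := i.2; omega)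
    · exact absurd h (by have := (s j').2; omega)
    · exact absurd h (by have := q.1.2; omega)
    · exact congrArg _ (congrArg _ (Subtype.ext (Fin.ext h)))
    · exact absurd h (by have := q.1.2; omega)
    · exact absurd (Fin.ext h.symm) (q.2 j')
    · exact absurd h (by have := i'.2; omega)
    · exact absurd h (by have := q'.1.2; omega)
    · exact congrArg _ (congrArg _ (Fin.ext (by omega)))
    · exact absurd h (by have := (s j').2; omega)
    · exact absurd h (by have := (s j).2; omega)
    · exact absurd (Fin.ext h) (q'.2 j)
    · exact absurd h (by have := (s j).2; omega)
    · exact congrArg _ (congrArg _ (s.injective (Fin.ext h)))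
  · rintro ((i | q) | (j | j)) <;> simp only [jointCol, outputLabel, Sum.elim_inl, Sum.elim_inr]
    · have := i.2; omega
    · have := q.1.2; omega
    · have := j.2; omega
    · have := (s j).2; omega
  · have := card_rest s
    simp only [Fintype.card_sum, Fintype.card_fin]
    omega

/-- The part of the memory that describes the register. -/
structure Register (s : Fin a ↪ Fin n) (m : Memory) : Prop where
  size : m 4 0 0 = n
  select : ∀ j : Fin a, m 3 j 0 = s j
  flag : ∀ c, m 14 c 0 ≠ 0 ↔ ∃ j, (s j : ℕ) = c

theorem Register.congr {s : Fin a ↪ Fin n} {m m' : Memory} (h : Register s m) (h3 : m' 3 = m 3)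
    (h4 : m' 4 = m 4) (h14 : m' 14 = m 14) : Register s m' :=
  ⟨by rw [h4, h.size], fun j => by rw [h3, h.select], fun c => by rw [h14, h.flag]⟩

/-- The difference of the `x`-entries at the two copies of the `j`-th qubit. -/
def pairX {O : Type} (j : Fin a) : V2 (Joint O (Fin a)) →ₗ[ZMod 2] ZMod 2 :=
  coordX (Sum.inr (Sum.inl j)) + coordX (Sum.inr (Sum.inr j))

/-- The difference of the `z`-entries at the two copies of the `j`-th qubit. -/
def pairZ {O : Type} (j : Fin a) : V2 (Joint O (Fin a)) →ₗ[ZMod 2] ZMod 2 :=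
  coordZ (Sum.inr (Sum.inl j)) + coordZ (Sum.inr (Sum.inr j))

/-- The functionals for the first `k` pairs of qubits. -/
def pairFunctionals (O : Type) (a k : ℕ) : Set (V2 (Joint O (Fin a)) →ₗ[ZMod 2] ZMod 2) :=
  {ℓ | ∃ j : Fin a, (j : ℕ) < k ∧
    (ℓ = pairX j ∨
      ℓ = pairZ j)}

/-- The functionals for the output qubits in the first `k` columns. -/
def outFunctionals (b : ℕ) (s : Fin a ↪ Fin n) (k : ℕ) :
    Set (V2 (Joint (Fin b ⊕ Rest s) (Fin a)) →ₗ[ZMod 2] ZMod 2) :=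
  {ℓ | ∃ o, outputLabel s o < k ∧ (ℓ = coordX (Sum.inl o) ∨ ℓ = coordZ (Sum.inl o))}

theorem pairFunctionals_succ {O : Type} (j : Fin a) :
    insert (pairZ j)
      (insert (pairX j) (pairFunctionals O a j)) = pairFunctionals O a (j + 1) := by
  ext ℓ
  simp only [pairFunctionals, Set.mem_insert_iff, Set.mem_ofPred_eq]
  constructor
  · rintro (h | h | ⟨i, hi, h⟩)
    · exact ⟨j, by omega, Or.inr h⟩
    · exact ⟨j, by omega, Or.inl h⟩
    · exact ⟨i, by omega, h⟩
  · rintro ⟨i, hi, h⟩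
    rcases eq_or_ne i j with rfl | hij
    · exact h.elim (fun h => Or.inr (Or.inl h)) Or.inl
    · exact Or.inr (Or.inr ⟨i, by have : (i : ℕ) ≠ j := fun h => hij (Fin.ext h); omega, h⟩)

theorem outputLabel_injective (s : Fin a ↪ Fin n) :
    Function.Injective (outputLabel s : Fin b ⊕ Rest s → ℕ) := fun x y h =>
  Sum.inl_injective ((jointCol_columns s).injective (a₁ := Sum.inl x) (a₂ := Sum.inl y) h)

theorem outputLabel_lt (s : Fin a ↪ Fin n) (o : Fin b ⊕ Rest s) : outputLabel s o < n + b := by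
  rcases o with i | q <;> simp only [outputLabel, Sum.elim_inl, Sum.elim_inr]
  · have := i.2; omega
  · have := q.1.2; omega

theorem exists_outputLabel {s : Fin a ↪ Fin n} {k : ℕ} (hk : k < n + b)
    (hs : ¬ ∃ j, (s j : ℕ) = k) : ∃ o : Fin b ⊕ Rest s, outputLabel s o = k := by
  rcases lt_or_ge k n with hkn | hkn
  · exact ⟨Sum.inr ⟨⟨k, hkn⟩, fun j hj => hs ⟨j, by rw [hj]⟩⟩, rfl⟩
  · exact ⟨Sum.inl ⟨k - n, by omega⟩, by simp [outputLabel]; omega⟩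

theorem outputLabel_ne (s : Fin a ↪ Fin n) (o : Fin b ⊕ Rest s) (j : Fin a) :
    (s j : ℕ) ≠ outputLabel s o := fun h => Sum.inl_ne_inr ((jointCol_columns s).injective
      (a₁ := Sum.inl o) (a₂ := Sum.inr (Sum.inr j)) h.symm)

theorem outFunctionals_succ {s : Fin a ↪ Fin n} (o : Fin b ⊕ Rest s) :
    insert (coordZ (Sum.inl o)) (insert (coordX (Sum.inl o))
      (outFunctionals b s (outputLabel s o))) = outFunctionals b s (outputLabel s o + 1) := by
  ext ℓ
  simp only [outFunctionals, Set.mem_insert_iff, Set.mem_ofPred_eq]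
  constructor
  · rintro (h | h | ⟨i, hi, h⟩)
    · exact ⟨o, by omega, Or.inr h⟩
    · exact ⟨o, by omega, Or.inl h⟩
    · exact ⟨i, by omega, h⟩
  · rintro ⟨i, hi, h⟩
    rcases eq_or_ne i o with rfl | hij
    · exact h.elim (fun h => Or.inr (Or.inl h)) Or.inl
    · have : outputLabel s i ≠ outputLabel s o := fun h => hij (outputLabel_injective s h)
      exact Or.inr (Or.inr ⟨i, by omega, h⟩)

theorem bit_test {k : ℕ} (hk : k < 2) : k ≠ 0 ↔ (k : ZMod 2) = 1 := by
  interval_cases k <;> decide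

theorem pairE_test {s : Fin a ↪ Fin n} {m : Memory} (hm : Register s m) (hr : Reduced m)
    (j : Fin a) :
    ((pairE b 10 j).eval m ≠ 0 ↔ (pairX j)
      ((view (jointCol b s) m).v (m 20 0 0)) = 1) ∧
    ((pairE b 11 j).eval m ≠ 0 ↔ (pairZ j)
      ((view (jointCol b s) m).v (m 20 0 0)) = 1) := by
  have e : ∀ y, (pairE b y j).eval m = bxor (m y (m 20 0 0) (n + (b + j))) (m y (m 20 0 0) (s j)) := by
    intro y
    rw [pairE, xorE_eval]
    simp only [Expr.eval, sc_eval, size_eval, hm.size, hm.select]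
  rw [e, e]
  have h1 := (hr (m 20 0 0) (n + (b + j))).1
  have h2 := (hr (m 20 0 0) (s j)).1
  have h3 := (hr (m 20 0 0) (n + (b + j))).2.1
  have h4 := (hr (m 20 0 0) (s j)).2.1
  rw [bit_test (bxor_lt h1 h2), bit_test (bxor_lt h3 h4), bxor_cast h1 h2, bxor_cast h3 h4]
  exact ⟨Iff.rfl, Iff.rfl⟩

variable {s : Fin a ↪ Fin n} {m : Memory}
  {ψ : (Joint (Fin b ⊕ Rest s) (Fin a) → Fin 2) → ℂ}

/-- The first `k` pairs of qubits have been treated. -/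
structure PairsInv (m : Memory) (s : Fin a ↪ Fin n)
    (ψ : (Joint (Fin b ⊕ Rest s) (Fin a) → Fin 2) → ℂ)
    (L : Set (V2 (Joint (Fin b ⊕ Rest s) (Fin a)) →ₗ[ZMod 2] ZMod 2)) (m' : Memory) : Prop where
  reduced : Reduced m'
  frame : ∀ x, ¬ Scratch x → m' x = m x
  marks : ∀ r < n + (b + a), m' 13 r 0 ≤ 1
  generates : Generates (n + (b + a)) ψ (view (jointCol b s) m')
  detects : Detects (n + (b + a)) L (fun r => m' 13 r 0 ≠ 0) (view (jointCol b s) m').v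

theorem PairsInv.pass {L : Set (V2 (Joint (Fin b ⊕ Rest s) (Fin a)) →ₗ[ZMod 2] ZMod 2)}
    {m' : Memory} (hm : Register s m) (h : PairsInv m s ψ L m') {test : Expr}
    {ℓ : V2 (Joint (Fin b ⊕ Rest s) (Fin a)) →ₗ[ZMod 2] ZMod 2}
    (htest : ∀ m' : Memory, Register s m' → Reduced m' →
      (test.eval m' ≠ 0 ↔ ℓ ((view (jointCol b s) m').v (m' 20 0 0)) = 1)) :
    PairsInv m s ψ (insert ℓ L) ((pass (b + a) test 1).run m') := by
  have hreg : ∀ m'' : Memory, (∀ x, ¬ Scratch x → m'' x = m x) → Register s m'' := fun m'' hx =>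
    hm.congr (hx 3 (by simp [Scratch])) (hx 4 (by simp [Scratch])) (hx 14 (by simp [Scratch]))
  have hsize : m' 4 0 0 = n := (hreg m' h.frame).size
  obtain ⟨h1, h2⟩ := pass_spec (l := b + a) (mk := 1) (m := m') (test := test) (ℓ := ℓ)
    (by rw [hsize]; exact jointCol_columns s) one_ne_zero h.reduced (fun m'' hr hx =>
      htest m'' (hreg m'' fun x hxs => by rw [hx x hxs, h.frame x hxs]) hr)
  rw [hsize] at h2
  refine ⟨h1, fun x hx => ?_, fun r hr => ?_, h2.generates h.generates,
    h2.extend h.detects⟩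
  · rw [Prog.run_of_not_writes _ (pass_not_writes hx), h.frame x hx]
  · rcases h2.rows with h3 | ⟨p, -, -, -, -, -, hp, h3⟩
    · exact (h3 r).2.2.trans_le (h.marks r hr)
    · rcases eq_or_ne r p with rfl | hrp
      · exact hp.le
      · exact (h3 r hrp).1.trans_le (h.marks r hr)

theorem elimPairs_spec (hm : Register s m) (hr : Reduced m)
    (hmark : ∀ r < n + (b + a), m 13 r 0 = 0)
    (hg : Generates (n + (b + a)) ψ (view (jointCol b s) m)) :
    PairsInv m s ψ (pairFunctionals _ a a) ((elimPairs a b).run m) := by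
  rw [elimPairs, seqRange_run]
  refine iter_induction (p := fun k => PairsInv m s ψ (pairFunctionals _ a k)) a
    ⟨hr, fun _ _ => rfl, fun r hr => by rw [hmark r hr]; omega, hg, ?_, ?_⟩ ?_
  · rintro r - - ℓ ⟨j, hj, -⟩
    omega
  · intro c _ i hi
    exact absurd (hmark i i.2) hi
  · intro k m' hk h
    have h1 := h.pass hm (test := pairE b 10 k) (fun m'' hm'' hr'' =>
      (pairE_test (b := b) hm'' hr'' ⟨k, hk⟩).1)
    have h2 := h1.pass hm (test := pairE b 11 k) (fun m'' hm'' hr'' =>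
      (pairE_test (b := b) hm'' hr'' ⟨k, hk⟩).2)
    rw [show pairFunctionals _ a k = pairFunctionals _ a ((⟨k, hk⟩ : Fin a) : ℕ) from rfl,
      pairFunctionals_succ] at h2
    exact h2

/-- The pairs of qubits and some of the output qubits have been treated. -/
structure OutInv (m : Memory) (s : Fin a ↪ Fin n)
    (ψ : (Joint (Fin b ⊕ Rest s) (Fin a) → Fin 2) → ℂ)
    (L : Set (V2 (Joint (Fin b ⊕ Rest s) (Fin a)) →ₗ[ZMod 2] ZMod 2)) (m' : Memory) : Prop where
  reduced : Reduced m'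
  frame : ∀ x, ¬ Scratch x → x ≠ 21 → m' x = m x
  generates : Generates (n + (b + a)) ψ (view (jointCol b s) m')
  pairs : Detects (n + (b + a)) (pairFunctionals _ a a) (fun r => m' 13 r 0 = 1)
    (view (jointCol b s) m').v
  detects : Detects (n + (b + a)) L (fun r => m' 13 r 0 ≠ 0) (view (jointCol b s) m').v

theorem OutInv.pass {L : Set (V2 (Joint (Fin b ⊕ Rest s) (Fin a)) →ₗ[ZMod 2] ZMod 2)}
    {m' : Memory} (hm : Register s m) (h : OutInv m s ψ L m') {test : Expr}
    {ℓ : V2 (Joint (Fin b ⊕ Rest s) (Fin a)) →ₗ[ZMod 2] ZMod 2}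
    (htest : ∀ m'' : Memory, m'' 21 = m' 21 → Reduced m'' →
      (test.eval m'' ≠ 0 ↔ ℓ ((view (jointCol b s) m'').v (m'' 20 0 0)) = 1)) :
    OutInv m s ψ (insert ℓ L) ((StabProp.pass (b + a) test 2).run m') := by
  have hsize : m' 4 0 0 = n := by rw [h.frame 4 (by simp [Scratch]) (by decide), hm.size]
  obtain ⟨h1, h2⟩ := pass_spec (l := b + a) (mk := 2) (m := m') (test := test) (ℓ := ℓ)
    (by rw [hsize]; exact jointCol_columns s) two_ne_zero h.reduced (fun m'' hr hx =>
      htest m'' (hx 21 (by simp [Scratch])) hr)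
  rw [hsize] at h2
  refine ⟨h1, fun x hx hx' => ?_, h2.generates h.generates, ?_, h2.extend h.detects⟩
  · rw [Prog.run_of_not_writes _ (pass_not_writes hx), h.frame x hx hx']
  -- The pair functionals vanish on every row whose mark is not 1, in particular on the new pivot,
  -- so this round leaves their values alone.
  · have h3 := h2.keep (fun r _ (hr0 : m' 13 r 0 = 0) => by simp [hr0]) h.pairs
    have h4 : ∀ r, (m' 13 r 0 = 1) = ((StabProp.pass (b + a) test 2).run m' 13 r 0 = 1) := by
      intro r
      rcases h2.rows with h4 | ⟨p, -, hp0, -, -, -, hp, h4⟩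
      · exact congrArg (· = 1) (h4 r).2.2.symm
      · rcases eq_or_ne r p with rfl | hrp
        · have e1 : m' 13 r 0 = 0 := hp0
          have e2 : (StabProp.pass (b + a) test 2).run m' 13 r 0 = 2 := hp
          rw [e1, e2]
          simp
        · exact congrArg (· = 1) (h4 r hrp).1.symm
    simpa only [h4] using h3

theorem elimOut_spec (hm : Register s m) {m' : Memory}
    (h : PairsInv m s ψ (pairFunctionals _ a a) m') :
    OutInv m s ψ (outFunctionals b s (n + b) ∪ pairFunctionals _ a a)
      ((elimOut a b).run m') := by
  rw [elimOut, Prog.run_loop, size_eval, h.frame 4 (by simp [Scratch]), hm.size]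
  refine iter_induction
    (p := fun k => OutInv m s ψ (outFunctionals b s k ∪ pairFunctionals _ a a)) (n + b)
    ⟨h.reduced, fun x hx _ => h.frame x hx, h.generates, ⟨?_, ?_⟩, ?_⟩ ?_
  · intro r hr hr1 ℓ hℓ
    exact h.detects.vanish r hr (by have := h.marks r hr; omega) ℓ hℓ
  · intro c hc i hi
    exact h.detects.detect c hc i (by omega)
  · have : outFunctionals b s 0 = ∅ := by
      ext ℓ
      simp [outFunctionals]
    rw [this, Set.empty_union]
    exact h.detects
  · intro k m1 hk h1
    set m2 := m1.set 21 0 0 k with hm2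
    have h2x : ∀ x, x ≠ 21 → m2 x = m1 x := fun x hx => Memory.set_of_ne hx.symm
    have h221 : m2 21 0 0 = k := by simp [hm2, Memory.set]
    have hv2 : view (jointCol b s) m2 = view (jointCol b s) m1 := view_congr (h2x _ (by decide))
      (h2x _ (by decide)) (h2x _ (by decide)) (h2x _ (by decide))
    have h2 : OutInv m s ψ (outFunctionals b s k ∪ pairFunctionals _ a a) m2 := by
      refine ⟨fun i j => ?_, fun x hx hx' => ?_, ?_, ?_, ?_⟩
      · rw [h2x 10 (by decide), h2x 11 (by decide), h2x 12 (by decide)]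
        exact h1.reduced i j
      · rw [h2x x hx', h1.frame x hx hx']
      · rw [hv2]
        exact h1.generates
      · rw [hv2, h2x 13 (by decide)]
        exact h1.pairs
      · rw [hv2, h2x 13 (by decide)]
        exact h1.detects
    have hflag : (Expr.cell 14 (sc 21) (.const 0)).eval m2 ≠ 0 ↔ ∃ j, (s j : ℕ) = k := by
      simp only [Expr.eval, sc_eval, h221]
      rw [h2.frame 14 (by simp [Scratch]) (by decide)]
      exact hm.flag k
    rw [Prog.run_ite]
    split_ifs with hc
    -- A flagged column holds a selected qubit, which is no output qubit, so no functional is added.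
    · obtain ⟨j, hj⟩ := hflag.mp hc
      have : outFunctionals b s (k + 1) = outFunctionals b s k := by
        ext ℓ
        simp only [outFunctionals, Set.mem_ofPred_eq]
        refine exists_congr fun o => and_congr_left fun _ => ?_
        have : outputLabel s o ≠ k := by
          rw [← hj]
          exact (outputLabel_ne s o j).symm
        omega
      rw [this, Prog.run]
      exact h2
    · obtain ⟨o, ho⟩ := exists_outputLabel hk fun h => hc (hflag.mpr h)
      have t : ∀ m'' : Memory, m'' 21 = m2 21 → Reduced m'' →
          ((Expr.cell 10 (sc 20) (sc 21)).eval m'' ≠ 0 ↔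
            coordX (Sum.inl o) ((view (jointCol b s) m'').v (m'' 20 0 0)) = 1) ∧
          ((Expr.cell 11 (sc 20) (sc 21)).eval m'' ≠ 0 ↔
            coordZ (Sum.inl o) ((view (jointCol b s) m'').v (m'' 20 0 0)) = 1) := by
        intro m'' hx hr
        simp only [Expr.eval, sc_eval]
        rw [hx, h221, bit_test (hr _ _).1, bit_test (hr _ _).2.1, ← ho]
        exact ⟨Iff.rfl, Iff.rfl⟩
      have h3 := h2.pass hm (fun m'' hx hr => (t m'' hx hr).1)
      have e21 : (StabProp.pass (b + a) (.cell 10 (sc 20) (sc 21)) 2).run m2 21 = m2 21 :=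
        Prog.run_of_not_writes _ (pass_not_writes (by simp [Scratch])) _
      have h4 := h3.pass hm (fun m'' hx hr => (t m'' (hx.trans e21) hr).2)
      rw [← Set.insert_union, ← Set.insert_union, ← ho, outFunctionals_succ] at h4
      rw [← ho]
      exact h4

theorem pairFunctionals_iff {O : Type} (v : V2 (Joint O (Fin a))) :
    (∀ ℓ ∈ pairFunctionals O a a, ℓ v = 0) ↔ mismatch v = 0 := by
  have h1 : mismatch v = 0 ↔ ∀ j : Fin a, pairX j v = 0 ∧ pairZ j v = 0 := by
    rw [Prod.ext_iff, funext_iff, funext_iff, ← forall_and]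
    rfl
  rw [h1]
  constructor
  · exact fun h j => ⟨h _ ⟨j, j.2, Or.inl rfl⟩, h _ ⟨j, j.2, Or.inr rfl⟩⟩
  · rintro h ℓ ⟨j, -, rfl | rfl⟩
    · exact (h j).1
    · exact (h j).2

theorem outFunctionals_iff (v : V2 (Joint (Fin b ⊕ Rest s) (Fin a))) :
    (∀ ℓ ∈ outFunctionals b s (n + b), ℓ v = 0) ↔ outPart v = 0 := by
  have h1 : outPart v = 0 ↔ ∀ o : Fin b ⊕ Rest s,
      coordX (Sum.inl o) v = 0 ∧ coordZ (Sum.inl o) v = 0 := by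
    rw [Prod.ext_iff, funext_iff, funext_iff, ← forall_and]
    rfl
  rw [h1]
  constructor
  · exact fun h o => ⟨h _ ⟨o, outputLabel_lt s o, Or.inl rfl⟩, h _ ⟨o, outputLabel_lt s o, Or.inr rfl⟩⟩
  · rintro h ℓ ⟨o, -, rfl | rfl⟩
    · exact (h o).1
    · exact (h o).2

/-- Detection by the pair functionals alone gives `first`; detection by both families together gives
`second`. -/
theorem OutInv.echelon {m' : Memory}
    (h : OutInv m s ψ (outFunctionals b s (n + b) ∪ pairFunctionals _ a a) m') :
    Echelon (fun i : Fin (n + (b + a)) => m' 13 i 0)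
      (fun i : Fin (n + (b + a)) => (view (jointCol b s) m').v i) := by
  refine ⟨fun i hi => ?_, fun i hi => ?_, fun c hc i hi => ?_, fun c hc hc' i hi => ?_⟩
  · exact (pairFunctionals_iff _).mp (h.pairs.vanish i i.2 hi)
  · exact (outFunctionals_iff _).mp fun ℓ hℓ =>
      h.detects.vanish i i.2 (by simpa using hi) ℓ (Set.mem_union_left _ hℓ)
  · exact h.pairs.detect c ((pairFunctionals_iff _).mpr hc) i hi
  · refine h.detects.detect c ?_ i hi
    rintro ℓ (hℓ | hℓ)
    · exact (outFunctionals_iff _).mpr hc' ℓ hℓ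
    · exact (pairFunctionals_iff _).mpr hc ℓ hℓ

end program

/-! ### The joint state -/

section product

variable {P Q W : Type} [Fintype P] [DecidableEq P] [Fintype Q] [DecidableEq Q] [Fintype W]
  [DecidableEq W]

/-- The product of states of two parts of a register. -/
def productState (ε : P ⊕ Q ≃ W) (φ : (P → Fin 2) → ℂ) (ψ : (Q → Fin 2) → ℂ) :
    (W → Fin 2) → ℂ :=
  fun f => φ (fun p => f (ε (Sum.inl p))) * ψ (fun q => f (ε (Sum.inr q)))

theorem sum_product (ε : P ⊕ Q ≃ W) (F : (P → Fin 2) → (Q → Fin 2) → ℂ) :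
    ∑ f : W → Fin 2, F (fun p => f (ε (Sum.inl p))) (fun q => f (ε (Sum.inr q))) =
      ∑ g, ∑ h, F g h := by
  rw [← Fintype.sum_prod_type']
  exact Equiv.sum_comp ((Equiv.arrowCongr ε.symm (Equiv.refl (Fin 2))).trans
    (Equiv.sumArrowEquivProdArrow P Q (Fin 2))) fun x => F x.1 x.2

theorem productState_unit (ε : P ⊕ Q ≃ W) {φ : (P → Fin 2) → ℂ} {ψ : (Q → Fin 2) → ℂ}
    (hφ : star φ ⬝ᵥ φ = 1) (hψ : star ψ ⬝ᵥ ψ = 1) :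
    star (productState ε φ ψ) ⬝ᵥ productState ε φ ψ = 1 := by
  have : star (productState ε φ ψ) ⬝ᵥ productState ε φ ψ =
      ∑ g, ∑ h, (star φ g * φ g) * (star ψ h * ψ h) := by
    rw [← sum_product ε fun g h => (star φ g * φ g) * (star ψ h * ψ h)]
    refine Finset.sum_congr rfl fun f _ => ?_
    simp only [productState, Pi.star_apply, star_mul']
    ring
  rw [this, ← Finset.sum_mul_sum]
  have h1 : ∑ g, star φ g * φ g = 1 := hφ
  have h2 : ∑ h, star ψ h * ψ h = 1 := hψ
  rw [h1, h2, one_mul]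

theorem hz_product (ε : P ⊕ Q ≃ W) (v : V2 W) (f g : W → Fin 2) :
    hz v f g = hz (restr (fun p => ε (Sum.inl p)) v) (fun p => f (ε (Sum.inl p)))
        (fun p => g (ε (Sum.inl p))) *
      hz (restr (fun q => ε (Sum.inr q)) v) (fun q => f (ε (Sum.inr q)))
        (fun q => g (ε (Sum.inr q))) := by
  simp only [hz, tens, Matrix.of_apply]
  rw [← ε.prod_comp, Fintype.prod_sum_type]
  rfl

theorem hz_mulVec_product (ε : P ⊕ Q ≃ W) (v : V2 W) (φ : (P → Fin 2) → ℂ)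
    (ψ : (Q → Fin 2) → ℂ) :
    hz v *ᵥ productState ε φ ψ = productState ε (hz (restr (fun p => ε (Sum.inl p)) v) *ᵥ φ)
      (hz (restr (fun q => ε (Sum.inr q)) v) *ᵥ ψ) := by
  funext f
  simp only [Matrix.mulVec, dotProduct, productState, hz_product ε v]
  rw [Finset.sum_mul_sum, ← sum_product ε]
  refine Finset.sum_congr rfl fun g _ => ?_
  ring

theorem Fixes.product_left (ε : P ⊕ Q ≃ W) {v : V2 W} {e : ZMod 4} {φ : (P → Fin 2) → ℂ}
    (ψ : (Q → Fin 2) → ℂ) (h : Fixes e (restr (fun p => ε (Sum.inl p)) v) φ)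
    (h0 : restr (fun q => ε (Sum.inr q)) v = 0) : Fixes e v (productState ε φ ψ) := by
  rw [fixes_iff] at *
  rw [hz_mulVec_product, h, h0, hz_zero, Matrix.one_mulVec]
  funext f
  simp [productState, mul_assoc]

theorem Fixes.product_right (ε : P ⊕ Q ≃ W) {v : V2 W} {e : ZMod 4} (φ : (P → Fin 2) → ℂ)
    {ψ : (Q → Fin 2) → ℂ} (h : Fixes e (restr (fun q => ε (Sum.inr q)) v) ψ)
    (h0 : restr (fun p => ε (Sum.inl p)) v = 0) : Fixes e v (productState ε φ ψ) := by
  rw [fixes_iff] at *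
  rw [hz_mulVec_product, h, h0, hz_zero, Matrix.one_mulVec]
  funext f
  simp [productState, mul_left_comm]

/-- The phase exponent of a generator. -/
def Tableau.phase {k : ℕ} (T : Tableau k Q) (i : Fin k) : ZMod 4 :=
  2 * lift4 (T.sign i) + yCount (T.x i, T.z i)

/-- Each row is trivial on one of the two parts, so it fixes the product as soon as it fixes one
factor, and independence is block diagonal. -/
theorem generates_product (ε : P ⊕ Q ≃ W) {k l : ℕ} {S : Tableau k Q} {T : Tableau l P}
    {φ : (P → Fin 2) → ℂ} {ψ : (Q → Fin 2) → ℂ} (hS : S.Describes ψ) (hT : T.Describes φ)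
    {s : Rows W}
    (h1 : ∀ i : Fin k, restr (fun p => ε (Sum.inl p)) (s.v i) = 0 ∧
      restr (fun q => ε (Sum.inr q)) (s.v i) = (S.x i, S.z i) ∧ s.e i = S.phase i)
    (h2 : ∀ i : Fin l, restr (fun p => ε (Sum.inl p)) (s.v (k + i)) = (T.x i, T.z i) ∧
      restr (fun q => ε (Sum.inr q)) (s.v (k + i)) = 0 ∧ s.e (k + i) = T.phase i) :
    Generates (k + l) (productState ε φ ψ) s := by
  refine ⟨fun r hr => ?_, ?_⟩
  · rcases lt_or_ge r k with h | h
    · obtain ⟨g1, g2, g3⟩ := h1 ⟨r, h⟩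
      refine Fixes.product_right ε φ ?_ g1
      rw [g2, g3]
      exact hS.fixes _
    · obtain ⟨g1, g2, g3⟩ := h2 ⟨r - k, by omega⟩
      simp only [Nat.add_sub_of_le h] at g1 g2 g3
      refine Fixes.product_left ε ψ ?_ g2
      rw [g1, g3]
      exact hT.fixes _
  · rw [Fintype.linearIndependent_iff]
    intro c hc
    rw [Fin.sum_univ_add] at hc
    have c1 := congrArg (restr fun q => ε (Sum.inr q)) hc
    have c2 := congrArg (restr fun p => ε (Sum.inl p)) hc
    simp only [map_add, map_sum, map_smul, map_zero, Fin.val_castAdd, Fin.val_natAdd, h1, h2,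
      smul_zero, Finset.sum_const_zero, add_zero, zero_add] at c1 c2
    have d1 := Fintype.linearIndependent_iff.mp hS.independent _ c1
    have d2 := Fintype.linearIndependent_iff.mp hT.independent _ c2
    intro i
    induction i using Fin.addCases with
    | left i => exact d1 i
    | right i => exact d2 i

end product

/-! ### Loading the tableau of the product of a Choi component and the input -/

section load

variable {n a b : ℕ}

/-- The joint register consists of the register of a Choi state and the register of a state. -/
def jointEquiv (b : ℕ) (s : Fin a ↪ Fin n) :
    (Fin b ⊕ Fin a) ⊕ Fin n ≃ Joint (Fin b ⊕ Rest s) (Fin a) where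
  toFun := Sum.elim (Sum.elim (fun i => Sum.inl (Sum.inl i)) fun j => Sum.inr (Sum.inl j))
    fun q => Sum.elim (fun j => Sum.inr (Sum.inr j)) (fun q => Sum.inl (Sum.inr q))
      ((partEquiv s).symm q)
  invFun := Sum.elim (Sum.elim (fun i => Sum.inl (Sum.inl i)) fun q => Sum.inr q.1)
    (Sum.elim (fun j => Sum.inl (Sum.inr j)) fun j => Sum.inr (s j))
  left_inv := by
    rintro ((i | j) | q)
    · rfl
    · rfl
    · obtain ⟨(j | q), rfl⟩ := (partEquiv s).surjective q <;>
        simp only [Sum.elim_inr, Equiv.symm_apply_apply, Sum.elim_inl] <;> rfl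
  right_inv := by
    rintro ((i | q) | (j | j))
    · rfl
    · have : (partEquiv s).symm q.1 = Sum.inr q := by rw [Equiv.symm_apply_eq]; rfl
      simp [this]
    · rfl
    · have : (partEquiv s).symm (s j) = Sum.inl j := by rw [Equiv.symm_apply_eq]; rfl
      simp [this]

theorem jointCol_left (s : Fin a ↪ Fin n) (p : Fin b ⊕ Fin a) :
    jointCol b s (jointEquiv b s (Sum.inl p)) = n + finSumFinEquiv p := by
  rcases p with i | j <;> simp [jointCol, jointEquiv, outputLabel]

theorem jointCol_right (s : Fin a ↪ Fin n) (q : Fin n) :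
    jointCol b s (jointEquiv b s (Sum.inr q)) = q := by
  obtain ⟨(j | q), rfl⟩ := (partEquiv s).surjective q <;>
    simp only [jointEquiv, jointCol, Equiv.coe_fn_mk, Sum.elim_inr, Equiv.symm_apply_apply,
      Sum.elim_inl] <;> rfl

/-- Copy the columns of the row `20[0, 0]` of the input. -/
def copyRow (l : ℕ) : Prog :=
  .loop 22 (size l)
    (.seq
      -- A column with both bits set is a `Y = i X Z` and adds one to the exponent.
      (.assign 12 (sc 20) (.const 0) (modE (.add (.cell 12 (sc 20) (.const 0))
        (andE (.cell 0 (sc 20) (sc 22)) (.cell 1 (sc 20) (sc 22))))))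
      (.seq
        (.assign 10 (sc 20) (sc 22) (.cell 0 (sc 20) (sc 22)))
        (.assign 11 (sc 20) (sc 22) (.cell 1 (sc 20) (sc 22)))))

/-- Copy the input to the working tableau. -/
def copyInput (l : ℕ) : Prog :=
  -- All `n + l` rows and columns are covered: the input arrays are zero from index `n` on, and this
  -- erases what an earlier component has left in the working tableau.
  .loop 20 (size l)
    (.seq
      -- A sign is `i ^ 2`, so the sign bit enters doubled.
      (.assign 12 (sc 20) (.const 0)
        (.add (.cell 2 (sc 20) (.const 0)) (.cell 2 (sc 20) (.const 0))))
      (.seq (.assign 13 (sc 20) (.const 0) (.const 0)) (copyRow l)))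

/-- The entries of the input tableau are bits. -/
def InputBits (m : Memory) : Prop := ∀ i j, m 0 i j < 2 ∧ m 1 i j < 2 ∧ m 2 i j < 2

/-- The first `k` columns of the row `r` have been copied. -/
structure CopyRowInv (m : Memory) (r k : ℕ) (m' : Memory) : Prop where
  reduced : Reduced m'
  frame : ∀ x, x ≠ 10 → x ≠ 11 → x ≠ 12 → x ≠ 22 → m' x = m x
  other : ∀ i j, i ≠ r → m' 10 i j = m 10 i j ∧ m' 11 i j = m 11 i j ∧ m' 12 i j = m 12 i j
  done : ∀ j, j < k → m' 10 r j = m 0 r j ∧ m' 11 r j = m 1 r j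
  phase : (m' 12 r 0 : ZMod 4) =
    m 12 r 0 + ∑ j ∈ Finset.range k, lift4 (m 0 r j) * lift4 (m 1 r j)

theorem copyRow_spec {l : ℕ} {m : Memory} {r : ℕ} (hm : Reduced m) (hi : InputBits m)
    (hr : m 20 0 0 = r) : CopyRowInv m r (m 4 0 0 + l) ((copyRow l).run m) := by
  rw [copyRow, Prog.run_loop, size_eval]
  refine iter_induction (p := CopyRowInv m r) _
    ⟨hm, fun _ _ _ _ _ => rfl, fun _ _ _ => ⟨rfl, rfl, rfl⟩, fun j hj => by omega, by simp⟩ ?_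
  intro k m' hk h
  have b0 := (hi r k).1
  have b1 := (hi r k).2.1
  have b2 := (h.reduced r 0).2.2
  have hlt : m' 12 r 0 + band (m 0 r k) (m 1 r k) < 8 := by
    have := band_lt b0 b1
    omega
  have f20 : m' 20 0 0 = r := by
    rw [h.frame 20 (by decide) (by decide) (by decide) (by decide), hr]
  have f0 : m' 0 = m 0 := h.frame 0 (by decide) (by decide) (by decide) (by decide)
  have f1 : m' 1 = m 1 := h.frame 1 (by decide) (by decide) (by decide) (by decide)
  set m'' := Prog.run _ _ with hm''
  have e12 : ∀ i j, m'' 12 i j = if i = r ∧ j = 0 then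
      mod4 (m' 12 r 0 + band (m 0 r k) (m 1 r k)) else m' 12 i j := by
    intro i j
    simp [hm'', Prog.run, Memory.set, Expr.eval, modE_eval, andE_eval, sc_eval, f20, f0, f1]
  have e10 : ∀ i j, m'' 10 i j = if i = r ∧ j = k then m 0 r k else m' 10 i j := by
    intro i j
    simp [hm'', Prog.run, Memory.set, Expr.eval, sc_eval, f20, f0]
  have e11 : ∀ i j, m'' 11 i j = if i = r ∧ j = k then m 1 r k else m' 11 i j := by
    intro i j
    simp [hm'', Prog.run, Memory.set, Expr.eval, sc_eval, f20, f1]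
  refine ⟨fun i j => ?_, fun x h10 h11 h12 h22 => ?_, fun i j hi' => ?_, fun j hj => ?_, ?_⟩
  · rw [e10, e11, e12]
    refine ⟨?_, ?_, ?_⟩ <;> split_ifs
    · exact b0
    · exact (h.reduced i j).1
    · exact b1
    · exact (h.reduced i j).2.1
    · exact mod4_lt hlt
    · exact (h.reduced i j).2.2
  · rw [hm'', Prog.run_of_not_writes _ (by simp [Prog.Writes]; omega), Memory.set_of_ne h22.symm,
      h.frame x h10 h11 h12 h22]
  · rw [e10, e11, e12, if_neg (by simp [hi']), if_neg (by simp [hi']), if_neg (by simp [hi'])]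
    exact h.other i j hi'
  · rw [e10, e11]
    rcases eq_or_ne j k with rfl | hjk
    · rw [if_pos ⟨rfl, rfl⟩, if_pos ⟨rfl, rfl⟩]
      exact ⟨rfl, rfl⟩
    · rw [if_neg (by simp [hjk]), if_neg (by simp [hjk])]
      exact h.done j (by omega)
  · rw [e12, if_pos ⟨rfl, rfl⟩, mod4_cast hlt, Finset.sum_range_succ, Nat.cast_add, h.phase,
      band_cast b0 b1]
    ring

/-- The first `k` rows have been copied. -/
structure CopyInv (m : Memory) (N k : ℕ) (m' : Memory) : Prop where
  reduced : Reduced m'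
  frame : ∀ x, x ≠ 10 → x ≠ 11 → x ≠ 12 → x ≠ 13 → x ≠ 20 → x ≠ 22 → m' x = m x
  done : ∀ r < k, ∀ j < N, m' 10 r j = m 0 r j ∧ m' 11 r j = m 1 r j
  phase : ∀ r < k, (m' 12 r 0 : ZMod 4) = 2 * lift4 (m 2 r 0) +
    ∑ j ∈ Finset.range N, lift4 (m 0 r j) * lift4 (m 1 r j)
  mark : ∀ r < k, m' 13 r 0 = 0

theorem copyInput_spec {l : ℕ} {m : Memory} (hm : Reduced m) (hi : InputBits m) :
    CopyInv m (m 4 0 0 + l) (m 4 0 0 + l) ((copyInput l).run m) := by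
  rw [copyInput, Prog.run_loop, size_eval]
  refine iter_induction (p := CopyInv m (m 4 0 0 + l)) _
    ⟨hm, fun _ _ _ _ _ _ _ => rfl, fun j hj => by omega, fun j hj => by omega,
      fun j hj => by omega⟩ ?_
  intro k m' hk h
  have f0 : m' 0 = m 0 := h.frame 0 (by decide) (by decide) (by decide) (by decide) (by decide)
    (by decide)
  have f1 : m' 1 = m 1 := h.frame 1 (by decide) (by decide) (by decide) (by decide) (by decide)
    (by decide)
  have f2 : m' 2 = m 2 := h.frame 2 (by decide) (by decide) (by decide) (by decide) (by decide)
    (by decide)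
  have f4 : m' 4 = m 4 := h.frame 4 (by decide) (by decide) (by decide) (by decide) (by decide)
    (by decide)
  rw [Prog.run_seq, Prog.run_seq]
  set m1 := Prog.run (.assign 13 _ _ _) _ with hm1
  have g20 : m1 20 0 0 = k := by simp [hm1, Prog.run, Memory.set]
  have g12 : ∀ i j, m1 12 i j = if i = k ∧ j = 0 then m 2 k 0 + m 2 k 0 else m' 12 i j := by
    intro i j
    simp [hm1, Prog.run, Memory.set, Expr.eval, sc_eval, f2]
  have g13 : ∀ i j, m1 13 i j = if i = k ∧ j = 0 then 0 else m' 13 i j := by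
    intro i j
    simp [hm1, Prog.run, Memory.set, Expr.eval, sc_eval]
  have gx : ∀ x, x ≠ 12 → x ≠ 13 → x ≠ 20 → m1 x = m' x := by
    intro x h12 h13 h20
    rw [hm1, Prog.run, Memory.set_of_ne h13.symm, Prog.run, Memory.set_of_ne h12.symm,
      Memory.set_of_ne h20.symm]
  have b2 := (hi k 0).2.2
  have hred : Reduced m1 := by
    intro i j
    rw [gx 10 (by decide) (by decide) (by decide), gx 11 (by decide) (by decide) (by decide), g12]
    refine ⟨(h.reduced i j).1, (h.reduced i j).2.1, ?_⟩
    split_ifs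
    · omega
    · exact (h.reduced i j).2.2
  have k0 : m1 0 = m 0 := by rw [gx 0 (by decide) (by decide) (by decide), f0]
  have k1 : m1 1 = m 1 := by rw [gx 1 (by decide) (by decide) (by decide), f1]
  have k2 : m1 2 = m 2 := by rw [gx 2 (by decide) (by decide) (by decide), f2]
  have key := copyRow_spec (l := l) hred (fun i j => by rw [k0, k1, k2]; exact hi i j) g20
  rw [gx 4 (by decide) (by decide) (by decide), f4] at key
  set m2 := (copyRow l).run m1
  have h13 : m2 13 = m1 13 := key.frame 13 (by decide) (by decide) (by decide) (by decide)
  refine ⟨key.reduced, fun x h10 h11 h12 h13 h20 h22 => ?_, fun r hr j hj => ?_, fun r hr => ?_,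
    fun r hr => ?_⟩
  · rw [key.frame x h10 h11 h12 h22, gx x h12 h13 h20, h.frame x h10 h11 h12 h13 h20 h22]
  · rcases eq_or_ne r k with rfl | hrk
    · have := key.done j hj
      rwa [k0, k1] at this
    · have := key.other r j hrk
      rw [this.1, this.2.1, gx 10 (by decide) (by decide) (by decide),
        gx 11 (by decide) (by decide) (by decide)]
      exact h.done r (by omega) j hj
  · rcases eq_or_ne r k with rfl | hrk
    · rw [key.phase, k0, k1, g12, if_pos ⟨rfl, rfl⟩]
      congr 1
      generalize m 2 r 0 = t at b2
      interval_cases t <;> decide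
    · rw [(key.other r 0 hrk).2.2, g12, if_neg (by simp [hrk])]
      exact h.phase r (by omega)
  · rw [h13, g13]
    split_ifs with hrk
    · rfl
    · exact h.mark r (by simp at hrk; omega)

/-- Write a constant row into the working tableau, from the column `n` on. -/
def writeRow (l i : ℕ) (X Z : ℕ → ℕ) : Prog :=
  seqRange l fun j => .seq (.assign 10 (size i) (size j) (.const (X j)))
    (.assign 11 (size i) (size j) (.const (Z j)))

/-- Write a constant array into the working tableau, from the row and column `n` on. -/
def writeTable (l : ℕ) (X Z : ℕ → ℕ → ℕ) (E : ℕ → ℕ) : Prog :=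
  seqRange l fun i => .seq (.assign 12 (size i) (.const 0) (.const (E i)))
    (writeRow l i (X i) (Z i))

/-- A part of a row of the working tableau has been replaced. -/
structure WriteRowInv (m : Memory) (n r k : ℕ) (X Z : ℕ → ℕ) (m' : Memory) : Prop where
  frame : ∀ x, x ≠ 10 → x ≠ 11 → m' x = m x
  x : ∀ i j, m' 10 i j = if i = n + r ∧ n ≤ j ∧ j < n + k then X (j - n) else m 10 i j
  z : ∀ i j, m' 11 i j = if i = n + r ∧ n ≤ j ∧ j < n + k then Z (j - n) else m 11 i j

theorem writeRow_spec (l r : ℕ) (X Z : ℕ → ℕ) (m : Memory) :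
    WriteRowInv m (m 4 0 0) r l X Z ((writeRow l r X Z).run m) := by
  rw [writeRow, seqRange_run]
  refine iter_induction (p := fun k => WriteRowInv m (m 4 0 0) r k X Z) l
    ⟨fun _ _ _ => rfl, fun i j => by rw [if_neg (by omega)],
      fun i j => by rw [if_neg (by omega)]⟩ ?_
  intro k m' hk h
  have f4 : m' 4 0 0 = m 4 0 0 := by rw [h.frame 4 (by decide) (by decide)]
  set n := m 4 0 0
  refine ⟨fun x h10 h11 => ?_, fun i j => ?_, fun i j => ?_⟩
  · rw [Prog.run_of_not_writes _ (by simp [Prog.Writes]; omega), h.frame x h10 h11]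
  · have : (Prog.seq (.assign 10 (size r) (size k) (.const (X k)))
        (.assign 11 (size r) (size k) (.const (Z k)))).run m' 10 i j =
        if i = n + r ∧ j = n + k then X k else m' 10 i j := by
      simp [Prog.run, Memory.set, Expr.eval, size_eval, f4]
    rw [this, h.x]
    by_cases h1 : i = n + r ∧ j = n + k
    · rw [if_pos h1, if_pos (by omega), h1.2, Nat.add_sub_cancel_left]
    · rw [if_neg h1]
      exact if_congr (by omega) rfl rfl
  · have : (Prog.seq (.assign 10 (size r) (size k) (.const (X k)))
        (.assign 11 (size r) (size k) (.const (Z k)))).run m' 11 i j =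
        if i = n + r ∧ j = n + k then Z k else m' 11 i j := by
      simp [Prog.run, Memory.set, Expr.eval, size_eval, f4]
    rw [this, h.z]
    by_cases h1 : i = n + r ∧ j = n + k
    · rw [if_pos h1, if_pos (by omega), h1.2, Nat.add_sub_cancel_left]
    · rw [if_neg h1]
      exact if_congr (by omega) rfl rfl

/-- Some rows of the working tableau have been replaced. -/
structure WriteInv (m : Memory) (n l k : ℕ) (X Z : ℕ → ℕ → ℕ) (E : ℕ → ℕ) (m' : Memory) :
    Prop where
  frame : ∀ x, x ≠ 10 → x ≠ 11 → x ≠ 12 → m' x = m x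
  x : ∀ i j, m' 10 i j =
    if n ≤ i ∧ i < n + k ∧ n ≤ j ∧ j < n + l then X (i - n) (j - n) else m 10 i j
  z : ∀ i j, m' 11 i j =
    if n ≤ i ∧ i < n + k ∧ n ≤ j ∧ j < n + l then Z (i - n) (j - n) else m 11 i j
  e : ∀ i j, m' 12 i j = if n ≤ i ∧ i < n + k ∧ j = 0 then E (i - n) else m 12 i j

theorem writeTable_spec (l : ℕ) (X Z : ℕ → ℕ → ℕ) (E : ℕ → ℕ) (m : Memory) :
    WriteInv m (m 4 0 0) l l X Z E ((writeTable l X Z E).run m) := by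
  rw [writeTable, seqRange_run]
  refine iter_induction (p := fun k => WriteInv m (m 4 0 0) l k X Z E) l
    ⟨fun _ _ _ _ => rfl, fun i j => by rw [if_neg (by omega)],
      fun i j => by rw [if_neg (by omega)], fun i j => by rw [if_neg (by omega)]⟩ ?_
  intro k m' hk h
  rw [Prog.run_seq]
  set m1 := Prog.run _ m' with hm1
  have f4 : m' 4 0 0 = m 4 0 0 := by rw [h.frame 4 (by decide) (by decide) (by decide)]
  have f1 : ∀ x, x ≠ 12 → m1 x = m' x := fun x hx => Memory.set_of_ne hx.symm
  have e12 : ∀ i j, m1 12 i j = if i = m 4 0 0 + k ∧ j = 0 then E k else m' 12 i j := by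
    intro i j
    simp [hm1, Prog.run, Memory.set, Expr.eval, size_eval, f4]
  have key := writeRow_spec l k (X k) (Z k) m1
  rw [f1 4 (by decide), f4] at key
  set n := m 4 0 0
  refine ⟨fun x h10 h11 h12 => ?_, fun i j => ?_, fun i j => ?_, fun i j => ?_⟩
  · rw [key.frame x h10 h11, f1 x h12, h.frame x h10 h11 h12]
  · rw [key.x, f1 10 (by decide), h.x]
    by_cases h1 : i = n + k ∧ n ≤ j ∧ j < n + l
    · rw [if_pos h1, if_pos (by omega), h1.1, Nat.add_sub_cancel_left]
    · rw [if_neg h1]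
      exact if_congr (by omega) rfl rfl
  · rw [key.z, f1 11 (by decide), h.z]
    by_cases h1 : i = n + k ∧ n ≤ j ∧ j < n + l
    · rw [if_pos h1, if_pos (by omega), h1.1, Nat.add_sub_cancel_left]
    · rw [if_neg h1]
      exact if_congr (by omega) rfl rfl
  · rw [key.frame 12 (by decide) (by decide), e12, h.e]
    by_cases h1 : i = n + k ∧ j = 0
    · rw [if_pos h1, if_pos (by omega), h1.1, Nat.add_sub_cancel_left]
    · rw [if_neg h1]
      exact if_congr (by omega) rfl rfl

/-- The entries of a tableau as a function on natural numbers. -/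
def bitTable {k : ℕ} {P : Type} {l : ℕ} (ε : P ≃ Fin l) (x : Fin k → P → ZMod 2) (i j : ℕ) : ℕ :=
  if h : i < k ∧ j < l then (x ⟨i, h.1⟩ (ε.symm ⟨j, h.2⟩)).val else 0

theorem bitTable_lt {k : ℕ} {P : Type} {l : ℕ} (ε : P ≃ Fin l) (x : Fin k → P → ZMod 2)
    (i j : ℕ) : bitTable ε x i j < 2 := by
  unfold bitTable
  split_ifs
  · exact ZMod.val_lt _
  · omega

theorem bitTable_cast {k : ℕ} {P : Type} {l : ℕ} (ε : P ≃ Fin l) (x : Fin k → P → ZMod 2)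
    (i : Fin k) (p : P) : ((bitTable ε x i (ε p) : ℕ) : ZMod 2) = x i p := by
  simp [bitTable]

/-- The phase exponents of a tableau as a function on natural numbers. -/
def phaseTable {k : ℕ} {P : Type} [Fintype P] (T : Tableau k P) (i : ℕ) : ℕ :=
  if h : i < k then (T.phase ⟨i, h⟩).val else 0

theorem phaseTable_lt {k : ℕ} {P : Type} [Fintype P] (T : Tableau k P) (i : ℕ) :
    phaseTable T i < 4 := by
  unfold phaseTable
  split_ifs
  · exact ZMod.val_lt _
  · omega

/-- Load the input and a constant tableau into the working tableau. -/
def load (C : Tableau (b + a) (Fin b ⊕ Fin a)) : Prog :=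
  .seq (copyInput (b + a))
    (writeTable (b + a) (bitTable finSumFinEquiv C.x) (bitTable finSumFinEquiv C.z)
      (phaseTable C))

/-- The arrays of the input are unchanged. -/
def InputKept (T : Tableau n (Fin n)) (s : Fin a ↪ Fin n) (m : Memory) : Prop :=
  ∀ x, x < 5 → m x = inputMemory T s x

section input

variable {T : Tableau n (Fin n)} {s : Fin a ↪ Fin n} {m : Memory}

theorem InputKept.bits (hm : InputKept T s m) : InputBits m := by
  intro i j
  rw [hm 0 (by decide), hm 1 (by decide), hm 2 (by decide)]
  simp only [inputMemory]
  refine ⟨?_, ?_, ?_⟩ <;> simp only [reduceIte, OfNat.ofNat_ne_zero, one_ne_zero,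
    OfNat.ofNat_ne_one] <;> split_ifs
  all_goals first | exact ZMod.val_lt _ | omega

theorem InputKept.size (hm : InputKept T s m) : m 4 0 0 = n := by
  rw [hm 4 (by decide)]
  simp [inputMemory]

theorem InputKept.x (hm : InputKept T s m) (i j : ℕ) :
    (m 0 i j : ZMod 2) = if h : i < n ∧ j < n then T.x ⟨i, h.1⟩ ⟨j, h.2⟩ else 0 := by
  rw [hm 0 (by decide)]
  simp only [inputMemory]
  split_ifs <;> simp

theorem InputKept.z (hm : InputKept T s m) (i j : ℕ) :
    (m 1 i j : ZMod 2) = if h : i < n ∧ j < n then T.z ⟨i, h.1⟩ ⟨j, h.2⟩ else 0 := by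
  rw [hm 1 (by decide)]
  simp only [inputMemory, one_ne_zero, if_false, if_true]
  split_ifs <;> simp

theorem InputKept.sign (hm : InputKept T s m) (i : Fin n) : (m 2 i 0 : ZMod 2) = T.sign i := by
  rw [hm 2 (by decide)]
  simp [inputMemory]

/-- The rows below `n` carry the generators of the input and the next `b + a` rows those of `C`, in
disjoint sets of columns; this is a tableau of the product state. -/
theorem load_spec {C : Tableau (b + a) (Fin b ⊕ Fin a)} {φ : (Fin b ⊕ Fin a → Fin 2) → ℂ}
    {ψ : (Fin n → Fin 2) → ℂ} (hm : InputKept T s m) (hr : Reduced m) (hT : T.Describes ψ)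
    (hC : C.Describes φ) :
    Reduced ((load C).run m) ∧ (∀ r < n + (b + a), (load C).run m 13 r 0 = 0) ∧
      Generates (n + (b + a)) (productState (jointEquiv b s) φ ψ)
        (view (jointCol b s) ((load C).run m)) := by
  have h1 := copyInput_spec (l := b + a) hr hm.bits
  rw [load, Prog.run_seq]
  set m1 := (copyInput (b + a)).run m
  have h2 := writeTable_spec (b + a) (bitTable finSumFinEquiv C.x) (bitTable finSumFinEquiv C.z)
    (phaseTable C) m1
  have f4 : m1 4 0 0 = n := by
    rw [h1.frame 4 (by decide) (by decide) (by decide) (by decide) (by decide) (by decide),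
      hm.size]
  rw [f4] at h2
  rw [hm.size] at h1
  set m2 := Prog.run _ m1
  refine ⟨fun i j => ?_, fun r hr' => ?_, generates_product _ hT hC (fun i => ?_) fun i => ?_⟩
  · rw [h2.x, h2.z, h2.e]
    refine ⟨?_, ?_, ?_⟩ <;> split_ifs
    · exact bitTable_lt _ _ _ _
    · exact (h1.reduced i j).1
    · exact bitTable_lt _ _ _ _
    · exact (h1.reduced i j).2.1
    · exact phaseTable_lt _ _
    · exact (h1.reduced i j).2.2
  · rw [h2.frame 13 (by decide) (by decide) (by decide)]
    exact h1.mark r hr'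
  · have hi : (i : ℕ) < n + (b + a) := by omega
    have ex : ∀ j, j < n + (b + a) → (m2 10 i j : ZMod 2) =
        if h : (i : ℕ) < n ∧ j < n then T.x ⟨i, h.1⟩ ⟨j, h.2⟩ else 0 := by
      intro j hj
      rw [h2.x, if_neg (by omega), (h1.done i hi j hj).1, hm.x]
    have ez : ∀ j, j < n + (b + a) → (m2 11 i j : ZMod 2) =
        if h : (i : ℕ) < n ∧ j < n then T.z ⟨i, h.1⟩ ⟨j, h.2⟩ else 0 := by
      intro j hj
      rw [h2.z, if_neg (by omega), (h1.done i hi j hj).2, hm.z]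
    refine ⟨?_, ?_, ?_⟩
    · ext p
      · simp only [restr_apply, view, jointCol_left]
        rw [ex _ (by omega), dif_neg (by omega)]
        rfl
      · simp only [restr_apply, view, jointCol_left]
        rw [ez _ (by omega), dif_neg (by omega)]
        rfl
    · ext q
      · simp only [restr_apply, view, jointCol_right]
        rw [ex _ (by omega), dif_pos ⟨i.2, q.2⟩]
      · simp only [restr_apply, view, jointCol_right]
        rw [ez _ (by omega), dif_pos ⟨i.2, q.2⟩]
    · simp only [view]
      rw [h2.e, if_neg (by omega), h1.phase i hi, (jointCol_columns s).sum_range, hm.sign,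
        ← (jointEquiv b s).sum_comp, Fintype.sum_sum_type, Tableau.phase, yCount]
      simp only [jointCol_left, jointCol_right, hm.x, hm.z]
      congr 1
      rw [Finset.sum_eq_zero, zero_add]
      · refine Finset.sum_congr rfl fun q _ => ?_
        rw [dif_pos ⟨i.2, q.2⟩, dif_pos ⟨i.2, q.2⟩]
      · intro p _
        rw [dif_neg (by omega)]
        simp [lift4]
  · have hi : n + (i : ℕ) < n + (b + a) := by omega
    refine ⟨?_, ?_, ?_⟩
    · ext p
      · simp only [restr_apply, view, jointCol_left]
        rw [h2.x, if_pos (by omega), Nat.add_sub_cancel_left, Nat.add_sub_cancel_left,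
          bitTable_cast]
      · simp only [restr_apply, view, jointCol_left]
        rw [h2.z, if_pos (by omega), Nat.add_sub_cancel_left, Nat.add_sub_cancel_left,
          bitTable_cast]
    · ext q
      · simp only [restr_apply, view, jointCol_right]
        rw [h2.x, if_neg (by omega), (h1.done _ hi q (by omega)).1, hm.x, dif_neg (by omega)]
        rfl
      · simp only [restr_apply, view, jointCol_right]
        rw [h2.z, if_neg (by omega), (h1.done _ hi q (by omega)).2, hm.z, dif_neg (by omega)]
        rfl
    · simp only [view]
      rw [h2.e, if_pos (by omega), Nat.add_sub_cancel_left]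
      simp [phaseTable]

end input

end load

/-! ### Counting rows -/

section count

/-- Count the rows without a mark in `26[0, 0]` and add their phase exponents in `27[0, 0]`. -/
def countRows (l : ℕ) : Prog :=
  .seq (.assign 26 (.const 0) (.const 0) (.const 0))
    (.seq (.assign 27 (.const 0) (.const 0) (.const 0))
      (.loop 20 (size l) (.ite (.cell 13 (sc 20) (.const 0)) .skip
        (.seq (.assign 26 (.const 0) (.const 0) (.add (sc 26) (.const 1)))
          -- The sum is not reduced modulo 4, so it is zero only if every exponent is.
          (.assign 27 (.const 0) (.const 0) (.add (sc 27) (.cell 12 (sc 20) (.const 0))))))))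

/-- The first `k` rows have been counted. -/
structure CountInv (m : Memory) (k : ℕ) (m' : Memory) : Prop where
  frame : ∀ x, x ≠ 20 → x ≠ 26 → x ≠ 27 → m' x = m x
  count : m' 26 0 0 = Nat.count (fun r => m 13 r 0 = 0) k
  phase : m' 27 0 0 = 0 ↔ ∀ r < k, m 13 r 0 = 0 → m 12 r 0 = 0

theorem countRows_spec (l : ℕ) (m : Memory) :
    CountInv m (m 4 0 0 + l) ((countRows l).run m) := by
  rw [countRows, Prog.run_seq, Prog.run_seq, Prog.run_loop, size_eval]
  set m0 := Prog.run _ (Prog.run _ m) with hm0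
  have f0 : ∀ x, x ≠ 26 → x ≠ 27 → m0 x = m x := fun x h26 h27 => by
    rw [hm0, Prog.run_of_not_writes _ (by simp [Prog.Writes]; omega),
      Prog.run_of_not_writes _ (by simp [Prog.Writes]; omega)]
  rw [f0 4 (by decide) (by decide)]
  refine iter_induction (p := CountInv m) _ ⟨fun x _ h26 h27 => f0 x h26 h27, ?_, ?_⟩ ?_
  · simp [hm0, Prog.run, Memory.set, Expr.eval]
  · simp [hm0, Prog.run, Memory.set, Expr.eval]
  · intro k m' _ h
    have f13 : m' 13 = m 13 := h.frame 13 (by decide) (by decide) (by decide)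
    have f12 : m' 12 = m 12 := h.frame 12 (by decide) (by decide) (by decide)
    have he : (Expr.cell 13 (sc 20) (.const 0)).eval (m'.set 20 0 0 k) = m 13 k 0 := by
      simp [Expr.eval, sc_eval, Memory.set, f13]
    rw [Prog.run_ite, he]
    split_ifs with hk
    · rw [Prog.run]
      refine ⟨fun x h20 h26 h27 => ?_, ?_, ?_⟩
      · rw [Memory.set_of_ne h20.symm, h.frame x h20 h26 h27]
      · rw [Memory.set_of_ne (by decide), h.count, Nat.count_succ, if_neg hk, add_zero]
      · rw [Memory.set_of_ne (by decide), h.phase, Nat.forall_lt_succ_right]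
        simp [hk]
    · rw [not_not] at hk
      set m1 := Prog.run _ _ with hm1
      have e26 : m1 26 0 0 = m' 26 0 0 + 1 := by
        simp [hm1, Prog.run, Memory.set, Expr.eval, sc_eval]
      have e27 : m1 27 0 0 = m' 27 0 0 + m 12 k 0 := by
        simp [hm1, Prog.run, Memory.set, Expr.eval, sc_eval, f12]
      refine ⟨fun x h20 h26 h27 => ?_, ?_, ?_⟩
      · rw [hm1, Prog.run_of_not_writes _ (by simp [Prog.Writes]; omega),
          Memory.set_of_ne h20.symm, h.frame x h20 h26 h27]
      · rw [e26, h.count, Nat.count_succ, if_pos hk]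
      · rw [e27, Nat.add_eq_zero_iff, h.phase, Nat.forall_lt_succ_right]
        simp [hk]

theorem card_filter_fin (p : ℕ → Prop) [DecidablePred p] (N : ℕ) :
    (Finset.univ.filter fun i : Fin N => p i).card = Nat.count p N := by
  rw [Nat.count_eq_card_filter_range, ← Finset.card_map Fin.valEmbedding]
  congr 1
  ext r
  simp only [Finset.mem_map, Finset.mem_filter, Finset.mem_univ, true_and, Fin.valEmbedding_apply,
    Finset.mem_range]
  exact ⟨fun ⟨i, hi, h⟩ => h ▸ ⟨i.2, hi⟩, fun ⟨h, hp⟩ => ⟨⟨r, h⟩, hp, rfl⟩⟩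

theorem exists_count_eq (p : ℕ → Prop) [DecidablePred p] {N j : ℕ} (hj : j < Nat.count p N) :
    ∃ r < N, p r ∧ Nat.count p r = j := by
  induction N with
  | zero => simp at hj
  | succ N ih =>
    rw [Nat.count_succ] at hj
    by_cases h : j < Nat.count p N
    · obtain ⟨r, hr, h'⟩ := ih h
      exact ⟨r, by omega, h'⟩
    · split_ifs at hj with hp
      · exact ⟨N, by omega, hp, by omega⟩
      · omega

end count

/-! ### Writing the output -/

section output

/-- The contribution of a column to the phase of the output row. -/
def outTerm : Expr :=
  -- Truncation makes a flagged column contribute 0, as the conjunction is at most 1.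
  .sub (andE (.cell 10 (sc 20) (sc 22)) (.cell 11 (sc 20) (sc 22))) (.cell 14 (sc 22) (.const 0))

/-- Copy the row `20[0, 0]` of the working tableau to the row `25[0, 0]` of the output. -/
def copyOut (b : ℕ) : Prog :=
  .seq (.assign 24 (.const 0) (.const 0) (.cell 12 (sc 20) (.const 0)))
    (.seq
      (.loop 22 (size b)
        (.seq (.assign 24 (.const 0) (.const 0)
            -- Adding three times is subtracting once modulo 4: the factors `i` of the `Y`s are
            -- removed to leave the sign.
            (modE (.add (sc 24) (.add outTerm (.add outTerm outTerm)))))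
          (.seq (.assign 0 (sc 25) (sc 22) (.cell 10 (sc 20) (sc 22)))
            (.assign 1 (sc 25) (sc 22) (.cell 11 (sc 20) (sc 22))))))
      -- `1 - (1 - e)` turns any nonzero exponent into the bit 1.
      (.seq (.assign 2 (sc 25) (.const 0) (.sub (.const 1) (.sub (.const 1) (sc 24))))
        (.assign 25 (.const 0) (.const 0) (.add (sc 25) (.const 1)))))

/-- The phase of a row of the working tableau relative to the Hermitian Pauli operator on the first
`k` columns without a flag. -/
def outPhase (m : Memory) (r k : ℕ) : ZMod 4 :=
  m 12 r 0 + 3 * ∑ j ∈ Finset.range k,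
    if m 14 j 0 = 0 then lift4 (m 10 r j) * lift4 (m 11 r j) else 0

/-- The first `k` columns of the row `r` have been copied to the row `q`. -/
structure CopyOutInv (m : Memory) (r q k : ℕ) (m' : Memory) : Prop where
  frame : ∀ x, x ≠ 0 → x ≠ 1 → x ≠ 22 → x ≠ 24 → m' x = m x
  other : ∀ i j, i ≠ q → m' 0 i j = m 0 i j ∧ m' 1 i j = m 1 i j
  done : ∀ j, j < k → m' 0 q j = m 10 r j ∧ m' 1 q j = m 11 r j
  phase : (m' 24 0 0 : ZMod 4) = outPhase m r k
  small : m' 24 0 0 < 4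

theorem copyOut_spec {b : ℕ} {m : Memory} {r q : ℕ} (hm : Reduced m) (hr : m 20 0 0 = r)
    (hq : m 25 0 0 = q) :
    (∀ x, x ≠ 0 → x ≠ 1 → x ≠ 2 → x ≠ 22 → x ≠ 24 → x ≠ 25 → (copyOut b).run m x = m x) ∧
    (∀ i j, i ≠ q → (copyOut b).run m 0 i j = m 0 i j ∧ (copyOut b).run m 1 i j = m 1 i j ∧
      (copyOut b).run m 2 i j = m 2 i j) ∧
    (∀ j, j < m 4 0 0 + b → (copyOut b).run m 0 q j = m 10 r j ∧
      (copyOut b).run m 1 q j = m 11 r j) ∧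
    (copyOut b).run m 2 q 0 = (if outPhase m r (m 4 0 0 + b) = 0 then 0 else 1) ∧
    (copyOut b).run m 25 0 0 = q + 1 := by
  rw [copyOut, Prog.run_seq, Prog.run_seq, Prog.run_loop, size_eval]
  set m0 := Prog.run _ m with hm0
  have f0 : ∀ x, x ≠ 24 → m0 x = m x := fun x hx => Memory.set_of_ne hx.symm
  have e0 : m0 24 0 0 = m 12 r 0 := by
    simp [hm0, Prog.run, Memory.set, Expr.eval, sc_eval, hr]
  rw [f0 4 (by decide)]
  set body := Prog.seq (.assign 24 (.const 0) (.const 0)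
            (modE (.add (sc 24) (.add outTerm (.add outTerm outTerm)))))
          (.seq (.assign 0 (sc 25) (sc 22) (.cell 10 (sc 20) (sc 22)))
            (.assign 1 (sc 25) (sc 22) (.cell 11 (sc 20) (sc 22)))) with hbody
  have key : CopyOutInv m r q (m 4 0 0 + b)
      (iter (fun k m' => body.run (m'.set 22 0 0 k)) (m 4 0 0 + b) m0) := by
    refine iter_induction (p := CopyOutInv m r q) _ ⟨fun x _ _ _ h24 => f0 x h24,
      fun i j _ => ⟨by rw [f0 0 (by decide)], by rw [f0 1 (by decide)]⟩, fun j hj => by omega,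
      by simp [e0, outPhase], by rw [e0]; exact (hm r 0).2.2⟩ ?_
    intro k m' hk h
    have fr : ∀ x, x ≠ 0 → x ≠ 1 → x ≠ 22 → x ≠ 24 → m' x = m x := h.frame
    have f10 : m' 10 = m 10 := fr 10 (by decide) (by decide) (by decide) (by decide)
    have f11 : m' 11 = m 11 := fr 11 (by decide) (by decide) (by decide) (by decide)
    have f14 : m' 14 = m 14 := fr 14 (by decide) (by decide) (by decide) (by decide)
    have f20 : m' 20 0 0 = r := by
      rw [fr 20 (by decide) (by decide) (by decide) (by decide), hr]
    have f25 : m' 25 0 0 = q := by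
      rw [fr 25 (by decide) (by decide) (by decide) (by decide), hq]
    set m1 := body.run (m'.set 22 0 0 k) with hm1
    set t := band (m 10 r k) (m 11 r k) - m 14 k 0 with ht
    have e24 : m1 24 0 0 = mod4 (m' 24 0 0 + (t + (t + t))) := by
      simp [hm1, hbody, Prog.run, Memory.set, Expr.eval, sc_eval, modE_eval, andE_eval, outTerm,
        f10, f11, f14, f20, ht]
    have g0 : ∀ i j, m1 0 i j = if i = q ∧ j = k then m 10 r k else m' 0 i j := by
      intro i j
      simp [hm1, hbody, Prog.run, Memory.set, Expr.eval, sc_eval, f10, f20, f25]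
    have g1 : ∀ i j, m1 1 i j = if i = q ∧ j = k then m 11 r k else m' 1 i j := by
      intro i j
      simp [hm1, hbody, Prog.run, Memory.set, Expr.eval, sc_eval, f11, f20, f25]
    have b1 := (hm r k).1
    have b2 := (hm r k).2.1
    have hband := band_lt b1 b2
    have hsm := h.small
    have hlt : m' 24 0 0 + (t + (t + t)) < 8 := by omega
    have ht' : (t : ZMod 4) =
        if m 14 k 0 = 0 then lift4 (m 10 r k) * lift4 (m 11 r k) else 0 := by
      split_ifs with hf
      · rw [ht, hf, Nat.sub_zero, band_cast b1 b2]
      · rw [ht, show band (m 10 r k) (m 11 r k) - m 14 k 0 = 0 by omega, Nat.cast_zero]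
    refine ⟨fun x h0 h1 h22 h24 => ?_, fun i j hi => ?_, fun j hj => ?_, ?_, ?_⟩
    · rw [hm1, Prog.run_of_not_writes _ (by simp [hbody, Prog.Writes]; omega),
        Memory.set_of_ne h22.symm, h.frame x h0 h1 h22 h24]
    · rw [g0, g1, if_neg (by simp [hi]), if_neg (by simp [hi])]
      exact h.other i j hi
    · rw [g0, g1]
      rcases eq_or_ne j k with rfl | hjk
      · rw [if_pos ⟨rfl, rfl⟩, if_pos ⟨rfl, rfl⟩]
        exact ⟨rfl, rfl⟩
      · rw [if_neg (by simp [hjk]), if_neg (by simp [hjk])]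
        exact h.done j (by omega)
    · rw [e24, mod4_cast hlt]
      push_cast
      rw [h.phase, outPhase, outPhase, Finset.sum_range_succ, ht']
      ring
    · rw [e24]
      exact mod4_lt hlt
  set m1 := iter _ _ m0
  have f25 : m1 25 0 0 = q := by
    rw [key.frame 25 (by decide) (by decide) (by decide) (by decide), hq]
  set m2 := Prog.run _ m1 with hm2
  have fx : ∀ x, x ≠ 2 → x ≠ 25 → m2 x = m1 x := fun x h2 h25 => by
    rw [hm2, Prog.run_of_not_writes _ (by simp [Prog.Writes]; omega)]
  have e2 : ∀ i j, m2 2 i j = if i = q ∧ j = 0 then 1 - (1 - m1 24 0 0) else m1 2 i j := by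
    intro i j
    simp [hm2, Prog.run, Memory.set, Expr.eval, sc_eval, f25]
  have f2 : m1 2 = m 2 := key.frame 2 (by decide) (by decide) (by decide) (by decide)
  refine ⟨fun x h0 h1 h2 h22 h24 h25 => ?_, fun i j hi => ?_, fun j hj => ?_, ?_, ?_⟩
  · rw [fx x h2 h25, key.frame x h0 h1 h22 h24]
  · rw [fx 0 (by decide) (by decide), fx 1 (by decide) (by decide), e2, if_neg (by simp [hi]), f2]
    exact ⟨(key.other i j hi).1, (key.other i j hi).2, rfl⟩
  · rw [fx 0 (by decide) (by decide), fx 1 (by decide) (by decide)]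
    exact key.done j hj
  · rw [e2, if_pos ⟨rfl, rfl⟩, ← key.phase]
    have := key.small
    generalize m1 24 0 0 = t at this
    interval_cases t <;> decide
  · simp [hm2, Prog.run, Memory.set, Expr.eval, sc_eval, f25]

/-- Write the rows with mark at least `2` to the output, and `idx` to `7[0, 0]`. -/
def finish (a b idx : ℕ) : Prog :=
  -- The program never reads this cell; it makes the value of an outcome a function of the memory.
  .seq (.assign 7 (.const 0) (.const 0) (.const idx))
    (.seq (.assign 25 (.const 0) (.const 0) (.const 0))
      (.loop 20 (size (b + a))
        (.ite (.sub (.cell 13 (sc 20) (.const 0)) (.const 1)) (copyOut b) .skip)))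

/-- The first `k` rows have been treated. -/
structure FinishInv (m : Memory) (idx b k : ℕ) (m' : Memory) : Prop where
  frame : ∀ x, x ≠ 0 → x ≠ 1 → x ≠ 2 → x ≠ 7 → x ≠ 20 → x ≠ 22 → x ≠ 24 → x ≠ 25 → m' x = m x
  index : m' 7 0 0 = idx
  count : m' 25 0 0 = Nat.count (fun r => 2 ≤ m 13 r 0) k
  rows : ∀ r < k, 2 ≤ m 13 r 0 →
    (∀ j < m 4 0 0 + b, m' 0 (Nat.count (fun r => 2 ≤ m 13 r 0) r) j = m 10 r j ∧
      m' 1 (Nat.count (fun r => 2 ≤ m 13 r 0) r) j = m 11 r j) ∧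
    m' 2 (Nat.count (fun r => 2 ≤ m 13 r 0) r) 0 =
      if outPhase m r (m 4 0 0 + b) = 0 then 0 else 1

theorem finish_spec {a b idx : ℕ} {m : Memory} (hm : Reduced m) :
    FinishInv m idx b (m 4 0 0 + (b + a)) ((finish a b idx).run m) := by
  rw [finish, Prog.run_seq, Prog.run_seq, Prog.run_loop, size_eval]
  set m0 := Prog.run _ (Prog.run _ m) with hm0
  have f0 : ∀ x, x ≠ 7 → x ≠ 25 → m0 x = m x := fun x h7 h25 => by
    rw [hm0, Prog.run_of_not_writes _ (by simp [Prog.Writes]; omega),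
      Prog.run_of_not_writes _ (by simp [Prog.Writes]; omega)]
  rw [f0 4 (by decide) (by decide)]
  refine iter_induction (p := FinishInv m idx b) _
    ⟨fun x _ _ _ h7 _ _ _ h25 => f0 x h7 h25, ?_, ?_, fun r hr => by omega⟩ ?_
  · simp [hm0, Prog.run, Memory.set, Expr.eval]
  · simp [hm0, Prog.run, Memory.set, Expr.eval]
  · intro k m' _ h
    set m1 := m'.set 20 0 0 k with hm1
    have f1 : ∀ x, x ≠ 20 → m1 x = m' x := fun x hx => Memory.set_of_ne hx.symm
    have e20 : m1 20 0 0 = k := by simp [hm1, Memory.set]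
    have fr : ∀ x, x ≠ 0 → x ≠ 1 → x ≠ 2 → x ≠ 7 → x ≠ 20 → x ≠ 22 → x ≠ 24 → x ≠ 25 →
        m1 x = m x := fun x h0 h1 h2 h7 h20 h22 h24 h25 => by
      rw [f1 x h20, h.frame x h0 h1 h2 h7 h20 h22 h24 h25]
    have f10 : m1 10 = m 10 := by apply fr <;> decide
    have f11 : m1 11 = m 11 := by apply fr <;> decide
    have f12 : m1 12 = m 12 := by apply fr <;> decide
    have f13 : m1 13 = m 13 := by apply fr <;> decide
    have f14 : m1 14 = m 14 := by apply fr <;> decide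
    have f4 : m1 4 = m 4 := by apply fr <;> decide
    have he : (Expr.sub (.cell 13 (sc 20) (.const 0)) (.const 1)).eval m1 = m 13 k 0 - 1 := by
      simp [Expr.eval, sc_eval, e20, f13]
    have hred : Reduced m1 := by
      intro i j
      rw [f10, f11, f12]
      exact hm i j
    rw [Prog.run_ite, he]
    split_ifs with hk
    · have hk2 : 2 ≤ m 13 k 0 := by omega
      have h25 : m1 25 0 0 = Nat.count (fun r => 2 ≤ m 13 r 0) k := by
        rw [f1 25 (by decide), h.count]
      obtain ⟨g1, g2, g3, g4, g5⟩ := copyOut_spec (b := b) hred e20 h25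
      have hph : ∀ N, outPhase m1 k N = outPhase m k N := by
        intro N
        simp only [outPhase, f10, f11, f12, f14]
      rw [f4] at g3 g4
      rw [f10, f11] at g3
      rw [hph] at g4
      refine ⟨fun x h0 h1 h2 h7 h20 h22 h24 h25 => ?_, ?_, ?_, fun r hr hr2 => ?_⟩
      · rw [g1 x h0 h1 h2 h22 h24 h25, fr x h0 h1 h2 h7 h20 h22 h24 h25]
      · rw [g1 7 (by decide) (by decide) (by decide) (by decide) (by decide) (by decide),
          f1 7 (by decide), h.index]
      · rw [g5, Nat.count_succ, if_pos hk2]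
      · rcases eq_or_ne r k with rfl | hrk
        · exact ⟨g3, g4⟩
        · have hne : Nat.count (fun r => 2 ≤ m 13 r 0) r ≠ Nat.count (fun r => 2 ≤ m 13 r 0) k :=
            (Nat.count_strict_mono (p := fun r => 2 ≤ m 13 r 0) hr2 (by omega)).ne
          have := h.rows r (by omega) hr2
          refine ⟨fun j hj => ?_, ?_⟩
          · rw [(g2 _ j hne).1, (g2 _ j hne).2.1, f1 0 (by decide), f1 1 (by decide)]
            exact this.1 j hj
          · rw [(g2 _ 0 hne).2.2, f1 2 (by decide)]
            exact this.2
    · rw [Prog.run]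
      refine ⟨fr, ?_, ?_, fun r hr hr2 => ?_⟩
      · rw [f1 7 (by decide), h.index]
      · rw [f1 25 (by decide), h.count, Nat.count_succ, if_neg (by omega), add_zero]
      · rw [f1 0 (by decide), f1 1 (by decide), f1 2 (by decide)]
        have : r ≠ k := by rintro rfl; omega
        exact h.rows r (by omega) hr2

end output

/-! ### The output tableau describes the contracted state -/

section final

variable {n a b : ℕ} {s : Fin a ↪ Fin n} {m : Memory}
  {ψ : (Joint (Fin b ⊕ Rest s) (Fin a) → Fin 2) → ℂ}

/-- The unflagged columns below `n + b` are exactly those of the output qubits, so the sum over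
columns counts their `Y` factors. -/
theorem outPhase_eq (hm : Register s m) (r : ℕ) :
    outPhase m r (n + b) = (view (jointCol b s) m).e r -
      yCount (outPart ((view (jointCol b s) m).v r)) := by
  have h1 : ∑ j ∈ Finset.range (n + b),
      (if m 14 j 0 = 0 then lift4 (m 10 r j) * lift4 (m 11 r j) else 0) =
        yCount (outPart ((view (jointCol b s) m).v r)) := by
    have himg : (Finset.range (n + b)).filter (fun j => m 14 j 0 = 0) =
        Finset.univ.image (outputLabel s : Fin b ⊕ Rest s → ℕ) := by
      ext j
      simp only [Finset.mem_filter, Finset.mem_range, Finset.mem_image, Finset.mem_univ, true_and]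
      constructor
      · rintro ⟨h1, h2⟩
        exact exists_outputLabel h1 fun h => (hm.flag j).mpr h h2
      · rintro ⟨o, rfl⟩
        refine ⟨outputLabel_lt s o, ?_⟩
        by_contra h
        obtain ⟨j, hj⟩ := (hm.flag _).mp h
        exact outputLabel_ne s o j hj
    rw [← Finset.sum_filter, himg, Finset.sum_image fun x _ y _ h => outputLabel_injective s h]
    rfl
  rw [outPhase, h1, sub_eq_add_neg]
  have : ∀ y : ZMod 4, 3 * y = -y := by decide
  rw [this]
  rfl

/-- The output after elimination describes the contracted state. -/
theorem finish_output {L : Set (V2 (Joint (Fin b ⊕ Rest s) (Fin a)) →ₗ[ZMod 2] ZMod 2)}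
    {m0 : Memory} (hm0 : OutInv m0 s ψ L m)
    (hL : L = outFunctionals b s (n + b) ∪ pairFunctionals _ a a) (hm : Register s m)
    (hψ : star ψ ⬝ᵥ ψ = 1) (hpos : ∀ r < n + (b + a), m 13 r 0 = 0 → m 12 r 0 = 0) (idx : ℕ) :
    ∃ (T : Tableau (b + (n - a)) (Fin b ⊕ Rest s)) (φ : (Fin b ⊕ Rest s → Fin 2) → ℂ),
      ((finish a b idx).run m).Holds (outputLabel s) T ∧ T.Describes φ ∧
      ((2 : ℂ) ^ Nat.count (fun r => m 13 r 0 = 0) (n + (b + a))) • proj φ =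
        (2 : ℂ) ^ a • proj (contr ψ) := by
  subst hL
  have hfin := finish_spec (a := a) (b := b) (idx := idx) hm0.reduced
  rw [hm.size] at hfin
  set m' := (finish a b idx).run m
  have hE := hm0.echelon
  have hcard : Fintype.card (Fin (n + (b + a))) =
      Fintype.card (Joint (Fin b ⊕ Rest s) (Fin a)) := by
    rw [(jointCol_columns s).card, Fintype.card_fin]
  have hfix : ∀ i : Fin (n + (b + a)), Fixes ((view (jointCol b s) m).e i)
      ((view (jointCol b s) m).v i) ψ := fun i => hm0.generates.fixes i i.2
  have hpos' : ∀ i : Fin (n + (b + a)), m 13 i 0 = 0 → (view (jointCol b s) m).e i = 0 := by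
    intro i hi
    simp [view, hpos i i.2 hi]
  obtain ⟨-, hcount⟩ := contr_norm hE hψ hfix hm0.generates.independent hcard hpos'
  have hO : b + (n - a) = Fintype.card (Fin b ⊕ Rest s) := by
    have := card_rest s
    simp only [Fintype.card_sum, Fintype.card_fin]
    omega
  -- The count in `contr_norm` leaves, after removal of the rows with mark 0, exactly as many rows
  -- as there are output qubits.
  have hcount2 : Nat.count (fun r => 2 ≤ m 13 r 0) (n + (b + a)) = b + (n - a) := by
    rw [← card_filter_fin, hO]
    have : (Finset.univ.filter fun i : Fin (n + (b + a)) => m 13 i 0 ≠ 1).card =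
        (Finset.univ.filter fun i : Fin (n + (b + a)) => m 13 i 0 = 0).card +
        (Finset.univ.filter fun i : Fin (n + (b + a)) => 2 ≤ m 13 i 0).card := by
      rw [← Finset.card_union_of_disjoint]
      · congr 1
        ext i
        simp
        omega
      · rw [Finset.disjoint_filter]
        intro i _ h1
        omega
    omega
  have hex : ∀ j : Fin (b + (n - a)), ∃ r : Fin (n + (b + a)), 2 ≤ m 13 r 0 ∧
      Nat.count (fun r => 2 ≤ m 13 r 0) r = j := by
    intro j
    obtain ⟨r, hr, h⟩ := exists_count_eq (fun r => 2 ≤ m 13 r 0) (N := n + (b + a)) (j := j)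
      (by rw [hcount2]; exact j.2)
    exact ⟨⟨r, hr⟩, h⟩
  choose r hr2 hrc using hex
  have hrow : ∀ j : Fin (b + (n - a)), (∀ o : Fin b ⊕ Rest s, m' 0 j (outputLabel s o) = m 10 (r j) (outputLabel s o) ∧
      m' 1 j (outputLabel s o) = m 11 (r j) (outputLabel s o)) ∧
      m' 2 j 0 = if outPhase m (r j) (n + b) = 0 then 0 else 1 := by
    intro j
    have := hfin.rows (r j) (r j).2 (hr2 j)
    rw [hrc j, hm.size] at this
    exact ⟨fun o => this.1 _ (outputLabel_lt s o), this.2⟩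
  let T : Tableau (b + (n - a)) (Fin b ⊕ Rest s) :=
    ⟨fun j o => (m' 0 j (outputLabel s o) : ZMod 2), fun j o => (m' 1 j (outputLabel s o) : ZMod 2),
      fun j => (m' 2 j 0 : ZMod 2)⟩
  obtain ⟨φ, hφ, hproj⟩ := contr_describes hE hψ hfix hm0.generates.independent hcard hpos' hO T r
    (fun i j hij => Fin.ext (by rw [← hrc i, ← hrc j, hij]))
    (fun j => by have := hr2 j; omega)
    (fun j => by
      ext o
      · exact congrArg Nat.cast ((hrow j).1 o).1
      · exact congrArg Nat.cast ((hrow j).1 o).2)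
    (fun j => by
      rw [← outPhase_eq hm]
      change ((m' 2 j 0 : ℕ) : ZMod 2) = _
      rw [(hrow j).2]
      split_ifs <;> simp)
  refine ⟨T, φ, ⟨fun j o => ?_, fun j o => ?_, fun j => ?_⟩, hφ, ?_⟩
  · change m' 0 j (outputLabel s o) = ((m' 0 j (outputLabel s o) : ℕ) : ZMod 2).val
    rw [ZMod.val_natCast, Nat.mod_eq_of_lt]
    rw [((hrow j).1 o).1]
    exact (hm0.reduced _ _).1
  · change m' 1 j (outputLabel s o) = ((m' 1 j (outputLabel s o) : ℕ) : ZMod 2).val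
    rw [ZMod.val_natCast, Nat.mod_eq_of_lt]
    rw [((hrow j).1 o).2]
    exact (hm0.reduced _ _).2.1
  · change m' 2 j 0 = ((m' 2 j 0 : ℕ) : ZMod 2).val
    rw [ZMod.val_natCast, Nat.mod_eq_of_lt]
    rw [(hrow j).2]
    split_ifs <;> omega
  · rw [← card_filter_fin, hproj, Fintype.card_fin]

end final

/-! ### The simulation program -/

theorem Prog.tame_loop {x k : ℕ} {p : Prog} :
    (Prog.loop x (size k) p).Tame ↔ x ≠ 4 ∧ p.Tame :=
  ⟨fun h => ⟨h.1, h.2.2⟩, fun h => ⟨h.1, ⟨k, rfl⟩, h.2⟩⟩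

section simulation

variable {n a b : ℕ}

/-- Load a component of the Choi state together with the input and eliminate. -/
def prep (C : Tableau (b + a) (Fin b ⊕ Fin a)) : Prog :=
  .seq (load C) (.seq (elimPairs a b) (.seq (elimOut a b) (countRows (b + a))))

/-- Run `f v` for the value `v` of `26[0, 0]`, or `f K` if `v` exceeds `K`. -/
def branch (f : ℕ → Prog) : ℕ → Prog
  | 0 => f 0
  -- Coin biases are constants of the program, so a bias that depends on a computed number needs
  -- this case distinction.
  | K + 1 => .ite (.sub (sc 26) (.const K)) (f (K + 1)) (branch f K)

/-- Sample from the first `k` components of the Choi state, where `R` bounds the total weight. -/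
def tree (C : ℕ → Tableau (b + a) (Fin b ⊕ Fin a)) (lam : ℕ → ℝ≥0) : ℕ → ℝ≥0 → Prog
  | 0, _ => .assign 5 (.const 0) (.const 0) (.const 1)
  -- A nonzero `27[0, 0]` means that the component contracts to zero; it is skipped and uses up no
  -- weight.
  | k + 1, R => .seq (prep (C k)) (.ite (sc 27) (tree C lam k R)
      -- The bias is the weight of the component relative to the available weight `R`, which shrinks
      -- accordingly on rejection. The minimum only ensures a legal bias in cases that never occur;
      -- exponents above `⌈(lam k)⁻¹⌉₊` would need a weight above 1 if `lam k ≠ 0`.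
      (branch (fun v => .flip (min 1 (lam k * 2 ^ v / R)) (min_le_left _ _) (finish a b k)
        (tree C lam k (R - lam k * 2 ^ v))) ⌈(lam k)⁻¹⌉₊))

/-- Set the flags of the selected qubits. -/
def setFlags (a : ℕ) : Prog :=
  seqRange a fun j => .assign 14 (.cell 3 (.const j) (.const 0)) (.const 0) (.const 1)

theorem setFlags_tame (a : ℕ) : (setFlags a).Tame :=
  seqRange_tame fun _ => show (14 : ℕ) ≠ 4 by decide

theorem pass_flipFree (l mk : ℕ) (test : Expr) : (pass l test mk).FlipFree := by
  simp [pass, rowMul, Prog.FlipFree]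

theorem pass_tame (l mk : ℕ) (test : Expr) : (pass l test mk).Tame := by
  simp [pass, rowMul, Prog.Tame]

theorem load_flipFree (C : Tableau (b + a) (Fin b ⊕ Fin a)) : (load C).FlipFree := by
  refine ⟨?_, seqRange_flipFree fun i => ⟨trivial, seqRange_flipFree fun j => ?_⟩⟩
  · simp [copyInput, copyRow, Prog.FlipFree]
  · simp [Prog.FlipFree]

theorem load_tame (C : Tableau (b + a) (Fin b ⊕ Fin a)) : (load C).Tame := by
  refine ⟨?_, seqRange_tame fun i => ⟨show (12 : ℕ) ≠ 4 by decide, seqRange_tame fun j => ?_⟩⟩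
  · simp [copyInput, copyRow, Prog.Tame, Prog.tame_loop]
  · simp [Prog.Tame]

theorem prep_flipFree (C : Tableau (b + a) (Fin b ⊕ Fin a)) : (prep C).FlipFree := by
  refine ⟨load_flipFree C, seqRange_flipFree fun j => ?_, ?_, ?_⟩
  · exact ⟨pass_flipFree _ _ _, pass_flipFree _ _ _⟩
  · simp [elimOut, Prog.FlipFree, pass_flipFree]
  · simp [countRows, Prog.FlipFree]

theorem prep_tame (C : Tableau (b + a) (Fin b ⊕ Fin a)) : (prep C).Tame := by
  refine ⟨load_tame C, seqRange_tame fun j => ?_, ?_, ?_⟩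
  · exact ⟨pass_tame _ _ _, pass_tame _ _ _⟩
  · simp [elimOut, Prog.Tame, Prog.tame_loop, pass_tame]
  · simp [countRows, Prog.Tame]

theorem finish_flipFree (a b idx : ℕ) : (finish a b idx).FlipFree := by
  simp [finish, copyOut, Prog.FlipFree]

theorem finish_tame (a b idx : ℕ) : (finish a b idx).Tame := by
  simp [finish, copyOut, Prog.Tame]

theorem branch_tame {f : ℕ → Prog} (h : ∀ v, (f v).Tame) (K : ℕ) : (branch f K).Tame := by
  induction K with
  | zero => exact h 0
  | succ K ih => exact ⟨h _, ih⟩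

theorem tree_tame (C : ℕ → Tableau (b + a) (Fin b ⊕ Fin a)) (lam : ℕ → ℝ≥0) (k : ℕ) (R : ℝ≥0) :
    (tree C lam k R).Tame := by
  induction k generalizing R with
  | zero => exact (show (5 : ℕ) ≠ 4 by decide)
  | succ k ih =>
    refine ⟨prep_tame _, ih R, branch_tame (fun v => ?_) _⟩
    exact ⟨finish_tame _ _ _, ih _⟩

theorem load_not_writes (C : Tableau (b + a) (Fin b ⊕ Fin a)) {x : ℕ} (hx : ¬ Scratch x) :
    ¬ (load C).Writes x := by
  simp only [Scratch, not_or] at hx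
  rintro (h | h)
  · simp [copyInput, copyRow, Prog.Writes] at h
    omega
  · refine seqRange_not_writes (fun i => ?_) h
    rintro (h | h)
    · exact hx.2.2.1 h.symm
    · refine seqRange_not_writes (fun j => ?_) h
      simp [Prog.Writes]
      omega

/-- The memory between the parts of the simulation. -/
structure Ready (T : Tableau n (Fin n)) (s : Fin a ↪ Fin n) (m : Memory) : Prop where
  kept : InputKept T s m
  reduced : Reduced m
  noAbort : m 5 0 0 = 0
  register : Register s m

section

variable {T : Tableau n (Fin n)} {s : Fin a ↪ Fin n} {m : Memory}

theorem setFlags_ready (T : Tableau n (Fin n)) (s : Fin a ↪ Fin n) :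
    Ready T s ((setFlags a).run (inputMemory T s)) := by
  have key : (∀ x, x ≠ 14 → (setFlags a).run (inputMemory T s) x = inputMemory T s x) ∧
      ∀ c, (setFlags a).run (inputMemory T s) 14 c 0 ≠ 0 ↔ ∃ j : Fin a, (j : ℕ) < a ∧ (s j : ℕ) = c := by
    rw [setFlags, seqRange_run]
    refine iter_induction (p := fun k m => (∀ x, x ≠ 14 → m x = inputMemory T s x) ∧
      ∀ c, m 14 c 0 ≠ 0 ↔ ∃ j : Fin a, (j : ℕ) < k ∧ (s j : ℕ) = c) a
      ⟨fun _ _ => rfl, fun c => by simp [inputMemory]⟩ ?_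
    rintro k m hk ⟨h1, h2⟩
    refine ⟨fun x hx => ?_, fun c => ?_⟩
    · rw [Prog.run_of_not_writes _ (by simpa [Prog.Writes] using hx.symm), h1 x hx]
    · have h3 : m 3 k 0 = s ⟨k, hk⟩ := by
        rw [h1 3 (by decide)]
        simp [inputMemory, hk]
      have : (Prog.assign 14 (.cell 3 (.const k) (.const 0)) (.const 0) (.const 1)).run m 14 c 0 =
          if c = s ⟨k, hk⟩ then 1 else m 14 c 0 := by
        simp [Prog.run, Memory.set, Expr.eval, h3]
      rw [this]
      split_ifs with hc
      · simp only [ne_eq, one_ne_zero, not_false_eq_true, true_iff]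
        exact ⟨⟨k, hk⟩, by simp, hc.symm⟩
      · rw [h2]
        refine exists_congr fun j => and_congr_left fun hj => ?_
        have : (j : ℕ) ≠ k := by
          rintro rfl
          exact hc hj.symm
        omega
  obtain ⟨h1, h2⟩ := key
  refine ⟨fun x hx => h1 x (by omega), fun i j => ?_, ?_, ?_, fun j => ?_, fun c => ?_⟩
  · rw [h1 10 (by decide), h1 11 (by decide), h1 12 (by decide)]
    simp [inputMemory]
  · rw [h1 5 (by decide)]
    simp [inputMemory]
  · rw [h1 4 (by decide)]
    simp [inputMemory]
  · rw [h1 3 (by decide)]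
    simp [inputMemory]
  · rw [h2]
    simp

/-- The contraction of a component of the Choi state with the input state. -/
def chi (s : Fin a ↪ Fin n) (φ : (Fin b ⊕ Fin a → Fin 2) → ℂ) (ψ : (Fin n → Fin 2) → ℂ) :
    (Fin b ⊕ Rest s → Fin 2) → ℂ :=
  contr (productState (jointEquiv b s) φ ψ)

/-- `27[0, 0]` tests whether some row with mark 0 acts as a nontrivial phase; if none does, `26[0,
0]` is the exponent in the norm. `Ready` is restored so that the next component can be tried. -/
theorem prep_spec {C : Tableau (b + a) (Fin b ⊕ Fin a)} {φ : (Fin b ⊕ Fin a → Fin 2) → ℂ}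
    {ψ : (Fin n → Fin 2) → ℂ} (hm : Ready T s m) (hT : T.Describes ψ) (hC : C.Describes φ) :
    Ready T s ((prep C).run m) ∧
    ((prep C).run m 27 0 0 ≠ 0 → chi s φ ψ = 0) ∧
    ((prep C).run m 27 0 0 = 0 →
      star (chi s φ ψ) ⬝ᵥ chi s φ ψ = 2 ^ ((prep C).run m 26 0 0) / 2 ^ a ∧
      ∀ idx, ∃ (T' : Tableau (b + (n - a)) (Fin b ⊕ Rest s)) (φ' : (Fin b ⊕ Rest s → Fin 2) → ℂ),
        ((finish a b idx).run ((prep C).run m)).Holds (outputLabel s) T' ∧ T'.Describes φ' ∧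
        ((2 : ℂ) ^ ((prep C).run m 26 0 0)) • proj φ' = (2 : ℂ) ^ a • proj (chi s φ ψ)) := by
  obtain ⟨h1, h2, h3⟩ := load_spec hm.kept hm.reduced hT hC
  rw [prep, Prog.run_seq, Prog.run_seq, Prog.run_seq]
  have hx1 : ∀ x, ¬ Scratch x → (load C).run m x = m x := fun x hx =>
    Prog.run_of_not_writes _ (load_not_writes C hx) _
  set m1 := (load C).run m
  have hr1 : Register s m1 := hm.register.congr (hx1 3 (by simp [Scratch]))
    (hx1 4 (by simp [Scratch])) (hx1 14 (by simp [Scratch]))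
  have h4 := elimPairs_spec hr1 h1 h2 h3
  have h5 := elimOut_spec hr1 h4
  set m3 := (elimOut a b).run _
  have h6 := countRows_spec (b + a) m3
  have f4 : m3 4 0 0 = n := by rw [h5.frame 4 (by simp [Scratch]) (by decide), hr1.size]
  rw [f4] at h6
  set m4 := (countRows (b + a)).run m3
  have hx4 : ∀ x, ¬ Scratch x → x ≠ 21 → x ≠ 26 → x ≠ 27 → m4 x = m x := by
    intro x hx h21 h26 h27
    have h20 : x ≠ 20 := by rintro rfl; simp [Scratch] at hx
    rw [h6.frame x h20 h26 h27, h5.frame x hx h21, hx1 x hx]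
  have hr4 : Register s m4 := hm.register.congr
    (hx4 3 (by simp [Scratch]) (by decide) (by decide) (by decide))
    (hx4 4 (by simp [Scratch]) (by decide) (by decide) (by decide))
    (hx4 14 (by simp [Scratch]) (by decide) (by decide) (by decide))
  have f10 : m4 10 = m3 10 := h6.frame 10 (by decide) (by decide) (by decide)
  have f11 : m4 11 = m3 11 := h6.frame 11 (by decide) (by decide) (by decide)
  have f12 : m4 12 = m3 12 := h6.frame 12 (by decide) (by decide) (by decide)
  have f13 : m4 13 = m3 13 := h6.frame 13 (by decide) (by decide) (by decide)
  have hv : view (jointCol b s) m4 = view (jointCol b s) m3 := view_congr f10 f11 f12 f13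
  have h7 : OutInv m4 s (productState (jointEquiv b s) φ ψ)
      (outFunctionals b s (n + b) ∪ pairFunctionals _ a a) m4 := by
    refine ⟨fun i j => ?_, fun _ _ _ => rfl, ?_, ?_, ?_⟩
    · rw [f10, f11, f12]
      exact h5.reduced i j
    · rw [hv]
      exact h5.generates
    · rw [hv, f13]
      exact h5.pairs
    · rw [hv, f13]
      exact h5.detects
  have hcount := h6.count
  have hphase := h6.phase
  rw [← f13] at hcount hphase
  rw [← f12] at hphase
  have hunit := productState_unit (jointEquiv b s) hC.unit hT.unit
  have hfix : ∀ i : Fin (n + (b + a)), Fixes ((view (jointCol b s) m4).e i)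
      ((view (jointCol b s) m4).v i) (productState (jointEquiv b s) φ ψ) :=
    fun i => h7.generates.fixes i i.2
  refine ⟨⟨fun x hx => ?_, h7.reduced, ?_, hr4⟩, fun h27 => ?_, fun h27 => ?_⟩
  · rw [hx4 x (by simp only [Scratch]; omega) (by omega) (by omega) (by omega), hm.kept x hx]
  · rw [hx4 5 (by simp [Scratch]) (by decide) (by decide) (by decide), hm.noAbort]
  · rw [ne_eq, hphase] at h27
    push Not at h27
    obtain ⟨r, hr, hr0, hre⟩ := h27
    refine contr_eq_zero h7.echelon hfix (i := ⟨r, hr⟩) hr0 fun h => hre ?_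
    have hlt := (h7.reduced r 0).2.2
    have h' : ((m4 12 r 0 : ℕ) : ZMod 4) = 0 := h
    rw [ZMod.natCast_eq_zero_iff] at h'
    exact Nat.eq_zero_of_dvd_of_lt h' hlt
  · have hpos := hphase.mp h27
    refine ⟨?_, fun idx => ?_⟩
    · have := (contr_norm h7.echelon hunit hfix h7.generates.independent
        (by rw [(jointCol_columns s).card, Fintype.card_fin])
        (fun i hi => by simp [view, hpos i i.2 hi])).1
      rw [chi, this, hcount, Fintype.card_fin, ← card_filter_fin]
    · rw [hcount]
      exact finish_output h7 rfl hr4 hunit hpos idx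

theorem branch_sampled {E : Type} [AddCommGroup E] [Module ℂ E] [TopologicalSpace E]
    [ContinuousAdd E] [ContinuousConstSMul ℂ E] {value : Memory → E} {ok : Memory → Prop}
    {f : ℕ → Prog} {ρ : E} (K : ℕ) (h : Sampled value ok ((f (min (m 26 0 0) K)).exec m) ρ) :
    Sampled value ok ((branch f K).exec m) ρ := by
  induction K with
  | zero => simpa [branch] using h
  | succ K ih =>
    refine Sampled.ite (fun he => ?_) fun he => ih ?_
    · simp only [Expr.eval, sc_eval] at he
      rwa [Nat.min_eq_right (by omega)] at h
    · simp only [Expr.eval, sc_eval] at he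
      rwa [Nat.min_eq_left (by omega), ← Nat.min_eq_left (show m 26 0 0 ≤ K by omega)] at h

/-- Since `v < 2 ^ v ≤ x⁻¹`. A crude bound is enough; what matters is that it does not depend on the
input. -/
theorem le_ceil_of_weight {x : ℝ≥0} {v : ℕ} (hx : x ≠ 0) (h : x * 2 ^ v ≤ 1) : v ≤ ⌈x⁻¹⌉₊ := by
  have h1 : (2 : ℝ≥0) ^ v ≤ x⁻¹ := by
    rw [← one_div, le_div_iff₀ (pos_iff_ne_zero.mpr hx), mul_comm]
    exact h
  have h2 : ((2 ^ v : ℕ) : ℝ≥0) ≤ (⌈x⁻¹⌉₊ : ℝ≥0) := by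
    push_cast
    exact h1.trans (Nat.le_ceil _)
  exact Nat.lt_two_pow_self.le.trans (by exact_mod_cast h2)

variable {C : ℕ → Tableau (b + a) (Fin b ⊕ Fin a)} {φ : ℕ → (Fin b ⊕ Fin a → Fin 2) → ℂ}
  {ψ : (Fin n → Fin 2) → ℂ} {lam w : ℕ → ℝ≥0}

/-- The value of an output: the component that is named in `7[0, 0]`. -/
def outValue (s : Fin a ↪ Fin n) (φ : ℕ → (Fin b ⊕ Fin a → Fin 2) → ℂ) (ψ : (Fin n → Fin 2) → ℂ)
    (w : ℕ → ℝ≥0) (m : Memory) : Op (Fin b ⊕ Rest s) :=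
  if m 5 0 0 ≠ 0 then 0
  else (w (m 7 0 0) : ℂ)⁻¹ • (2 : ℂ) ^ a • proj (chi s (φ (m 7 0 0)) ψ)

/-- With acceptance probability `β` one has `R β = x` and `R (1 - β) = R - x`, where `x` is the
weight of the component, so the means add up by induction. Stating `R • ρ` instead of dividing by
`R` covers `R = 0`, where no weight is left. -/
theorem tree_sampled (hT : T.Describes ψ) (hC : ∀ i, (C i).Describes (φ i))
    (hw : ∀ i, (w i : ℂ) = 2 ^ a * (star (chi s (φ i) ψ) ⬝ᵥ chi s (φ i) ψ)) (k : ℕ) (R : ℝ≥0)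
    (m : Memory) (hm : Ready T s m) (hR : ∑ i ∈ Finset.range k, lam i * w i ≤ R) (hR1 : R ≤ 1) :
    ∃ ρ, Sampled (outValue s φ ψ w) (fun m => m.IsOutput s (outValue s φ ψ w m))
        ((tree C lam k R).exec m) ρ ∧
      (R : ℂ) • ρ = ∑ i ∈ Finset.range k, (lam i : ℂ) • (2 : ℂ) ^ a • proj (chi s (φ i) ψ) := by
  induction k generalizing R m with
  | zero =>
    have h5 : (tree C lam 0 R).run m 5 0 0 ≠ 0 := by
      simp [tree, Prog.run, Memory.set, Expr.eval]
    have hv : outValue s φ ψ w ((tree C lam 0 R).run m) = 0 := by rw [outValue, if_pos h5]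
    refine ⟨outValue s φ ψ w ((tree C lam 0 R).run m), Sampled.of_flipFree (p := tree C lam 0 R) trivial
      (Or.inl ⟨h5, hv⟩), ?_⟩
    rw [hv]
    simp
  | succ k ih =>
    obtain ⟨h1, h2, h3⟩ := prep_spec hm hT (hC k)
    rw [Finset.sum_range_succ] at hR
    simp only [Finset.sum_range_succ]
    by_cases h27 : (prep (C k)).run m 27 0 0 = 0
    swap
    · obtain ⟨ρ, hρ, hsum⟩ := ih R _ h1 (le_trans le_self_add hR) hR1
      refine ⟨ρ, Sampled.seq (prep_flipFree _) (Sampled.ite (fun _ => hρ) fun h => absurd h h27), ?_⟩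
      have h0 : proj (chi s (φ k) ψ) = 0 := by
        rw [h2 h27]
        ext
        simp [proj, Matrix.vecMulVec_apply]
      rw [hsum, h0, smul_zero, smul_zero, add_zero]
    obtain ⟨hn, hout⟩ := h3 h27
    set m' := (prep (C k)).run m
    set v := m' 26 0 0 with hv
    have hwk : w k = 2 ^ v := by
      have := hw k
      rw [hn, mul_div_cancel₀ _ (by positivity)] at this
      exact_mod_cast this
    rw [hwk] at hR
    -- Clamping the exponent is harmless: either the coefficient is zero or the exponent is within
    -- the bound.
    have hmin : lam k * 2 ^ min v ⌈(lam k)⁻¹⌉₊ = lam k * 2 ^ v := by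
      by_cases h0 : lam k = 0
      · rw [h0, zero_mul, zero_mul]
      · rw [Nat.min_eq_left (le_ceil_of_weight h0 ((le_trans le_add_self hR).trans hR1))]
    set x := lam k * 2 ^ v with hx
    have hxR : x ≤ R := le_trans le_add_self hR
    have hR' : ∑ i ∈ Finset.range k, lam i * w i ≤ R - x := le_tsub_of_add_le_right hR
    obtain ⟨ρ, hρ, hsum⟩ := ih (R - x) m' h1 hR' (tsub_le_self.trans hR1)
    obtain ⟨T', φ', hH, hD, hP⟩ := hout k
    set mf := (finish a b k).run m' with hmf
    have hfs := finish_spec (a := a) (b := b) (idx := k) h1.reduced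
    rw [← hmf] at hfs
    have hf5 : mf 5 0 0 = 0 := by
      rw [hfs.frame 5 (by decide) (by decide) (by decide) (by decide) (by decide) (by decide)
        (by decide) (by decide), h1.noAbort]
    have hfv : outValue s φ ψ w mf = proj φ' := by
      rw [outValue, if_neg (by simp [hf5]), hfs.index, hwk, ← hP, smul_smul]
      push_cast
      rw [inv_mul_cancel₀ (by positivity), one_smul]
    have hfin : Sampled (outValue s φ ψ w) (fun m => m.IsOutput s (outValue s φ ψ w m))
        ((finish a b k).exec m') (proj φ') := by
      rw [← hfv]
      refine Sampled.of_flipFree (finish_flipFree a b k) (Or.inr ⟨hf5, T', φ', hH, hD, hfv⟩)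
    have hflip := Sampled.flip (min_le_left 1 (x / R)) hfin hρ
    refine ⟨_, Sampled.seq (ρ := ((min 1 (x / R) : ℝ≥0) : ℂ) • proj φ' +
      (1 - ((min 1 (x / R) : ℝ≥0) : ℂ)) • ρ) (prep_flipFree _) (Sampled.ite
        (fun h => absurd h27 h) fun _ => branch_sampled _ ?_), ?_⟩
    · have hmin' : lam k * 2 ^ min ((prep (C k)).run m 26 0 0) ⌈(lam k)⁻¹⌉₊ = x := hmin
      simp only [hmin']
      exact hflip
    · have hβ : R * min 1 (x / R) = x := by
        by_cases hR0 : R = 0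
        · rw [hR0, zero_mul]
          exact (le_antisymm (hxR.trans_eq hR0) bot_le).symm
        · rw [min_eq_right (div_le_one_of_le₀ hxR bot_le), mul_div_cancel₀ _ hR0]
      have hβ' : (R : ℂ) * (min 1 (x / R) : ℝ≥0) = (x : ℝ≥0) := by
        exact_mod_cast congrArg (fun y : ℝ≥0 => (y : ℂ)) hβ
      have hsub : (((R - x : ℝ≥0) : ℝ) : ℂ) = R - x := by
        rw [NNReal.coe_sub hxR]
        push_cast
        rfl
      rw [← hsum, ← hP, hsub, smul_add, smul_smul, smul_smul, mul_sub, mul_one, hβ', smul_smul,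
        add_comm]
      congr 2
      rw [hx]
      push_cast
      rfl

/-- The weights sum to the trace of `value`, which is at most 1, so sampling may start with `R = 1`.
-/
theorem simulation {d : ℕ} {value : Op (Fin b ⊕ Rest s)} (hT : T.Describes ψ)
    (hC : ∀ i, (C i).Describes (φ i))
    (hsum : ∑ i ∈ Finset.range d, (lam i : ℂ) • (2 : ℂ) ^ a • proj (chi s (φ i) ψ) = value)
    (htr : value.trace.re ≤ 1) :
    ∃ val : Memory → Op (Fin b ⊕ Rest s),
      Sampled val (fun m => m.IsOutput s (val m))
        ((Prog.seq (setFlags a) (tree C lam d 1)).exec (inputMemory T s)) value := by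
  have hnn : ∀ χ : (Fin b ⊕ Rest s → Fin 2) → ℂ, ∃ y : ℝ≥0, (y : ℂ) = 2 ^ a * (star χ ⬝ᵥ χ) := by
    intro χ
    refine ⟨2 ^ a * ∑ g, ‖χ g‖₊ ^ 2, ?_⟩
    push_cast
    congr 1
    refine Finset.sum_congr rfl fun g _ => ?_
    rw [Pi.star_apply, Complex.star_def, Complex.conj_mul']
  choose w hw using fun i => hnn (chi s (φ i) ψ)
  have hR : ∑ i ∈ Finset.range d, lam i * w i ≤ 1 := by
    have h1 : (((∑ i ∈ Finset.range d, lam i * w i : ℝ≥0) : ℝ) : ℂ) = value.trace := by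
      rw [← hsum, Matrix.trace_sum]
      push_cast
      refine Finset.sum_congr rfl fun i _ => ?_
      rw [Matrix.trace_smul, Matrix.trace_smul, hw, proj, Matrix.trace_vecMulVec, dotProduct_comm]
      rfl
    have h2 := congrArg Complex.re h1
    rw [Complex.ofReal_re] at h2
    rw [← h2] at htr
    exact_mod_cast htr
  obtain ⟨ρ, hρ, hρs⟩ := tree_sampled (C := C) (lam := lam) hT hC hw d 1 _ (setFlags_ready T s) hR
    le_rfl
  have hρ' : ρ = value := by
    rw [← hsum, ← hρs, NNReal.coe_one, Complex.ofReal_one, one_smul]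
  rw [hρ'] at hρ
  have hflip : (setFlags a).FlipFree := seqRange_flipFree fun j => trivial
  exact ⟨outValue s φ ψ w, hρ.seq hflip⟩

end

end simulation

/-! ### Channels and their Choi states -/

section channels

variable {A B : Type} [Fintype A] [DecidableEq A] [Fintype B] [DecidableEq B]
  {Λ : Op A →ₗ[ℂ] Op B}

theorem card_basis (A : Type) [Fintype A] [DecidableEq A] :
    Fintype.card (A → Fin 2) = 2 ^ Fintype.card A := by simp

theorem choi_apply (Λ : Op A →ₗ[ℂ] Op B) (g h : B ⊕ A → Fin 2) :
    choi Λ g h = ((2 : ℂ) ^ Fintype.card A)⁻¹ *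
      Λ (Matrix.single (g ∘ Sum.inr) (h ∘ Sum.inr) 1) (g ∘ Sum.inl) (h ∘ Sum.inl) := by
  have h1 : (Matrix.of fun u v : A → Fin 2 => proj (bell (A → Fin 2)) (u, g ∘ Sum.inr) (v, h ∘ Sum.inr)) =
      ((2 : ℂ) ^ Fintype.card A)⁻¹ • Matrix.single (g ∘ Sum.inr) (h ∘ Sum.inr) (1 : ℂ) := by
    ext u v
    have h2 : ((1 / Real.sqrt (Fintype.card (A → Fin 2)) : ℝ) : ℂ) *
        ((1 / Real.sqrt (Fintype.card (A → Fin 2)) : ℝ) : ℂ) = ((2 : ℂ) ^ Fintype.card A)⁻¹ := by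
      rw [← Complex.ofReal_mul, ← mul_div_mul_comm, Real.mul_self_sqrt (Nat.cast_nonneg _), card_basis]
      push_cast
      rw [one_mul, one_div]
    simp only [proj, Matrix.of_apply, Matrix.vecMulVec_apply, bell, Pi.star_apply, Matrix.smul_apply,
      Matrix.single_apply, smul_eq_mul, eq_comm (a := g ∘ Sum.inr), eq_comm (a := h ∘ Sum.inr)]
    by_cases hu : u = g ∘ Sum.inr <;> by_cases hv : v = h ∘ Sum.inr
    · simp only [hu, hv, if_true, and_self, mul_one, Complex.star_def, Complex.conj_ofReal]
      exact h2
    all_goals simp [hu, hv]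
  have h3 : choi Λ g h = Λ (Matrix.of fun u v : A → Fin 2 =>
      proj (bell (A → Fin 2)) (u, g ∘ Sum.inr) (v, h ∘ Sum.inr)) (g ∘ Sum.inl) (h ∘ Sum.inl) := rfl
  rw [h3, h1, map_smul, Matrix.smul_apply, smul_eq_mul]

/-- The Choi matrix lists the images of the matrix units; `2^|A|` undoes the normalization of the
Bell state. -/
theorem apply_eq_choi (Λ : Op A →ₗ[ℂ] Op B) (M : Op A) (g h : B → Fin 2) :
    Λ M g h = 2 ^ Fintype.card A *
      ∑ u, ∑ v, M u v * choi Λ (Sum.elim g u) (Sum.elim h v) := by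
  conv_lhs => rw [Matrix.matrix_eq_sum_single M]
  simp only [map_sum, Matrix.sum_apply, Finset.mul_sum]
  refine Finset.sum_congr rfl fun u _ => Finset.sum_congr rfl fun v _ => ?_
  rw [choi_apply]
  have : Matrix.single u v (M u v) = M u v • Matrix.single u v (1 : ℂ) := by
    rw [Matrix.smul_single, smul_eq_mul, mul_one]
  rw [this, map_smul, Matrix.smul_apply, smul_eq_mul]
  simp only [Sum.elim_comp_inl, Sum.elim_comp_inr]
  field_simp

theorem IsPostselective.posSemidef (hΛ : IsPostselective Λ) {ρ : Op A} (h : ρ.PosSemidef) :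
    (Λ ρ).PosSemidef :=
  (hΛ.completelyPositive 1 _ (h.submatrix Prod.fst)).submatrix fun g => (g, 0)

theorem proj_posSemidef {α : Type} [Fintype α] (ψ : α → ℂ) : (proj ψ).PosSemidef :=
  Matrix.posSemidef_vecMulVec_self_star ψ

theorem one_sub_proj_posSemidef {α : Type} [Fintype α] [DecidableEq α] {ψ : α → ℂ}
    (h : star ψ ⬝ᵥ ψ = 1) : (1 - proj ψ).PosSemidef := by
  have h1 : (proj ψ)ᴴ = proj ψ := (proj_posSemidef ψ).isHermitian
  have h2 : proj ψ * proj ψ = proj ψ := by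
    rw [proj, Matrix.vecMulVec_mul_vecMulVec, h, one_smul]
  have h3 : (1 - proj ψ)ᴴ * (1 - proj ψ) = 1 - proj ψ := by
    rw [Matrix.conjTranspose_sub, Matrix.conjTranspose_one, h1, sub_mul, mul_sub, mul_sub, h2]
    simp
  rw [← h3]
  exact Matrix.posSemidef_conjTranspose_mul_self _

theorem sum_sumArrow {P Q : Type} [Fintype P] [DecidableEq P] [Fintype Q] [DecidableEq Q]
    (F : (P ⊕ Q → Fin 2) → ℂ) : ∑ f, F f = ∑ g, ∑ h, F (Sum.elim g h) := by
  rw [← Fintype.sum_prod_type' fun g h => F (Sum.elim g h)]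
  exact (Equiv.sum_comp (Equiv.sumArrowEquivProdArrow P Q (Fin 2)).symm F).symm

theorem trace_choi (Λ : Op A →ₗ[ℂ] Op B) :
    (choi Λ).trace = ((2 : ℂ) ^ Fintype.card A)⁻¹ * (Λ 1).trace := by
  have h1 : (1 : Op A) = ∑ u, Matrix.single u u 1 := by
    ext i j
    simp only [Matrix.sum_apply, Matrix.single_apply, ite_and, Matrix.one_apply]
    simp
  rw [h1, map_sum, Matrix.trace_sum]
  simp only [Matrix.trace, Matrix.diag_apply]
  rw [sum_sumArrow, Finset.sum_comm, Finset.mul_sum]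
  refine Finset.sum_congr rfl fun u _ => ?_
  rw [Finset.mul_sum]
  refine Finset.sum_congr rfl fun g _ => ?_
  rw [choi_apply]
  simp only [Sum.elim_comp_inl, Sum.elim_comp_inr]

/-- The trace of the Choi state of a postselective channel is positive. -/
theorem IsPostselective.exists_trace_choi (hΛ : IsPostselective Λ) :
    ∃ t : ℝ, 0 < t ∧ (choi Λ).trace = t := by
  obtain ⟨ψ, hψ, hψ1⟩ := hΛ.satisfiable
  have h0 := (hΛ.posSemidef Matrix.PosSemidef.one).trace_nonneg
  -- Positivity of the image of `1 - |ψ⟩⟨ψ|` gives `tr Λ(1) ≥ tr Λ(|ψ⟩⟨ψ|) = 1`.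
  have h1 := (hΛ.posSemidef (one_sub_proj_posSemidef hψ)).trace_nonneg
  rw [map_sub, Matrix.trace_sub, hψ1, Complex.le_def] at h1
  rw [Complex.le_def] at h0
  refine ⟨((2 : ℝ) ^ Fintype.card A)⁻¹ * (Λ 1).trace.re, ?_, ?_⟩
  · have : 0 ≤ (Λ 1).trace.re - 1 := by simpa using h1.1
    have : 0 < (Λ 1).trace.re := by linarith
    positivity
  · rw [trace_choi]
    push_cast
    congr 1
    exact Complex.ext rfl (by simpa using h0.2.symm)

end channels

/-! ### A channel on part of a register -/

section apply

variable {n a b : ℕ} {Λ : Op (Fin a) →ₗ[ℂ] Op (Fin b)} (s : Fin a ↪ Fin n)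

/-- Basis states of the register from basis states of its two parts. -/
def joinBasis (u : Fin a → Fin 2) (κ : Rest s → Fin 2) : Fin n → Fin 2 := (splitBasis s).symm (u, κ)

theorem sum_joinBasis (F : (Fin n → Fin 2) → ℂ) : ∑ f, F f = ∑ u, ∑ κ, F (joinBasis s u κ) := by
  rw [← Fintype.sum_prod_type' fun u κ => F (joinBasis s u κ)]
  exact (Equiv.sum_comp (splitBasis s).symm F).symm

theorem joinBasis_apply (u : Fin a → Fin 2) (κ : Rest s → Fin 2) (q : Fin n) :
    joinBasis s u κ q = Sum.elim u κ ((partEquiv s).symm q) := rfl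

theorem applyAt_apply (Λ : Op (Fin a) →ₗ[ℂ] Op (Fin b)) (ρ : Op (Fin n)) (g h : Fin b ⊕ Rest s → Fin 2) :
    applyAt Λ s ρ g h = Λ (Matrix.of fun u v => ρ (joinBasis s u (g ∘ Sum.inr))
      (joinBasis s v (h ∘ Sum.inr))) (g ∘ Sum.inl) (h ∘ Sum.inl) := rfl

/-- Tracing out the untouched qubits splits `ψ` into unnormalized vectors on the selected qubits
whose squared norms sum to 1; each block is covered by `traceNonincreasing`. -/
theorem trace_applyAt_le (hΛ : IsPostselective Λ) {ψ : (Fin n → Fin 2) → ℂ}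
    (hψ : star ψ ⬝ᵥ ψ = 1) : (applyAt Λ s (proj ψ)).trace.re ≤ 1 := by
  have h1 : (applyAt Λ s (proj ψ)).trace =
      ∑ κ : Rest s → Fin 2, (Λ (proj fun u => ψ (joinBasis s u κ))).trace := by
    simp only [Matrix.trace, Matrix.diag_apply]
    rw [sum_sumArrow, Finset.sum_comm]
    rfl
  have h2 : ∑ κ : Rest s → Fin 2, (proj fun u => ψ (joinBasis s u κ)).trace = 1 := by
    rw [← hψ, dotProduct, sum_joinBasis s, Finset.sum_comm]
    refine Finset.sum_congr rfl fun κ _ => Finset.sum_congr rfl fun u _ => ?_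
    simp [proj, Matrix.vecMulVec_apply, mul_comm]
  rw [h1, Complex.re_sum, ← Complex.one_re, ← h2, Complex.re_sum]
  exact Finset.sum_le_sum fun κ _ => (hΛ.traceNonincreasing _ (proj_posSemidef _)).2

end apply

/-! ### From a decomposition of the Choi state to a simulation -/

section decomposition

variable {n a b : ℕ} {Λ : Op (Fin a) →ₗ[ℂ] Op (Fin b)}

theorem chi_eq (s : Fin a ↪ Fin n) (φ : (Fin b ⊕ Fin a → Fin 2) → ℂ) (ψ : (Fin n → Fin 2) → ℂ)
    (g : Fin b ⊕ Rest s → Fin 2) : chi s φ ψ g =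
      ∑ u, φ (Sum.elim (g ∘ Sum.inl) u) * ψ (joinBasis s u (g ∘ Sum.inr)) := by
  refine Finset.sum_congr rfl fun u _ => ?_
  rw [productState]
  congr 2
  · funext p
    rcases p with p | p <;> rfl
  · funext q
    rw [joinBasis_apply]
    simp only [jointEquiv, Equiv.coe_fn_mk, Sum.elim_inr]
    rcases (partEquiv s).symm q with p | p <;> rfl

/-- A rank-one term of the Choi state acts as a single Kraus operator, read off from `φ i`; applied
to `ψ` it gives `chi`, up to the Bell normalization. -/
theorem applyAt_eq_sum {d : ℕ} {c : ℕ → ℂ} {φ : ℕ → (Fin b ⊕ Fin a → Fin 2) → ℂ}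
    (h : choi Λ = ∑ i ∈ Finset.range d, c i • proj (φ i)) (s : Fin a ↪ Fin n)
    (ψ : (Fin n → Fin 2) → ℂ) :
    ∑ i ∈ Finset.range d, c i • (2 : ℂ) ^ a • proj (chi s (φ i) ψ) = applyAt Λ s (proj ψ) := by
  ext g k
  rw [applyAt_apply, apply_eq_choi, h, Fintype.card_fin]
  simp only [Matrix.sum_apply, Matrix.smul_apply, smul_eq_mul, proj, Matrix.vecMulVec_apply,
    Pi.star_apply, chi_eq, star_sum, star_mul', Matrix.of_apply, Finset.mul_sum, Finset.sum_mul]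
  conv_rhs => rw [Finset.sum_comm]
  rw [Finset.sum_comm]
  refine Finset.sum_congr rfl fun u _ => ?_
  rw [Finset.sum_comm]
  refine Finset.sum_congr rfl fun v _ => Finset.sum_congr rfl fun i _ => ?_
  ring

theorem exists_choi_eq_sum (hΛ : IsPostselective Λ) (h : IsStabilizerMixture (normalizedChoi Λ)) :
    ∃ (d : ℕ) (lam : ℕ → ℝ≥0) (C : ℕ → Tableau (b + a) (Fin b ⊕ Fin a))
      (φ : ℕ → (Fin b ⊕ Fin a → Fin 2) → ℂ), (∀ i, (C i).Describes (φ i)) ∧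
      choi Λ = ∑ i ∈ Finset.range d, (lam i : ℂ) • proj (φ i) := by
  obtain ⟨t, ht, htr⟩ := hΛ.exists_trace_choi
  obtain ⟨S, hS⟩ := (stabStates_finite (Fin b ⊕ Fin a)).exists_finset_coe
  rw [IsStabilizerMixture, ← hS, Finset.mem_convexHull'] at h
  obtain ⟨w, hw, hw1, hsum⟩ := h
  have hchoi : choi Λ = ∑ ρ ∈ S, ((t * w ρ : ℝ) : ℂ) • ρ := by
    have : choi Λ = (t : ℂ) • normalizedChoi Λ := by
      rw [normalizedChoi, htr, smul_smul, mul_inv_cancel₀ (by exact_mod_cast ht.ne'), one_smul]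
    rw [this, ← hsum, Finset.smul_sum]
    refine Finset.sum_congr rfl fun ρ _ => ?_
    rw [Complex.ofReal_mul, mul_smul]
    rfl
  have hne : S.Nonempty := by
    rw [Finset.nonempty_iff_ne_empty]
    rintro rfl
    simp at hw1
  have hcard : Fintype.card (Fin b ⊕ Fin a) = b + a := by simp
  have hdesc : ∀ ρ : S, ∃ (C : Tableau (b + a) (Fin b ⊕ Fin a)) (φ : (Fin b ⊕ Fin a → Fin 2) → ℂ),
      C.Describes φ ∧ ρ.1 = proj φ := by
    rintro ⟨ρ, hρ⟩
    obtain ⟨C, φ, hC⟩ : ρ ∈ stabStates _ := hS ▸ Finset.mem_coe.mpr hρ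
    rw [← hcard]
    exact ⟨C, φ, hC⟩
  choose C φ hC hφ using hdesc
  -- Indices out of range repeat some state, so that every index has a valid tableau.
  let e : ℕ → S := fun i => if h : i < S.card then S.equivFin.symm ⟨i, h⟩ else ⟨_, hne.choose_spec⟩
  refine ⟨S.card, fun i => ⟨t * w (e i), mul_nonneg ht.le (hw _ (e i).2)⟩, fun i => C (e i),
    fun i => φ (e i), fun i => hC _, ?_⟩
  rw [hchoi, Finset.sum_range, ← Finset.sum_coe_sort, ← Equiv.sum_comp S.equivFin.symm]
  refine Finset.sum_congr rfl fun i _ => ?_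
  have he : e i = S.equivFin.symm i := dif_pos i.2
  rw [← hφ]
  change _ = ((t * w (e i) : ℝ) : ℂ) • (e i : Op (Fin b ⊕ Fin a))
  rw [he]


theorem efficientlySimulable_of_mixture (hΛ : IsPostselective Λ)
    (h : IsStabilizerMixture (normalizedChoi Λ)) : EfficientlySimulable Λ := by
  obtain ⟨d, lam, C, φ, hC, hchoi⟩ := exists_choi_eq_sum hΛ h
  have htame : (Prog.seq (setFlags a) (tree C lam d 1)).Tame :=
    ⟨setFlags_tame a, tree_tame C lam d 1⟩
  obtain ⟨P, hP⟩ := htame.polynomial_time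
  refine ⟨Prog.seq (setFlags a) (tree C lam d 1), P, fun n s T ψ hT => ?_⟩
  obtain ⟨val, hval⟩ := simulation hT hC (applyAt_eq_sum hchoi s ψ)
    (trace_applyAt_le s hΛ hT.unit)
  have hn : inputMemory T s 4 0 0 = n := by simp [inputMemory]
  refine ⟨val, fun o ho => ⟨?_, hval.support o ho⟩, hval.mean⟩
  have := (hP _ o ho).1
  rwa [hn] at this

end decomposition

/-! ### Quasiprobability decompositions and convex hulls -/

section hull

variable {Q : Type} [Fintype Q] [DecidableEq Q] {S : Set (Op Q)} {ρ : Op Q}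

theorem exists_separating (hS : S.Finite) (h : ρ ∉ convexHull ℝ S) :
    ∃ (f : Op Q →L[ℝ] ℝ) (u : ℝ), (∀ σ ∈ S, f σ < u) ∧ u < f ρ := by
  have : LocallyConvexSpace ℝ (Op Q) :=
    inferInstanceAs (LocallyConvexSpace ℝ ((Q → Fin 2) → (Q → Fin 2) → ℂ))
  obtain ⟨f, u, h1, h2⟩ := geometric_hahn_banach_closed_point (convex_convexHull ℝ S)
    (hS.isCompact_convexHull ℝ).isClosed h
  exact ⟨f, u, fun σ hσ => h1 σ (subset_convexHull ℝ S hσ), h2⟩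

theorem one_le_quasiCost (S : Set (Op Q)) (ρ : Op Q) : 1 ≤ quasiCost S ρ := by
  refine le_iInf₂ fun q hq => ?_
  rw [← ENNReal.ofReal_one, ← hq.2]
  exact ENNReal.ofReal_le_ofReal (Finset.sum_le_sum fun _ _ => le_abs_self _)

theorem quasiCost_le_one_of_mem (hS : S.Finite) (h : ρ ∈ convexHull ℝ S) : quasiCost S ρ ≤ 1 := by
  obtain ⟨s, rfl⟩ := hS.exists_finset_coe
  obtain ⟨w, hw, hw1, hsum⟩ := Finset.mem_convexHull'.mp h
  let q : (s : Set (Op Q)) →₀ ℝ := Finsupp.equivFunOnFinite.symm fun σ => w σ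
  have hq1 : (q.sum fun _ c => c) = 1 := by
    rw [Finsupp.sum_fintype _ _ fun _ => rfl, ← hw1]
    exact Finset.sum_coe_sort s w
  have hq : (q.sum fun φ c => (c : ℂ) • (φ : Op Q)) = ρ := by
    rw [Finsupp.sum_fintype _ _ fun _ => by rw [Complex.ofReal_zero, zero_smul], ← hsum]
    exact Finset.sum_coe_sort s fun σ => w σ • σ
  refine (iInf₂_le q ⟨hq, hq1⟩).trans ?_
  have : (q.sum fun _ c => |c|) = q.sum fun _ c => c :=
    Finset.sum_congr rfl fun σ _ => abs_of_nonneg (hw σ σ.2)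
  rw [this, hq1, ENNReal.ofReal_one]

/-- The cost is an infimum, so a decomposition of cost exactly 1 is not at hand. Instead a
separating functional bounds the cost of all decompositions away from 1: reaching beyond the hull
requires a definite amount of negative weight. -/
theorem mem_of_quasiCost_le_one (hS : S.Finite) (h : quasiCost S ρ ≤ 1) : ρ ∈ convexHull ℝ S := by
  by_contra hρ
  obtain ⟨f, u, hf, hu⟩ := exists_separating hS hρ
  obtain ⟨D, hD⟩ := (hS.image fun σ => u - f σ).bddAbove
  set D' := max D 1
  have hD' : 0 < D' := lt_max_of_lt_right one_pos
  have key : ENNReal.ofReal (1 + 2 * (f ρ - u) / D') ≤ quasiCost S ρ := by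
    refine le_iInf₂ fun q hq => ENNReal.ofReal_le_ofReal ?_
    have h1 : (q.sum fun σ c => c * (u - f σ)) = u - f ρ := by
      rw [← hq.1, Finsupp.sum, Finsupp.sum, map_sum]
      simp only [mul_sub, Finset.sum_sub_distrib, ← Finset.sum_mul]
      have : ∑ c ∈ q.support, q c = 1 := hq.2
      rw [this, one_mul]
      congr 1
      refine Finset.sum_congr rfl fun σ _ => ?_
      rw [Complex.coe_smul, map_smul, smul_eq_mul]
    -- The gap `u - f σ` lies between 0 and `D'`, so only negative coefficients lower the right-hand
    -- sum, each by at most `D' |c|`.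
    have h2 : (q.sum fun σ c => -(D' / 2) * (|c| - c)) ≤ q.sum fun σ c => c * (u - f σ) := by
      refine Finset.sum_le_sum fun σ _ => ?_
      have g1 : u - f σ ≤ D' := (hD ⟨σ, σ.2, rfl⟩).trans (le_max_left _ _)
      have g0 : 0 ≤ u - f σ := (sub_pos.mpr (hf σ σ.2)).le
      change -(D' / 2) * (|q σ| - q σ) ≤ q σ * (u - f σ)
      rcases le_total 0 (q σ) with hc | hc
      · rw [abs_of_nonneg hc, sub_self, mul_zero]
        exact mul_nonneg hc g0
      · rw [abs_of_nonpos hc]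
        nlinarith
    have h3 : (q.sum fun σ c => -(D' / 2) * (|c| - c)) = -(D' / 2) * ((q.sum fun _ c => |c|) - 1) := by
      rw [← hq.2]
      simp only [Finsupp.sum, ← Finset.sum_sub_distrib, Finset.mul_sum]
    rw [h1, h3] at h2
    rw [← le_sub_iff_add_le', div_le_iff₀ hD']
    linarith
  have h1 : (1 : ℝ≥0∞) < ENNReal.ofReal (1 + 2 * (f ρ - u) / D') := by
    rw [← ENNReal.ofReal_one]
    refine (ENNReal.ofReal_lt_ofReal_iff_of_nonneg zero_le_one).mpr ?_
    have : 0 < 2 * (f ρ - u) / D' := div_pos (by linarith) hD'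
    linarith
  exact absurd (h1.trans_le (key.trans h)) (lt_irrefl _)

theorem quasiCost_le_one_iff (hS : S.Finite) : quasiCost S ρ ≤ 1 ↔ ρ ∈ convexHull ℝ S :=
  ⟨mem_of_quasiCost_le_one hS, quasiCost_le_one_of_mem hS⟩

/-- The mean of a random element of a finite set is in its convex hull. -/
theorem mean_mem_convexHull {Ω : Type} (hS : S.Finite) {p : PMF Ω} {value : Ω → Op Q}
    (hv : ∀ o ∈ p.support, value o ∈ S)
    (hρ : HasSum (fun o => ((p o).toReal : ℂ) • value o) ρ) : ρ ∈ convexHull ℝ S := by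
  by_contra h
  -- The mean may be an infinite sum, so convexity is used through a functional: its average over
  -- values below `u` cannot exceed `u`.
  obtain ⟨f, u, hf, hu⟩ := exists_separating hS h
  have h1 : HasSum (fun o => (p o).toReal * u) u := by
    have := (ENNReal.hasSum_toReal p.tsum_coe_ne_top).mul_right u
    rwa [← ENNReal.tsum_toReal_eq p.apply_ne_top, p.tsum_coe, ENNReal.toReal_one, one_mul] at this
  have h2 : HasSum (fun o => (p o).toReal * f (value o)) (f ρ) := by
    convert f.hasSum hρ using 2 with o
    rw [Complex.coe_smul, map_smul, smul_eq_mul]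
  refine absurd (hasSum_le (fun o => ?_) h2 h1) (not_le.mpr hu)
  by_cases ho : p o = 0
  · simp [ho]
  · exact mul_le_mul_of_nonneg_left (hf _ (hv o ((PMF.mem_support_iff _ _).mpr ho))).le
      ENNReal.toReal_nonneg

end hull

theorem robustness_eq_one_iff {Q : Type} [Fintype Q] [DecidableEq Q] (ρ : Op Q) :
    robustness ρ = 1 ↔ IsStabilizerMixture ρ := by
  rw [IsStabilizerMixture, ← quasiCost_le_one_iff (stabStates_finite Q)]
  exact ⟨fun h => h.le, fun h => le_antisymm h (one_le_quasiCost _ _)⟩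

theorem robustnessAbort_le_one_iff {Q : Type} [Fintype Q] [DecidableEq Q] (ρ : Op Q) :
    robustnessAbort ρ ≤ 1 ↔ ρ ∈ convexHull ℝ (insert 0 (stabStates Q)) :=
  quasiCost_le_one_iff ((stabStates_finite Q).insert 0)

theorem Tableau.Describes.mem_stabStates {k : ℕ} {Q : Type} [Fintype Q] [DecidableEq Q]
    {T : Tableau k Q} {φ : (Q → Fin 2) → ℂ} (h : T.Describes φ) : proj φ ∈ stabStates Q := by
  obtain rfl := h.card_eq
  exact ⟨T, φ, h, rfl⟩

theorem exists_tableau {k : ℕ} {Q : Type} [Fintype Q] [DecidableEq Q] (hk : k = Fintype.card Q)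
    {ρ : Op Q} (h : ρ ∈ stabStates Q) :
    ∃ (T : Tableau k Q) (φ : (Q → Fin 2) → ℂ), T.Describes φ ∧ ρ = proj φ := by
  subst hk
  exact h

/-! ### Cost at most one -/

section cost

variable {a b : ℕ} {Λ : Op (Fin a) →ₗ[ℂ] Op (Fin b)}

theorem channelCost_le_one_iff : channelCost Λ ≤ 1 ↔ ∀ (n : ℕ) (s : Fin a ↪ Fin n),
    ∀ ρ ∈ stabStates (Fin n), applyAt Λ s ρ ∈ convexHull ℝ (insert 0 (stabStates (Fin b ⊕ Rest s))) := by
  simp only [channelCost, iSup_le_iff, robustnessAbort_le_one_iff]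

/-- For the forward direction an otherwise empty circuit suffices: its sample number is positive and
finite, and the squared cost is the only change. Conversely the product of costs is monotone. -/
theorem doesNotIncreaseSamples_iff : DoesNotIncreaseSamples Λ ↔ channelCost Λ ≤ 1 := by
  constructor
  · intro h
    have h1 := h 1 (1 / 2) 1 one_pos (by norm_num) (by norm_num) one_pos [] []
    have hlog : 0 < 1 / (2 * (1 : ℝ) ^ 2) * Real.log (2 / (1 / 2)) :=
      mul_pos (by norm_num) (Real.log_pos (by norm_num))
    rw [requiredSamples, requiredSamples,
      ENNReal.mul_le_mul_iff_right (ENNReal.ofReal_pos.mpr hlog).ne' ENNReal.ofReal_ne_top] at h1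
    simp only [List.nil_append, List.prod_cons, List.prod_nil, mul_one, ENNReal.ofReal_one] at h1
    by_contra! hc
    have h2 : (2 : ℝ≥0∞) < 2 * channelCost Λ := by
      have := (ENNReal.mul_lt_mul_iff_right (a := 2) (by norm_num) (by norm_num)).mpr hc
      rwa [mul_one] at this
    exact absurd h1 (not_le.mpr (ENNReal.pow_lt_pow_left two_ne_zero h2))
  · intro h ε δ M _ _ _ _ before after
    rw [requiredSamples, requiredSamples, List.prod_append, List.prod_append, List.prod_cons]
    have : channelCost Λ * after.prod ≤ after.prod := mul_le_of_le_one_left' h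
    gcongr

theorem EfficientlySimulable.channelCost_le_one (h : EfficientlySimulable Λ) :
    channelCost Λ ≤ 1 := by
  obtain ⟨S, P, hS⟩ := h
  rw [channelCost_le_one_iff]
  intro n s ρ hρ
  obtain ⟨T, ψ, hT, rfl⟩ := exists_tableau (Fintype.card_fin n).symm hρ
  obtain ⟨value, h1, h2⟩ := hS n s T ψ hT
  have h3 : ∀ o ∈ (S.exec (inputMemory T s)).support,
      value o.1 ∈ insert 0 (stabStates (Fin b ⊕ Rest s)) := by
    intro o ho
    obtain ⟨-, h0⟩ | ⟨-, T', φ, -, hT', hφ⟩ := (h1 o ho).2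
    · exact Or.inl h0
    · exact Or.inr (hφ ▸ hT'.mem_stabStates)
  exact mean_mem_convexHull ((stabStates_finite _).insert 0) h3 h2

end cost

/-! ### Relabelling registers -/

section relabel

variable {Q Q' : Type} [Fintype Q] [DecidableEq Q] [Fintype Q'] [DecidableEq Q']

/-- Relabel the qubits of an operator. -/
def relabel (ε : Q ≃ Q') : Op Q' →ₗ[ℝ] Op Q where
  toFun ρ := ρ.submatrix (fun g => g ∘ ε.symm) fun g => g ∘ ε.symm
  map_add' _ _ := rfl
  map_smul' _ _ := rfl

theorem sum_relabel (ε : Q ≃ Q') (F : (Q' → Fin 2) → ℂ) : ∑ g : Q → Fin 2, F (g ∘ ε.symm) = ∑ g, F g :=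
  Equiv.sum_comp (Equiv.arrowCongr ε (Equiv.refl (Fin 2))) F

theorem Tableau.Describes.relabel {k : ℕ} {T : Tableau k Q'} {φ : (Q' → Fin 2) → ℂ}
    (h : T.Describes φ) (ε : Q ≃ Q') :
    (Tableau.mk (fun i q => T.x i (ε q)) (fun i q => T.z i (ε q)) T.sign).Describes
      fun g => φ (g ∘ ε.symm) where
  card_eq := h.card_eq.trans (Fintype.card_congr ε).symm
  independent := by
    refine h.independent.map' ((LinearMap.funLeft (ZMod 2) (ZMod 2) ε).prodMap
      (LinearMap.funLeft (ZMod 2) (ZMod 2) ε)) (LinearMap.ker_eq_bot.mpr ?_)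
    have := LinearMap.funLeft_injective_of_surjective (ZMod 2) (ZMod 2) ε ε.surjective
    exact Prod.map_injective.mpr ⟨this, this⟩
  unit := by
    rw [← h.unit]
    exact sum_relabel ε fun g => star φ g * φ g
  fixed i := by
    funext g
    have h1 := congrFun (h.fixed i) (g ∘ ε.symm)
    rw [← h1]
    simp only [Matrix.mulVec, dotProduct]
    rw [← sum_relabel ε]
    refine Finset.sum_congr rfl fun f _ => ?_
    congr 1
    simp only [Tableau.generator, Matrix.smul_apply, pauliOp, Matrix.of_apply]
    congr 1
    exact Fintype.prod_equiv ε _ _ fun q => by simp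

theorem relabel_mem_convexHull (ε : Q ≃ Q') {ρ : Op Q'}
    (h : ρ ∈ convexHull ℝ (insert 0 (stabStates Q'))) :
    relabel ε ρ ∈ convexHull ℝ (insert 0 (stabStates Q)) := by
  have h1 : relabel ε '' insert 0 (stabStates Q') ⊆ insert 0 (stabStates Q) := by
    rintro _ ⟨_, rfl | ⟨T, φ, hT, rfl⟩, rfl⟩
    · exact Or.inl (map_zero _)
    · exact Or.inr (hT.relabel ε).mem_stabStates
  refine convexHull_mono h1 ?_
  rw [← LinearMap.image_convexHull]
  exact ⟨ρ, h, rfl⟩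

end relabel

/-! ### The Bell state as a stabilizer state -/

section bell

variable {a : ℕ}

/-- The sign of `Z ^ z` at a basis state. -/
def zSign (z : ZMod 2) (h : Fin 2) : ℂ := if z = 1 ∧ h = 1 then -1 else 1

/-- The action of `X ^ x` on a basis state. -/
def flipBit (x : ZMod 2) (g : Fin 2) : Fin 2 := if x = 0 then g else g + 1

theorem flipBit_injective (x : ZMod 2) : Function.Injective (flipBit x) := by
  intro g h hgh
  rw [flipBit, flipBit] at hgh
  split_ifs at hgh
  · exact hgh
  · exact add_right_cancel hgh

theorem xz_apply (x z : ZMod 2) (g h : Fin 2) :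
    xz x z g h = if h = flipBit x g then zSign z h else 0 := by
  rcases zmod2_cases x with rfl | rfl <;> rcases zmod2_cases z with rfl | rfl <;>
    fin_cases g <;> fin_cases h <;> simp [xz, zSign, flipBit]

theorem hz_mulVec {W : Type} [Fintype W] [DecidableEq W] (v : V2 W) (ψ : (W → Fin 2) → ℂ)
    (g : W → Fin 2) : (hz v *ᵥ ψ) g =
      (∏ w, zSign (v.2 w) (flipBit (v.1 w) (g w))) * ψ fun w => flipBit (v.1 w) (g w) := by
  rw [Matrix.mulVec, dotProduct, Finset.sum_eq_single fun w => flipBit (v.1 w) (g w)]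
  · simp [hz, tens, xz_apply]
  · intro h _ hne
    obtain ⟨w, hw⟩ := Function.ne_iff.mp hne
    have : hz v g h = 0 := Finset.prod_eq_zero (Finset.mem_univ w)
      ((xz_apply _ _ _ _).trans (if_neg hw))
    rw [this, zero_mul]
  · exact fun h => absurd (Finset.mem_univ _) h

/-- The pair to which a qubit of the Bell state belongs. -/
def pairIndex (q : Fin (a + a)) : Fin a := Fin.addCases (motive := fun _ => Fin a) id id q

theorem pairIndex_castAdd (j : Fin a) : pairIndex (Fin.castAdd a j) = j := by
  simp [pairIndex]

theorem pairIndex_natAdd (j : Fin a) : pairIndex (Fin.natAdd a j) = j := by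
  simp [pairIndex, -Fin.natAdd_eq_addNat]

/-- The tableau of the Bell state. -/
def bellTableau (a : ℕ) : Tableau (a + a) (Fin (a + a)) where
  x i q := Fin.addCases (motive := fun _ => ZMod 2) (fun j => if pairIndex q = j then 1 else 0)
    (fun _ => 0) i
  z i q := Fin.addCases (motive := fun _ => ZMod 2) (fun _ => 0)
    (fun j => if pairIndex q = j then 1 else 0) i
  sign _ := 0

/-- The Bell state on a linearly ordered register. -/
def bellState (a : ℕ) (f : Fin (a + a) → Fin 2) : ℂ :=
  bell (Fin a → Fin 2) (fun i => f (Fin.castAdd a i), fun i => f (Fin.natAdd a i))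

/-- The generators are `X ⊗ X` and `Z ⊗ Z` on each pair. The former flips the same bit in both
halves and preserves their equality; the latter acts by two equal signs. -/
theorem bellTableau_describes (a : ℕ) : (bellTableau a).Describes (bellState a) where
  card_eq := (Fintype.card_fin _).symm
  independent := by
    rw [Fintype.linearIndependent_iff]
    intro c hc i
    have h1 := congrArg Prod.fst hc
    have h2 := congrArg Prod.snd hc
    rw [Prod.fst_sum] at h1
    rw [Prod.snd_sum] at h2
    refine Fin.addCases (fun j => ?_) (fun j => ?_) i
    · have := congrFun h1 (Fin.castAdd a j)
      simpa [Finset.sum_apply, Fin.sum_univ_add, bellTableau, pairIndex_castAdd,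
        -Fin.natAdd_eq_addNat] using this
    · have := congrFun h2 (Fin.castAdd a j)
      simpa [Finset.sum_apply, Fin.sum_univ_add, bellTableau, pairIndex_castAdd,
        -Fin.natAdd_eq_addNat] using this
  unit := by
    have h1 : star (bellState a) ⬝ᵥ bellState a = ∑ g : Fin a → Fin 2, ∑ h : Fin a → Fin 2,
        star (bell (Fin a → Fin 2) (g, h)) * bell (Fin a → Fin 2) (g, h) :=
      sum_product finSumFinEquiv fun g h =>
        star (bell (Fin a → Fin 2) (g, h)) * bell (Fin a → Fin 2) (g, h)
    have h2 : ((1 / Real.sqrt (Fintype.card (Fin a → Fin 2)) : ℝ) : ℂ) *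
        ((1 / Real.sqrt (Fintype.card (Fin a → Fin 2)) : ℝ) : ℂ) = ((2 : ℂ) ^ a)⁻¹ := by
      rw [← Complex.ofReal_mul, ← mul_div_mul_comm, Real.mul_self_sqrt (Nat.cast_nonneg _), card_basis]
      push_cast
      rw [one_mul, one_div, Fintype.card_fin]
    have h3 : ∀ g h : Fin a → Fin 2, star (bell (Fin a → Fin 2) (g, h)) * bell (Fin a → Fin 2) (g, h) =
        if g = h then ((2 : ℂ) ^ a)⁻¹ else 0 := by
      intro g h
      simp only [bell]
      split_ifs
      · rw [Complex.star_def, Complex.conj_ofReal, h2]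
      · simp
    rw [h1]
    simp only [h3]
    simp
  fixed i := by
    rw [generator_eq]
    have hy : yCount ((bellTableau a).x i, (bellTableau a).z i) = 0 := by
      refine Finset.sum_eq_zero fun q _ => ?_
      refine Fin.addCases (fun j => ?_) (fun j => ?_) i <;> simp [bellTableau, lift4, -Fin.natAdd_eq_addNat]
    have hs : lift4 ((bellTableau a).sign i) = 0 := by simp [bellTableau, lift4]
    rw [hy, hs, mul_zero, add_zero, ip_zero, one_smul]
    funext g
    rw [hz_mulVec]
    refine Fin.addCases (fun j => ?_) (fun j => ?_) i
    · have h1 : ∀ q, (bellTableau a).z (Fin.castAdd a j) q = 0 := fun q => by simp [bellTableau]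
      have h2 : ∀ q, (bellTableau a).x (Fin.castAdd a j) q = if pairIndex q = j then 1 else 0 :=
        fun q => by simp [bellTableau]
      simp only [h1, h2, zSign, bellState, bell, zero_ne_one, false_and, if_false,
        Finset.prod_const_one, one_mul, funext_iff, pairIndex_castAdd, pairIndex_natAdd,
        (flipBit_injective _).eq_iff]
    · have h1 : ∀ q, (bellTableau a).x (Fin.natAdd a j) q = 0 := fun q => by
        simp [bellTableau, -Fin.natAdd_eq_addNat]
      have h2 : ∀ q, (bellTableau a).z (Fin.natAdd a j) q = if pairIndex q = j then 1 else 0 :=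
        fun q => by simp [bellTableau, -Fin.natAdd_eq_addNat]
      simp only [h1, h2, flipBit, if_true]
      -- Where the halves agree the signs of each pair cancel; elsewhere the amplitude is zero.
      by_cases hg : (fun i => g (Fin.castAdd a i)) = fun i => g (Fin.natAdd a i)
      · have : ∏ w, zSign (if pairIndex w = j then 1 else 0) (g w) = 1 := by
          rw [Fin.prod_univ_add, ← Finset.prod_mul_distrib]
          refine Finset.prod_eq_one fun k _ => ?_
          rw [congrFun hg k, pairIndex_castAdd, pairIndex_natAdd, zSign]
          split_ifs <;> norm_num
        rw [this, one_mul]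
      · have : bellState a g = 0 := if_neg hg
        rw [this, mul_zero]

/-- The first half of the register of the Bell state. -/
def firstHalf (a : ℕ) : Fin a ↪ Fin (a + a) := Fin.castAddEmb a

/-- The second half of the register of the Bell state. -/
def secondHalf (a : ℕ) : Fin a ≃ Rest (firstHalf a) :=
  Equiv.ofBijective (fun j => ⟨Fin.natAdd a j, fun i h => by
    have := congrArg Fin.val h
    simp [firstHalf] at this
    omega⟩) <| by
    constructor
    · intro i j h
      simpa using h
    · rintro ⟨q, hq⟩
      induction q using Fin.addCases with
      | left i => exact absurd rfl (hq i)
      | right i => exact ⟨i, rfl⟩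

theorem bellState_joinBasis (u : Fin a → Fin 2) (κ : Rest (firstHalf a) → Fin 2) :
    bellState a (joinBasis (firstHalf a) u κ) = bell (Fin a → Fin 2) (u, κ ∘ secondHalf a) := by
  rw [bellState]
  congr 2
  · funext i
    have : (partEquiv (firstHalf a)).symm (Fin.castAdd a i) = Sum.inl i := by
      rw [Equiv.symm_apply_eq]
      rfl
    rw [joinBasis_apply, this, Sum.elim_inl]
  · funext i
    have : (partEquiv (firstHalf a)).symm (Fin.natAdd a i) = Sum.inr (secondHalf a i) := by
      rw [Equiv.symm_apply_eq]
      rfl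
    rw [joinBasis_apply, this, Sum.elim_inr, Function.comp_apply]

variable {b : ℕ} {Λ : Op (Fin a) →ₗ[ℂ] Op (Fin b)}

/-- The Choi state is an instance of applying the channel to part of a stabilizer state; only the
names of the reference qubits differ. -/
theorem relabel_applyAt_bellState (Λ : Op (Fin a) →ₗ[ℂ] Op (Fin b)) :
    relabel (Equiv.sumCongr (Equiv.refl (Fin b)) (secondHalf a))
      (applyAt Λ (firstHalf a) (proj (bellState a))) = choi Λ := by
  ext g h
  have h1 : ∀ f : Fin b ⊕ Fin a → Fin 2,
      ((f ∘ (Equiv.sumCongr (Equiv.refl (Fin b)) (secondHalf a)).symm) ∘ Sum.inr) ∘ secondHalf a =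
        f ∘ Sum.inr := by
    intro f
    funext i
    simp
  have h2 : (Matrix.of fun u v => proj (bellState a)
      (joinBasis (firstHalf a) u
        ((g ∘ (Equiv.sumCongr (Equiv.refl (Fin b)) (secondHalf a)).symm) ∘ Sum.inr))
      (joinBasis (firstHalf a) v
        ((h ∘ (Equiv.sumCongr (Equiv.refl (Fin b)) (secondHalf a)).symm) ∘ Sum.inr))) =
      Matrix.of fun u v => proj (bell (Fin a → Fin 2)) (u, g ∘ Sum.inr) (v, h ∘ Sum.inr) := by
    ext u v
    simp only [Matrix.of_apply, proj, Matrix.vecMulVec_apply, Pi.star_apply, bellState_joinBasis, h1]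
  exact congrArg (fun M => Λ M (g ∘ Sum.inl) (h ∘ Sum.inl)) h2

theorem isStabilizerMixture_of_channelCost (hΛ : IsPostselective Λ) (h : channelCost Λ ≤ 1) :
    IsStabilizerMixture (normalizedChoi Λ) := by
  have h1 := relabel_mem_convexHull (Equiv.sumCongr (Equiv.refl (Fin b)) (secondHalf a))
    (channelCost_le_one_iff.mp h _ (firstHalf a) _ (bellTableau_describes a).mem_stabStates)
  rw [relabel_applyAt_bellState] at h1
  obtain ⟨t, ht, htr⟩ := hΛ.exists_trace_choi
  obtain ⟨S, hS⟩ := (stabStates_finite (Fin b ⊕ Fin a)).exists_finset_coe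
  rw [← hS, ← Finset.coe_insert, Finset.mem_convexHull'] at h1
  obtain ⟨w, hw, -, hsum⟩ := h1
  -- The abort outcome contributes nothing and is dropped. The remaining weights sum to the trace
  -- `t`, so dividing by `t` makes the combination convex.
  rw [Finset.sum_insert_of_eq_zero_if_notMem (f := fun ρ => w ρ • ρ) fun _ => smul_zero _] at hsum
  have hwt : ∑ ρ ∈ S, w ρ = t := by
    have h2 : ∑ ρ ∈ S, (w ρ : ℂ) = t := by
      rw [← htr, ← hsum, Matrix.trace_sum]
      refine Finset.sum_congr rfl fun ρ hρ => ?_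
      obtain ⟨T, φ, hT, rfl⟩ : ρ ∈ stabStates _ := hS ▸ Finset.mem_coe.mpr hρ
      have h3 : (proj φ).trace = 1 := by
        rw [proj, Matrix.trace_vecMulVec, dotProduct_comm]
        exact hT.unit
      rw [Matrix.trace_smul, h3, Complex.real_smul, mul_one]
    exact_mod_cast h2
  rw [IsStabilizerMixture, ← hS, Finset.mem_convexHull']
  refine ⟨fun ρ => t⁻¹ * w ρ, fun ρ hρ => mul_nonneg (inv_nonneg.mpr ht.le)
    (hw ρ (Finset.mem_insert_of_mem hρ)), ?_, ?_⟩
  · rw [← Finset.mul_sum, hwt, inv_mul_cancel₀ ht.ne']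
  · simp only [mul_smul]
    rw [← Finset.smul_sum, hsum, normalizedChoi, htr, ← Complex.ofReal_inv]
    rfl

end bell

end StabProp

end

/-! ### The equivalences -/

open StabProp in
theorem mainTheorem1 (a b : ℕ) (Λ : Op (Fin a) →ₗ[ℂ] Op (Fin b)) (hΛ : IsPostselective Λ) :
    List.TFAE
      [robustness (normalizedChoi Λ) = 1,
       IsStabilizerMixture (normalizedChoi Λ),
       DoesNotIncreaseSamples Λ,
       EfficientlySimulable Λ] := by
  tfae_have 1 ↔ 2 := robustness_eq_one_iff _
  tfae_have 2 → 4 := efficientlySimulable_of_mixture hΛ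
  tfae_have 4 → 3 := fun h => doesNotIncreaseSamples_iff.mpr h.channelCost_le_one
  tfae_have 3 → 2 := fun h =>
    isStabilizerMixture_of_channelCost hΛ (doesNotIncreaseSamples_iff.mp h)
  tfae_finish
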